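/- **Setting.** Consider $\min_{x\in\mathbb R^n} F(x):=g_0(x)+\delta_{\mathbb R^m_-}(g(x))+\phi(x)$ with $g=(g_1,\dots,g_m)$ and $\Gamma:=g^{-1}(\mathbb R^m_-)\neq\emptyset$, where $g_0:\mathbb R^n\to(-\infty,\infty]$ is finite, locally Lipschitz and upper-$\mathcal C^2$ at every point of an open convex set $\mathcal O\supset\Gamma$, each $g_i:\mathbb R^n\to\mathbb R$ ($1\le i\le m$) is locally Lipschitz and upper-$\mathcal C^2$ on $\mathbb R^n$, $\phi:\mathbb R^n\to\mathbb R$ is convex, and $F$ is bounded below on $\Gamma$. Here $h$ is upper-$\mathcal C^2$ at $\bar x$ if near $\bar x$ it equals $\min_{s\in\Delta}\{\frac\rho2\|x\|^2-\langle b(s),x\rangle-c(s)\}$ for some $\rho\ge0$, a compact $\Delta\subset\mathbb R^p$ and continuous $b,c$ on $\Delta$. Let $\partial$ be the limiting subdifferential, $\partial g(x):=\{V\in\mathbb R^{n\times m}: V_i\in\partial g_i(x)\ \forall i\}$ ($V_i$ is the $i$th column), $\mathcal N_C$ the normal cone to a convex set $C$, and $\Gamma^*$ the set of stationary points, i.e.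 of $x\in\Gamma$ with $0\in\partial g_0(x)+\partial\phi(x)+\bigcup_{\zeta\in\mathcal N_{\mathbb R^m_-}(g(x))}\sum_i\zeta_i\partial g_i(x)$. Put $G(x,s,V,L):=g(s)+V^\top(x-s)+\frac12\|x-s\|^2L$. **Inexact MBA method.** Input: $0<\mu_{\min}\le\mu_{\max}$, $0<L_{\min}\le L_{\max}$, $M,\beta_C,\beta_S,\alpha>0$, $\tau>1$, $x^0\in\Gamma$. At iteration $k=0,1,2,\dots$ choose $\xi^k\in\partial g_0(x^k)$, $V^k\in\partial g(x^k)$, $\mu_{k,0}\in[\mu_{\min},\mu_{\max}]$, $L^{k,0}\in[L_{\min},L_{\max}]^m$. For $j=0,1,\dots$ choose a self-adjoint $\mathcal Q_{k,j}$ with $\mu_{k,j}\mathcal I\preceq\mathcal Q_{k,j}\preceq(\mu_{k,j}+M)\mathcal I$ and put $$\vartheta_{k,j}(x):=g_0(x^k)+\langle\xi^k,x-x^k\rangle+\tfrac12\langle x-x^k,\mathcal Q_{k,j}(x-x^k)\rangle,\quad F_{k,j}:=\vartheta_{k,j}+\phi,\quad G_{k,j}:=G(\cdot,x^k,V^k,L^{k,j}).$$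 The subproblem is to minimize $F_{k,j}$ subject to $G_{k,j}(x)\in\mathbb R^m_-$; its unique solution is denoted $\bar x^{k,j}$. Compute $y^{k,j}$, $v^{k,j}\in\partial\phi(y^{k,j})$, $\lambda^{k,j}\in\mathbb R^m_+$ such that (with $y,v,\lambda$ for $y^{k,j},v^{k,j},\lambda^{k,j}$) $F_{k,j}(y)\le F_{k,j}(x^k)$, $$\big(-\langle\lambda,G_{k,j}(y)\rangle\big)_++\big\|[G_{k,j}(y)]_+\big\|_\infty\le\tfrac{\beta_C}2\|y-x^k\|^2,\qquad \big\|\nabla\vartheta_{k,j}(y)+v+\nabla G_{k,j}(y)\lambda\big\|\le\beta_S\|y-x^k\|.$$ If $g(y)\in\mathbb R^m_-$ and $F(y)\le F(x^k)-\frac\alpha2\|y-x^k\|^2$, set $j_k:=j$ and stop the inner loop; otherwise, if $g(y)\notin\mathbb R^m_-$, set $(L^{k,j+1},\mu_{k,j+1}):=(\tau L^{k,j},\mu_{k,j})$; otherwise set $(L^{k,j+1},\mu_{k,j+1}):=(L^{k,j},\tau\mu_{k,j})$. Then $x^{k+1}:=y^{k,j_k}$, $L^k:=L^{k,j_k}$,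 $\mathcal Q_k:=\mathcal Q_{k,j_k}$, $\bar x^k:=\bar x^{k,j_k}$. **Theorem 4.2.** Let $\{x^k\}$ be the iterate sequence of an infinite run of this method and $\omega(x^0)$ its set of cluster points. Assume: 1. for all $k$ and $j\le j_k$, the multifunction $x\mapsto G(x,x^k,V^k,L^{k,j})-\mathbb R^m_-$ is metrically subregular at $(\bar x^{k,j},0)$; 2. $\{x^k\}$ is bounded; 3. with $u^k:=(x^k,L^k,V^k,\xi^k,\mathcal Q_k)$, at every cluster point $(u^*,x^*)$ of $\{(u^k,\bar x^k)\}$ the constraint system $H(u,x):=G(x,s,V,L)\in\mathbb R^m_-$, $u=(s,L,V,\xi,\mathcal Q)\in\mathbb U:=\mathbb R^n\times\mathbb R^m_+\times\mathbb R^{n\times m}\times\mathbb R^n\times\mathbb S_+$ ($\mathbb S_+$ the positive semidefinite operators on $\mathbb R^n$), has the partial bounded multiplier property with respect to $x$: there are $\kappa>0$ and a neighbourhood $\mathcal U\times\mathcal V$ of $(u^*,x^*)$ such that for all $u\in\mathcal U\cap\mathbb U$, all $x\in\mathcal V$ in $\mathcal S(u):=\{x: H(u,x)\in\mathbb R^m_-\}$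 and all $y\in\mathcal N_{\mathcal S(u)}(x)$ some $\lambda\in\mathcal N_{\mathbb R^m_-}(H(u,x))$ satisfies $\nabla_xH(u,x)\lambda=y$ and $\|\lambda\|\le\kappa\|y\|$. Let $D\subset\mathcal O$ be a compact convex set whose interior contains $\{x^k\}$, and let $g_i=f_i-h_i$ on $D$ for $i=0,\dots,m$, where $f_i$ is a strongly convex quadratic function and $h_i$ a finite strongly convex function on $\mathbb R^n$. With $h_i^*$ the conjugate of $h_i$, let $$T_0(x,s,\xi):=\langle\xi,x\rangle+f_0(s)-\langle\nabla f_0(s),s\rangle+h_0^*(-\xi+\nabla f_0(s)),$$ $$T_i(x,s,V,L):=\langle V_i,x\rangle+f_i(s)-\langle\nabla f_i(s),s\rangle+h_i^*(-V_i+\nabla f_i(s))+\tfrac12\|x-s\|^2L_i\quad(1\le i\le m),$$ and, for $z=(x,s,V,L,\xi)$ with $L\in\mathbb R^m_+$ and $d\in\mathbb R^n$, let $\Phi(z):=\phi(x)+T_0(x,s,\xi)+\delta_{\mathbb R^m_-}(T(x,s,V,L))$ and $\Phi_{\tilde c}(z,d):=\Phi(z)+\tilde c\|d\|^2$, where $\tilde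 c>0$ is any constant. Let $\mathcal W^*$ be the set of cluster points of $w^k:=(\bar x^k,x^k,V^k,L^k,\xi^k,x^{k+1}-x^k)$. If $\Phi_{\tilde c}$ has the Kurdyka–Łojasiewicz property at every point of $\mathcal W^*$, then $\sum_{k=0}^\infty\|x^{k+1}-x^k\|<\infty$, the whole sequence $\{x^k\}$ converges to some $x^*\in\omega(x^0)$, and $\omega(x^0)\subset\Gamma^*$; in particular $x^*$ is a stationary point. -/

import Mathlib

open Filter Topology Set

namespace MBA

noncomputable section

/-! ### Variational analysis for extended-real-valued functions -/

section Variational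

variable {X : Type*} [NormedAddCommGroup X] [InnerProductSpace ℝ X]

/-- The regular (Fréchet) subdifferential of `h` at `x ∈ dom h`:
`h x' ≥ h x + ⟪v, x' - x⟫ + o(‖x' - x‖)` as `x' → x`. -/
def regSubdiff (h : X → EReal) (x : X) : Set X :=
  {v | h x ≠ ⊤ ∧ h x ≠ ⊥ ∧ ∀ ε : ℝ, 0 < ε → ∀ᶠ x' in 𝓝 x,
    h x + ((inner ℝ v (x' - x) - ε * ‖x' - x‖ : ℝ) : EReal) ≤ h x'}

/-- The limiting (Mordukhovich) subdifferential of `h` at `x ∈ dom h`. -/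
def limSubdiff (h : X → EReal) (x : X) : Set X :=
  {v | h x ≠ ⊤ ∧ h x ≠ ⊥ ∧ ∃ (xs vs : ℕ → X),
    Tendsto xs atTop (𝓝 x) ∧ Tendsto (fun l => h (xs l)) atTop (𝓝 (h x)) ∧
    (∀ l, vs l ∈ regSubdiff h (xs l)) ∧ Tendsto vs atTop (𝓝 v)}

/-- The limiting subdifferential of a finite-valued function. -/
def limSubdiffReal (h : X → ℝ) (x : X) : Set X :=
  limSubdiff (fun y => (h y : EReal)) x

/-- The normal cone to a convex set `C` at `x` (empty when `x ∉ C`). -/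
def normalCone (C : Set X) (x : X) : Set X :=
  {v | x ∈ C ∧ ∀ z ∈ C, inner ℝ v (z - x) ≤ 0}

/-- Metric subregularity of a multifunction `Φ` at `(x, y) ∈ gph Φ`; distances to the empty set
are `∞`. -/
def Subregular {Y : Type*} [NormedAddCommGroup Y] (Φ : X → Set Y) (x : X) (y : Y) : Prop :=
  y ∈ Φ x ∧ ∃ δ > (0 : ℝ), ∃ κ > (0 : ℝ), ∀ x' ∈ Metric.closedBall x δ,
    Metric.infEDist x' {p | y ∈ Φ p} ≤ ENNReal.ofReal κ * Metric.infEDist y (Φ x')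

/-- The half-open interval `[0, η)`, where `η = ∞` is allowed. -/
def desingInterval (η : EReal) : Set ℝ := {t | 0 ≤ t ∧ (t : EReal) < η}

/-- The desingularizing functions: continuous and concave on `[0, η)` with values in `[0, ∞)`,
continuously differentiable on `(0, η)`, zero at zero, with positive derivative on `(0, η)`. -/
def IsDesingularizing (η : EReal) (ψ : ℝ → ℝ) : Prop :=
  ContinuousOn ψ (desingInterval η) ∧ ConcaveOn ℝ (desingInterval η) ψ ∧
  (∀ t ∈ desingInterval η, 0 ≤ ψ t) ∧ ψ 0 = 0 ∧
  ContDiffOn ℝ 1 ψ {t | 0 < t ∧ (t : EReal) < η} ∧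
  ∀ t : ℝ, 0 < t → (t : EReal) < η → 0 < deriv ψ t

/-- The Kurdyka–Łojasiewicz property of `h` at `x ∈ dom ∂h`; the distance from `0` to an empty
subdifferential is `∞`. -/
def HasKL (h : X → EReal) (x : X) : Prop :=
  (limSubdiff h x).Nonempty ∧
  ∃ δ > (0 : ℝ), ∃ η : EReal, 0 < η ∧ ∃ ψ : ℝ → ℝ, IsDesingularizing η ψ ∧
    ∀ y ∈ Metric.closedBall x δ, h x < h y → h y < h x + η →
      1 ≤ ENNReal.ofReal (deriv ψ (h y - h x).toReal) * Metric.infEDist 0 (limSubdiff h y)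

/-- The conjugate `h* (s) = sup_x (⟪x, s⟫ - h x)`, used only for finite strongly convex `h`, for
which the supremum is finite. -/
def conj (h : X → ℝ) (s : X) : ℝ := ⨆ x, (inner ℝ x s - h x)

/-- `f` is a quadratic strongly convex function. -/
def IsStronglyConvexQuadratic (f : X → ℝ) : Prop :=
  (∃ (A : X →L[ℝ] X) (b : X) (c : ℝ),
    ∀ x, f x = (1 / 2) * inner ℝ x (A x) + inner ℝ b x + c) ∧
  ∃ σ > (0 : ℝ), StrongConvexOn univ σ f

end Variational

/-! ### The constrained problem -/

/-- `ℝⁿ` with the Euclidean norm. -/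
abbrev Vec (n : ℕ) := EuclideanSpace ℝ (Fin n)

/-- `ℝ^{n × m}` with the Frobenius inner product, given by its columns: `V i` is the `i`-th
column. -/
abbrev Mat (n m : ℕ) := PiLp 2 (fun _ : Fin m => Vec n)

/-- The nonpositive orthant of `ℝᵐ`. -/
def nonpos (m : ℕ) : Set (Vec m) := {w | ∀ i, w i ≤ 0}

/-- `h` is upper-`C²` at `x`: near `x` it is a minimum, over a compact parameter set, of the
functions `(ρ/2)‖·‖² - ⟪b s, ·⟫ - c s` with `b`, `c` continuous. -/
def UpperC2At {n : ℕ} (h : Vec n → EReal) (x : Vec n) : Prop :=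
  ∃ ρ : ℝ, 0 ≤ ρ ∧ ∃ δ > (0 : ℝ), ∃ (p : ℕ) (Δ : Set (Vec p)) (b : Vec p → Vec n) (c : Vec p → ℝ),
    IsCompact Δ ∧ ContinuousOn b Δ ∧ ContinuousOn c Δ ∧
    ∀ y ∈ Metric.ball x δ,
      IsLeast ((fun s => ((ρ / 2 * ‖y‖ ^ 2 - inner ℝ (b s) y - c s : ℝ) : EReal)) '' Δ) (h y)

/-- The data of the problem of minimizing `g₀ + φ` subject to `g x ∈ ℝ₋ᵐ`. -/
structure Problem (n m : ℕ) where
  g0 : Vec n → EReal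
  g : Vec n → Vec m
  phi : Vec n → ℝ

variable {n m : ℕ}

/-- The feasible set `Γ`. -/
def Problem.feas (P : Problem n m) : Set (Vec n) := {x | P.g x ∈ nonpos m}

open Classical in
/-- The objective `F = g₀ + δ_{ℝ₋ᵐ} ∘ g + φ`. -/
def Problem.F (P : Problem n m) (x : Vec n) : EReal :=
  P.g0 x + (if P.g x ∈ nonpos m then 0 else ⊤) + (P.phi x : EReal)

/-- The limiting subdifferential of `g`, taken columnwise. -/
def Problem.subdiffG (P : Problem n m) (x : Vec n) : Set (Mat n m) :=
  {V | ∀ i, V i ∈ limSubdiffReal (fun y => P.g y i) x}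

/-- The standing assumptions on the problem, `O` being an open convex set around `Γ` on which
`g₀` is regular. -/
structure Problem.Standing (P : Problem n m) (O : Set (Vec n)) : Prop where
  isOpen : IsOpen O
  convex : Convex ℝ O
  feas_subset : P.feas ⊆ O
  feas_nonempty : P.feas.Nonempty
  g0_ne_bot : ∀ x, P.g0 x ≠ ⊥
  g0_ne_top : ∀ x ∈ O, P.g0 x ≠ ⊤
  g0_lip : LocallyLipschitzOn O (fun x => (P.g0 x).toReal)
  g0_upperC2 : ∀ x ∈ O, UpperC2At P.g0 x
  g_lip : ∀ i, LocallyLipschitz (fun x => P.g x i)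
  g_upperC2 : ∀ i x, UpperC2At (fun y => (P.g y i : EReal)) x
  phi_convex : ConvexOn ℝ univ P.phi
  bddBelow : ∃ B : ℝ, ∀ x ∈ P.feas, (B : EReal) ≤ P.F x

/-- The set `Γ*` of stationary points:
`0 ∈ ∂g₀(x) + ∂φ(x) + ⋃_{ζ ∈ N(g(x))} ∑ i, ζ i • ∂gᵢ(x)`. -/
def Problem.stationary (P : Problem n m) : Set (Vec n) :=
  {x | x ∈ P.feas ∧ ∃ ξ ∈ limSubdiff P.g0 x, ∃ v ∈ limSubdiffReal P.phi x,
    ∃ ζ ∈ normalCone (nonpos m) (P.g x), ∃ V ∈ P.subdiffG x,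
      ξ + v + ∑ i, ζ i • V i = 0}

/-- `∇H(x) λ = ∑ i, λ i • ∇Hᵢ(x)` for a differentiable map `H`. -/
def gradMul (H : Vec n → Vec m) (x : Vec n) (lam : Vec m) : Vec n :=
  ∑ i, lam i • gradient (fun y => H y i) x

/-- The partial bounded multiplier property with respect to `x` at `(u, x)` of the parametric
constraint system `H(u, x) ∈ ℝ₋ᵐ`, the parameter ranging over `U`. It is used only for `H`
whose solution sets `{x | H(u, x) ∈ ℝ₋ᵐ}`, `u ∈ U`, are convex. -/
def PartialBMP {A : Type*} [TopologicalSpace A] (U : Set A) (H : A → Vec n → Vec m)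
    (u : A) (x : Vec n) : Prop :=
  H u x ∈ nonpos m ∧ ∃ κ > (0 : ℝ), ∃ N ∈ 𝓝 u, ∃ N' ∈ 𝓝 x,
    ∀ u' ∈ N, u' ∈ U → ∀ x' ∈ N', H u' x' ∈ nonpos m →
      ∀ y ∈ normalCone {p | H u' p ∈ nonpos m} x',
        ∃ lam ∈ normalCone (nonpos m) (H u' x'),
          gradMul (H u') x' lam = y ∧ ‖lam‖ ≤ κ * ‖y‖

/-! ### The inexact moving balls approximation method -/

/-- `G(x, s, V, L) = g(s) + Vᵀ(x - s) + (1/2)‖x - s‖² L`. -/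
def Problem.G (P : Problem n m) (x s : Vec n) (V : Mat n m) (L : Vec m) : Vec m :=
  WithLp.toLp 2 fun i => P.g s i + inner ℝ (V i) (x - s) + 1 / 2 * ‖x - s‖ ^ 2 * L i

/-- `ϑ(x) = g₀(s) + ⟪ξ, x - s⟫ + (1/2)⟪x - s, Q(x - s)⟫`, for `s` with `g₀(s)` finite. -/
def Problem.theta (P : Problem n m) (s ξ : Vec n) (Q : Vec n →L[ℝ] Vec n) (x : Vec n) : ℝ :=
  (P.g0 s).toReal + inner ℝ ξ (x - s) + 1 / 2 * inner ℝ (x - s) (Q (x - s))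

/-- The objective `ϑ + φ` of the subproblem. -/
def Problem.subObj (P : Problem n m) (s ξ : Vec n) (Q : Vec n →L[ℝ] Vec n) (x : Vec n) : ℝ :=
  P.theta s ξ Q x + P.phi x

/-- The feasible set of the subproblem. -/
def Problem.subFeas (P : Problem n m) (s : Vec n) (V : Mat n m) (L : Vec m) : Set (Vec n) :=
  {x | P.G x s V L ∈ nonpos m}

/-- `x` is an optimal solution of the subproblem. -/
def Problem.IsSubSol (P : Problem n m) (s ξ : Vec n) (V : Mat n m) (L : Vec m)
    (Q : Vec n →L[ℝ] Vec n) (x : Vec n) : Prop :=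
  x ∈ P.subFeas s V L ∧ IsMinOn (P.subObj s ξ Q) (P.subFeas s V L) x

/-- The stationarity residual of the subproblem. -/
def Problem.resS (P : Problem n m) (s ξ : Vec n) (V : Mat n m) (L : Vec m)
    (Q : Vec n →L[ℝ] Vec n) (x v : Vec n) (lam : Vec m) : ℝ :=
  ‖gradient (P.theta s ξ Q) x + v + gradMul (fun y => P.G y s V L) x lam‖

/-- The joint complementarity and feasibility violation of the subproblem (the second term is the
`ℓ∞`-norm of the positive part). -/
def Problem.resC (P : Problem n m) (s : Vec n) (V : Mat n m) (L : Vec m)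
    (x : Vec n) (lam : Vec m) : ℝ :=
  max (-inner ℝ lam (P.G x s V L)) 0 + ‖(fun i => max (P.G x s V L i) 0 : Fin m → ℝ)‖

/-- The input parameters of the method. -/
structure Params where
  muMin : ℝ
  muMax : ℝ
  LMin : ℝ
  LMax : ℝ
  M : ℝ
  betaC : ℝ
  betaS : ℝ
  alpha : ℝ
  tau : ℝ
  muMin_pos : 0 < muMin
  muMin_le : muMin ≤ muMax
  LMin_pos : 0 < LMin
  LMin_le : LMin ≤ LMax
  M_pos : 0 < M
  betaC_pos : 0 < betaC
  betaS_pos : 0 < betaS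
  alpha_pos : 0 < alpha
  one_lt_tau : 1 < tau

/-- The quantities generated by the method. `jend k` is the number `j_k` of the inner step at
which the inner loop of iteration `k` ends; inner quantities with index `j > jend k` are
meaningless and never used. -/
structure Trace (n m : ℕ) where
  x : ℕ → Vec n
  xi : ℕ → Vec n
  V : ℕ → Mat n m
  jend : ℕ → ℕ
  mu : ℕ → ℕ → ℝ
  L : ℕ → ℕ → Vec m
  Q : ℕ → ℕ → Vec n →L[ℝ] Vec n
  y : ℕ → ℕ → Vec n
  v : ℕ → ℕ → Vec n
  lam : ℕ → ℕ → Vec m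

/-- The acceptance test of the inner loop, at the trial point `y` of the iterate `s`. -/
def Problem.Accept (P : Problem n m) (α : ℝ) (s y : Vec n) : Prop :=
  P.g y ∈ nonpos m ∧ P.F y ≤ P.F s - ((α / 2 * ‖y - s‖ ^ 2 : ℝ) : EReal)

/-- `T` is an (infinite) run of the inexact moving balls approximation method. -/
structure IsRun (P : Problem n m) (p : Params) (T : Trace n m) : Prop where
  x_zero : T.x 0 ∈ P.feas
  xi_mem : ∀ k, T.xi k ∈ limSubdiff P.g0 (T.x k)
  V_mem : ∀ k, T.V k ∈ P.subdiffG (T.x k)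
  mu_zero : ∀ k, p.muMin ≤ T.mu k 0 ∧ T.mu k 0 ≤ p.muMax
  L_zero : ∀ k i, p.LMin ≤ T.L k 0 i ∧ T.L k 0 i ≤ p.LMax
  Q_lower : ∀ k, ∀ j ≤ T.jend k,
    (T.Q k j - T.mu k j • ContinuousLinearMap.id ℝ (Vec n)).IsPositive
  Q_upper : ∀ k, ∀ j ≤ T.jend k,
    ((T.mu k j + p.M) • ContinuousLinearMap.id ℝ (Vec n) - T.Q k j).IsPositive
  v_mem : ∀ k, ∀ j ≤ T.jend k, T.v k j ∈ limSubdiffReal P.phi (T.y k j)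
  lam_nonneg : ∀ k, ∀ j ≤ T.jend k, ∀ i, 0 ≤ T.lam k j i
  inexact_obj : ∀ k, ∀ j ≤ T.jend k,
    P.subObj (T.x k) (T.xi k) (T.Q k j) (T.y k j)
      ≤ P.subObj (T.x k) (T.xi k) (T.Q k j) (T.x k)
  inexact_C : ∀ k, ∀ j ≤ T.jend k,
    P.resC (T.x k) (T.V k) (T.L k j) (T.y k j) (T.lam k j)
      ≤ p.betaC / 2 * ‖T.y k j - T.x k‖ ^ 2
  inexact_S : ∀ k, ∀ j ≤ T.jend k,
    P.resS (T.x k) (T.xi k) (T.V k) (T.L k j) (T.Q k j) (T.y k j) (T.v k j) (T.lam k j)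
      ≤ p.betaS * ‖T.y k j - T.x k‖
  not_accept : ∀ k, ∀ j < T.jend k, ¬ P.Accept p.alpha (T.x k) (T.y k j)
  update_L : ∀ k, ∀ j < T.jend k, P.g (T.y k j) ∉ nonpos m →
    T.L k (j + 1) = p.tau • T.L k j ∧ T.mu k (j + 1) = T.mu k j
  update_mu : ∀ k, ∀ j < T.jend k, P.g (T.y k j) ∈ nonpos m →
    T.L k (j + 1) = T.L k j ∧ T.mu k (j + 1) = p.tau * T.mu k j
  accept : ∀ k, P.Accept p.alpha (T.x k) (T.y k (T.jend k))
  x_succ : ∀ k, T.x (k + 1) = T.y k (T.jend k)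

/-- The accepted `L^k`. -/
def Trace.Lk (T : Trace n m) (k : ℕ) : Vec m := T.L k (T.jend k)

/-- The accepted `Q_k`. -/
def Trace.Qk (T : Trace n m) (k : ℕ) : Vec n →L[ℝ] Vec n := T.Q k (T.jend k)

/-- The cluster point set `ω(x⁰)` of the iterates. -/
def Trace.omega (T : Trace n m) : Set (Vec n) := {x | MapClusterPt x atTop T.x}

/-- Subregularity of the constraints of all subproblems at their solutions: the multifunction
`G(·, x^k, V^k, L^{k,j}) - ℝ₋ᵐ` is subregular at `(x, 0)`, `x` being the optimal solution. -/
def SubproblemSubregular (P : Problem n m) (T : Trace n m) : Prop :=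
  ∀ k, ∀ j ≤ T.jend k, ∀ x, P.IsSubSol (T.x k) (T.xi k) (T.V k) (T.L k j) (T.Q k j) x →
    Subregular
      (fun x' => {w : Vec m | ∃ c ∈ nonpos m, w = P.G x' (T.x k) (T.V k) (T.L k j) - c}) x 0

/-- The parameters `u = (s, L, V, ξ, Q)`. -/
abbrev Par (n m : ℕ) := Vec n × Vec m × Mat n m × Vec n × (Vec n →L[ℝ] Vec n)

/-- The parameter set `𝕌 = ℝⁿ × ℝ₊ᵐ × ℝ^{n×m} × ℝⁿ × 𝕊₊`. -/
def parSet (n m : ℕ) : Set (Par n m) := {u | (∀ i, 0 ≤ u.2.1 i) ∧ u.2.2.2.2.IsPositive}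

/-- The parameter `u^k` of the `k`-th accepted subproblem. -/
def Trace.u (T : Trace n m) (k : ℕ) : Par n m := (T.x k, T.Lk k, T.V k, T.xi k, T.Qk k)

/-- The parametric constraint map `H(u, x) = G(x, s, V, L)`. -/
def Problem.H (P : Problem n m) (u : Par n m) (x : Vec n) : Vec m := P.G x u.1 u.2.2.1 u.2.1

/-- The partial bounded multiplier property at every cluster point of `(u^k, x̄^k)`. -/
def ClusterBMP (P : Problem n m) (T : Trace n m) (xbar : ℕ → Vec n) : Prop :=
  ∀ u x, MapClusterPt (u, x) atTop (fun k => (T.u k, xbar k)) →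
    PartialBMP (parSet n m) P.H u x

/-! ### The potential function -/

/-- The functions `f₀, h₀` and `fᵢ, hᵢ` of a decomposition `gᵢ = fᵢ - hᵢ`. -/
structure Decomp (n m : ℕ) where
  f0 : Vec n → ℝ
  h0 : Vec n → ℝ
  f : Fin m → Vec n → ℝ
  h : Fin m → Vec n → ℝ

/-- `gᵢ = fᵢ - hᵢ` on `D` for `i = 0, …, m`, with `fᵢ` quadratic strongly convex and `hᵢ` strongly
convex on `ℝⁿ`. -/
structure Decomp.IsFor (S : Decomp n m) (P : Problem n m) (D : Set (Vec n)) : Prop where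
  f0_quad : IsStronglyConvexQuadratic S.f0
  f_quad : ∀ i, IsStronglyConvexQuadratic (S.f i)
  h0_conv : ∃ σ > (0 : ℝ), StrongConvexOn univ σ S.h0
  h_conv : ∀ i, ∃ σ > (0 : ℝ), StrongConvexOn univ σ (S.h i)
  eq0 : ∀ x ∈ D, P.g0 x = ((S.f0 x - S.h0 x : ℝ) : EReal)
  eq : ∀ i, ∀ x ∈ D, P.g x i = S.f i x - S.h i x

/-- `T₀(x, s, ξ) = ⟪ξ, x⟫ + f₀(s) - ⟪∇f₀(s), s⟫ + h₀*(-ξ + ∇f₀(s))`. -/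
def Decomp.T0 (S : Decomp n m) (x s ξ : Vec n) : ℝ :=
  inner ℝ ξ x + S.f0 s - inner ℝ (gradient S.f0 s) s + conj S.h0 (-ξ + gradient S.f0 s)

/-- `T(x, s, V, L) = Vᵀx + f(s) - f'(s)s + h*(-V + ∇f(s)) + (1/2)‖x - s‖² L`. -/
def Decomp.T (S : Decomp n m) (x s : Vec n) (V : Mat n m) (L : Vec m) : Vec m :=
  WithLp.toLp 2 fun i => inner ℝ (V i) x + S.f i s - inner ℝ (gradient (S.f i) s) s
    + conj (S.h i) (-V i + gradient (S.f i) s) + 1 / 2 * ‖x - s‖ ^ 2 * L i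

/-- The Euclidean space of the variables `z = (x, s, V, L, ξ)`. -/
abbrev ZSpace (n m : ℕ) :=
  WithLp 2 (Vec n × WithLp 2 (Vec n × WithLp 2 (Mat n m × WithLp 2 (Vec m × Vec n))))

/-- The Euclidean space of the variables `w = (z, d)`. -/
abbrev WSpace (n m : ℕ) := WithLp 2 (ZSpace n m × Vec n)

/-- `z = (x, s, V, L, ξ)`. -/
def mkZ (x s : Vec n) (V : Mat n m) (L : Vec m) (ξ : Vec n) : ZSpace n m :=
  WithLp.toLp 2 (x, WithLp.toLp 2 (s, WithLp.toLp 2 (V, WithLp.toLp 2 (L, ξ))))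

open Classical in
/-- `Φ(x, s, V, L, ξ) = φ(x) + T₀(x, s, ξ) + δ_{ℝ₋ᵐ}(T(x, s, V, L))` for `L ∈ ℝ₊ᵐ`, extended by
`∞` to all `L`. -/
def bigPhi (P : Problem n m) (S : Decomp n m) (z : ZSpace n m) : EReal :=
  let x := z.fst
  let s := z.snd.fst
  let V := z.snd.snd.fst
  let L := z.snd.snd.snd.fst
  let ξ := z.snd.snd.snd.snd
  if (∀ i, 0 ≤ L i) ∧ S.T x s V L ∈ nonpos m then ((P.phi x + S.T0 x s ξ : ℝ) : EReal) else ⊤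

/-- The potential function `Φ_c(z, d) = Φ(z) + c‖d‖²`. -/
def potential (P : Problem n m) (S : Decomp n m) (c : ℝ) (w : WSpace n m) : EReal :=
  bigPhi P S w.fst + ((c * ‖w.snd‖ ^ 2 : ℝ) : EReal)

/-- `w^k = (x̄^k, x^k, V^k, L^k, ξ^k, x^{k+1} - x^k)`. -/
def Trace.w (T : Trace n m) (xbar : ℕ → Vec n) (k : ℕ) : WSpace n m :=
  WithLp.toLp 2 (mkZ (xbar k) (T.x k) (T.V k) (T.Lk k) (T.xi k), T.x (k + 1) - T.x k)

end

end MBA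

/-!
The method is a descent method for the objective `F` on the feasible set: the acceptance test gives
`F(x^{k+1}) ≤ F(x^k) - (α/2) d_k²` with `d_k = ‖x^{k+1} - x^k‖`. Summability of `d_k` follows
from the Kurdyka–Łojasiewicz property of the potential function once three facts are known.

* *Boundedness.* Limiting subgradients of an upper-`C²` function provide quadratic upper models,
  with a curvature that is uniform on compact sets (`exists_forall_le_of_upperC2At`). Hence a trial point
  is accepted as soon as `L` and `μ` exceed fixed thresholds, and these parameters stay bounded
  (`IsRun.exists_mu_L_le`). The partial bounded multiplier property and compactness then give
  bounded multipliers at the exact solutions `x̄^k` (`IsRun.exists_bounded_multipliers`).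
* *Error estimates.* Strong convexity of the subproblem, tested with the inexact multipliers at
  `x^{k+1}` and with the bounded exact ones at `x̄^k`, yields `‖x̄^k - x^k‖ ≤ C d_k`, and
  `F(x^{k+1}) - C d_k² ≤ Φ(z^k) ≤ F(x^k)` for `z^k = (x̄^k, x^k, V^k, L^k, ξ^k)`
  (`IsRun.exists_estimates`).
* *Subgradients of the potential.* The relations `-ξ^k + ∇f₀(x^k) ∈ ∂h₀(x^k)`, and likewise for the
  constraints, turn the Fenchel–Young inequality into an equality at `z^k`. The potential is
  therefore minorized near `z^k` by a function whose first-order expansion is explicit, and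
  optimality of `x̄^k` makes the resulting subgradient of norm at most `A d_k` (`mem_regSubdiff_potential`,
  `IsRun.exists_infEDist_le`).

The coefficient `c` of the quadratic term of the potential is an arbitrary positive number, whereas
a lower bound of the potential by `F(x^{k+1})` needs the constant `C`. Since `d_k → 0`, the
Kurdyka–Łojasiewicz inequality is also available at the points `(z^k, t (x^{k+1} - x^k))` for every
fixed `t`, and there the potential takes the value `Φ(z^k) + c t² d_k²`; the choice `c t² = C` makes
it at least `F(x^{k+1})`. The potential is constant on the cluster set, so that finitely many
desingularizing functions can be summed into one, `ψ`, by compactness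
(`exists_eventually_of_mapClusterPt`, `DesingPair.exists_or_imp`). Concavity gives
`d_{k+1}² ≤ C' d_k (ψ(F(x^{k+1}) - F*) - ψ(F(x^{k+2}) - F*))`, where `F*` is the limit of `F(x^k)`,
and the arithmetic-geometric mean inequality makes the sum of `d_k` finite (`IsRun.summable_step`).

Stationarity of the cluster points comes from passing to the limit in the optimality conditions at
`x̄^k` along an ultrafilter (`IsRun.omega_subset_stationary`).
-/

namespace MBA

/-! ### Cluster points and compactness -/

/-- A family of properties `R i` of the terms of a sequence in a compact set: if near each cluster
point one of them holds eventually, and the family is directed, then one of them holds eventually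
along the whole sequence. -/
theorem exists_eventually_of_mapClusterPt {X ι : Type*} [TopologicalSpace X] [Nonempty ι]
    {K : Set X} (hK : IsCompact K) {a : ℕ → X} (ha : ∀ k, a k ∈ K) {R : ι → ℕ → Prop}
    (hdir : ∀ i j, ∃ l, ∀ k, R i k ∨ R j k → R l k)
    (hloc : ∀ x, MapClusterPt x atTop a → ∃ i, ∃ U ∈ 𝓝 x, ∀ᶠ k in atTop, a k ∈ U → R i k) :
    ∃ i, ∀ᶠ k in atTop, R i k := by
  have key := hK.induction_on (p := fun S => ∃ i, ∀ᶠ k in atTop, a k ∈ S → R i k)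
    ⟨Classical.arbitrary ι, by simp⟩
    (fun s t hst ⟨i, hi⟩ => ⟨i, hi.mono fun k hk hs => hk (hst hs)⟩)
    (by
      rintro s t ⟨i, hi⟩ ⟨j, hj⟩
      obtain ⟨l, hl⟩ := hdir i j
      refine ⟨l, ?_⟩
      filter_upwards [hi, hj] with k h1 h2 hk
      exact hl k (hk.imp h1 h2))
    (by
      intro x _
      by_cases hx : MapClusterPt x atTop a
      · obtain ⟨i, U, hU, h⟩ := hloc x hx
        exact ⟨U, mem_nhdsWithin_of_mem_nhds hU, i, h⟩
      · rw [mapClusterPt_iff_frequently] at hx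
        push Not at hx
        obtain ⟨U, hU, h⟩ := hx
        refine ⟨U, mem_nhdsWithin_of_mem_nhds hU, Classical.arbitrary ι, ?_⟩
        filter_upwards [h] with k hk hk'
        exact absurd hk' hk)
  obtain ⟨i, hi⟩ := key
  exact ⟨i, hi.mono fun k hk => hk (ha k)⟩

/-! ### Subgradients -/

section Subgradients

variable {X : Type*} [NormedAddCommGroup X] [InnerProductSpace ℝ X]

/-- `p` is a subgradient of `h` at `x` in the sense of convex analysis. -/
def IsSubgradient (h : X → ℝ) (x p : X) : Prop := ∀ y, h x + inner ℝ p (y - x) ≤ h y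

theorem regSubdiff_subset_limSubdiff (h : X → EReal) (x : X) :
    regSubdiff h x ⊆ limSubdiff h x := fun v hv =>
  ⟨hv.1, hv.2.1, fun _ => x, fun _ => v, tendsto_const_nhds, tendsto_const_nhds, fun _ => hv,
    tendsto_const_nhds⟩

theorem IsSubgradient.mem_limSubdiffReal {h : X → ℝ} {x p : X} (hp : IsSubgradient h x p) :
    p ∈ limSubdiffReal h x := by
  refine regSubdiff_subset_limSubdiff _ _ ⟨EReal.coe_ne_top _, EReal.coe_ne_bot _, fun ε hε => ?_⟩
  refine Eventually.of_forall fun y => ?_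
  rw [← EReal.coe_add, EReal.coe_le_coe_iff]
  have := hp y
  have : 0 ≤ ε * ‖y - x‖ := by positivity
  linarith

/-- The graph `{(x, h x, v) | v ∈ ∂h(x)}` of the limiting subdifferential is closed. -/
theorem mem_limSubdiff_of_tendsto {h : X → EReal} {x v : X} {ι : Type*} {l : Filter ι} [l.NeBot]
    {xs vs : ι → X} (hx : Tendsto xs l (𝓝 x)) (hhx : Tendsto (fun i => h (xs i)) l (𝓝 (h x)))
    (hv : Tendsto vs l (𝓝 v)) (hmem : ∀ i, vs i ∈ limSubdiff h (xs i))
    (htop : h x ≠ ⊤) (hbot : h x ≠ ⊥) : v ∈ limSubdiff h x := by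
  set Gr : Set (X × EReal × X) := {q | q.2.1 = h q.1 ∧ q.2.2 ∈ regSubdiff h q.1} with hGr
  have h1 : ∀ i, (xs i, h (xs i), vs i) ∈ closure Gr := by
    intro i
    obtain ⟨_, _, xs', vs', h1, h2, h3, h4⟩ := hmem i
    exact mem_closure_of_tendsto (h1.prodMk_nhds (h2.prodMk_nhds h4))
      (Eventually.of_forall fun j => ⟨rfl, h3 j⟩)
  have h2 : (x, h x, v) ∈ closure Gr :=
    isClosed_closure.mem_of_tendsto (hx.prodMk_nhds (hhx.prodMk_nhds hv)) (Eventually.of_forall h1)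
  obtain ⟨q, hq, hlim⟩ := mem_closure_iff_seq_limit.1 h2
  refine ⟨htop, hbot, fun j => (q j).1, fun j => (q j).2.2, ?_, ?_, fun j => (hq j).2, ?_⟩
  · exact (continuous_fst.tendsto _).comp hlim
  · have := ((continuous_fst.comp continuous_snd).tendsto _).comp hlim
    exact this.congr fun j => (hq j).1
  · exact ((continuous_snd.comp continuous_snd).tendsto _).comp hlim

/-- If `g = f - h` near `x` with `h` convex, regular subgradients `v` of `g` at `x` yield
subgradients `a - v` of `h`, where `a` is the gradient of `f` at `x`: comparing `g` at `x` and at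
`x - t (y - x)` bounds the slope of `h` on the far side of `x`. -/
theorem le_of_mem_regSubdiff_sub {g : X → EReal} {f h : X → ℝ} {B : Set X} (hB : IsOpen B)
    (hconv : ConvexOn ℝ B h) (hg : ∀ y ∈ B, g y = ((f y - h y : ℝ) : EReal)) {x a v : X} {K : ℝ}
    (hx : x ∈ B) (hf : ∀ y, f y ≤ f x + inner ℝ a (y - x) + K * ‖y - x‖ ^ 2)
    (hv : v ∈ regSubdiff g x) {y : X} (hy : y ∈ B) :
    h x + inner ℝ (a - v) (y - x) ≤ h y := by
  have hcont : Tendsto (fun t : ℝ => x - t • (y - x)) (𝓝[>] 0) (𝓝 x) := by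
    have : Continuous fun t : ℝ => x - t • (y - x) := by fun_prop
    have := this.tendsto 0
    simp only [zero_smul, sub_zero] at this
    exact this.mono_left nhdsWithin_le_nhds
  have main : ∀ ε : ℝ, 0 < ε →
      inner ℝ (a - v) (y - x) - ε * ‖y - x‖ ≤ h y - h x := by
    intro ε hε
    have hlim : Tendsto (fun t : ℝ => inner ℝ (a - v) (y - x) - ε * ‖y - x‖
        - K * ‖y - x‖ ^ 2 * t) (𝓝[>] 0) (𝓝 (inner ℝ (a - v) (y - x) - ε * ‖y - x‖)) := by
      have : Continuous fun t : ℝ => inner ℝ (a - v) (y - x) - ε * ‖y - x‖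
        - K * ‖y - x‖ ^ 2 * t := by fun_prop
      have := this.tendsto 0
      simp only [mul_zero, sub_zero] at this
      exact this.mono_left nhdsWithin_le_nhds
    refine le_of_tendsto hlim ?_
    filter_upwards [hcont.eventually (hv.2.2 ε hε), hcont.eventually (hB.mem_nhds hx),
      self_mem_nhdsWithin] with t h1 h2 (ht : 0 < t)
    rw [hg x hx, hg _ h2, ← EReal.coe_add, EReal.coe_le_coe_iff] at h1
    have h3 := hf (x - t • (y - x))
    have e1 : x - t • (y - x) - x = -(t • (y - x)) := by abel
    rw [e1, norm_neg, norm_smul, inner_neg_right, inner_smul_right, Real.norm_of_nonneg ht.le]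
      at h1 h3
    have h4 := hconv.2 h2 hy (show 0 ≤ 1 / (1 + t) by positivity)
      (show 0 ≤ t / (1 + t) by positivity) (by field_simp)
    have e2 : (1 / (1 + t)) • (x - t • (y - x)) + (t / (1 + t)) • y = x := by
      have : (1 + t) ≠ 0 := by positivity
      have e : (1 / (1 + t)) • (x - t • (y - x)) + (t / (1 + t)) • y
        = ((1 + t) * (1 / (1 + t))) • x + (t / (1 + t) - t * (1 / (1 + t))) • y := by module
      rw [e, mul_one_div_cancel this, mul_one_div, sub_self, one_smul, zero_smul, add_zero]
    rw [e2, smul_eq_mul, smul_eq_mul, div_mul_eq_mul_div, div_mul_eq_mul_div, ← add_div,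
      le_div_iff₀ (by positivity)] at h4
    rw [inner_sub_left]
    have h5 : t * (inner ℝ a (y - x) - inner ℝ v (y - x) - ε * ‖y - x‖ - K * ‖y - x‖ ^ 2 * t)
        ≤ t * (h y - h x) := by nlinarith
    exact le_of_mul_le_mul_left h5 ht
  refine le_of_forall_pos_le_add fun ε hε => ?_
  have h1 := main (ε / (‖y - x‖ + 1)) (by positivity)
  have h2 : ε / (‖y - x‖ + 1) * ‖y - x‖ ≤ ε := by
    rw [div_mul_eq_mul_div, div_le_iff₀ (by positivity)]
    nlinarith [norm_nonneg (y - x)]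
  linarith

/-- The version of `le_of_mem_regSubdiff_sub` for limiting subgradients. -/
theorem le_of_mem_limSubdiff_sub {g : X → EReal} {f h : X → ℝ} {B : Set X} (hB : IsOpen B)
    (hconv : ConvexOn ℝ B h) (hg : ∀ y ∈ B, g y = ((f y - h y : ℝ) : EReal)) {a : X → X} {K : ℝ}
    (ha : Continuous a) (hfc : Continuous f)
    (hf : ∀ x y, f y ≤ f x + inner ℝ (a x) (y - x) + K * ‖y - x‖ ^ 2)
    {x v : X} (hx : x ∈ B) (hv : v ∈ limSubdiff g x) {y : X} (hy : y ∈ B) :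
    h x + inner ℝ (a x - v) (y - x) ≤ h y := by
  obtain ⟨_, _, xs, vs, h1, h2, h3, h4⟩ := hv
  have hev : ∀ᶠ j in atTop, xs j ∈ B := h1.eventually (hB.mem_nhds hx)
  have h5 : Tendsto (fun j => h (xs j)) atTop (𝓝 (h x)) := by
    have h6 : Tendsto (fun j => (g (xs j)).toReal) atTop (𝓝 (g x).toReal) := by
      refine (EReal.tendsto_toReal ?_ ?_).comp h2 <;> rw [hg x hx]
      · exact EReal.coe_ne_top _
      · exact EReal.coe_ne_bot _
    have h7 := ((hfc.tendsto x).comp h1).sub h6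
    have e : f x - (g x).toReal = h x := by rw [hg x hx, EReal.toReal_coe]; ring
    rw [e] at h7
    refine h7.congr' ?_
    filter_upwards [hev] with j hj
    rw [hg _ hj, EReal.toReal_coe]
    simp
  have h8 : Tendsto (fun j => h (xs j) + inner ℝ (a (xs j) - vs j) (y - xs j)) atTop
      (𝓝 (h x + inner ℝ (a x - v) (y - x))) :=
    h5.add ((((ha.tendsto x).comp h1).sub h4).inner (tendsto_const_nhds.sub h1))
  refine le_of_tendsto h8 ?_
  filter_upwards [hev] with j hj
  exact le_of_mem_regSubdiff_sub hB hconv hg hj (hf _) (h3 j) hy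

/-- Subgradients of a convex function are determined locally. -/
theorem isSubgradient_of_eventually {h : X → ℝ} (hh : ConvexOn ℝ univ h) {x p : X}
    (hp : ∀ᶠ y in 𝓝 x, h x + inner ℝ p (y - x) ≤ h y) : IsSubgradient h x p := by
  have h1 : ConvexOn ℝ univ (fun y => h y + -inner ℝ p (y - x)) := by
    refine hh.add ⟨convex_univ, fun u _ w _ s t _ _ hst => le_of_eq ?_⟩
    have e : s • u + t • w - x = s • (u - x) + t • (w - x) := by
      rw [smul_sub, smul_sub, sub_add_sub_comm, ← add_smul, hst, one_smul]
    simp only [e, inner_add_right, inner_smul_right, smul_eq_mul]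
    ring
  have h2 : IsLocalMin (fun y => h y + -inner ℝ p (y - x)) x := by
    filter_upwards [hp] with y hy
    simp only [sub_self, inner_zero_right]
    linarith
  intro y
  have := IsMinOn.of_isLocalMin_of_convex_univ h2 h1 y
  simp only [sub_self, inner_zero_right] at this
  linarith

/-- The limiting subdifferential of a convex function is its convex subdifferential. -/
theorem isSubgradient_of_mem_limSubdiffReal {h : X → ℝ} (hh : ConvexOn ℝ univ h)
    {x p : X} (hp : p ∈ limSubdiffReal h x) : IsSubgradient h x p := by
  -- a regular subgradient of a convex function is a subgradient, by convexity along segments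
  have hreg : ∀ x p, p ∈ regSubdiff (fun y => (h y : EReal)) x → IsSubgradient h x p := by
    intro x p hp y
    have hcont : Tendsto (fun t : ℝ => x + t • (y - x)) (𝓝[>] 0) (𝓝 x) := by
      have : Continuous fun t : ℝ => x + t • (y - x) := by fun_prop
      have := this.tendsto 0
      simp only [zero_smul, add_zero] at this
      exact this.mono_left nhdsWithin_le_nhds
    refine le_of_forall_pos_le_add fun ε hε => ?_
    have hε' : 0 < ε / (‖y - x‖ + 1) := by positivity
    obtain ⟨t, ⟨h1, ht0⟩, ht1⟩ := ((hcont.eventually (hp.2.2 _ hε')).and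
      (self_mem_nhdsWithin)).and (Ioo_mem_nhdsGT one_pos) |>.exists
    have ht : 0 < t := ht0
    have ht1' : t < 1 := ht1.2
    rw [← EReal.coe_add, EReal.coe_le_coe_iff, add_sub_cancel_left, inner_smul_right, norm_smul,
      Real.norm_of_nonneg ht.le] at h1
    have h4 := hh.2 (mem_univ x) (mem_univ y) (show 0 ≤ 1 - t by linarith) ht.le (by ring)
    have e : (1 - t) • x + t • y = x + t • (y - x) := by module
    rw [e, smul_eq_mul, smul_eq_mul] at h4
    have h2 : ε / (‖y - x‖ + 1) * ‖y - x‖ ≤ ε := by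
      rw [div_mul_eq_mul_div, div_le_iff₀ (by positivity)]
      nlinarith [norm_nonneg (y - x)]
    have h5 : t * (h x + inner ℝ p (y - x)) ≤ t * (h y + ε) := by nlinarith
    exact le_of_mul_le_mul_left h5 ht
  obtain ⟨_, _, xs, vs, h1, h2, h3, h4⟩ := hp
  intro y
  have h2' : Tendsto (fun j => h (xs j)) atTop (𝓝 (h x)) := EReal.tendsto_coe.1 h2
  exact le_of_tendsto (h2'.add (h4.inner (tendsto_const_nhds.sub h1)))
    (Eventually.of_forall fun j => hreg _ _ (h3 j) y)

theorem IsSubgradient.of_tendsto {h : X → ℝ} (hc : Continuous h) {x p : X} {ι : Type*}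
    {l : Filter ι} [l.NeBot] {xs ps : ι → X} (hx : Tendsto xs l (𝓝 x)) (hp : Tendsto ps l (𝓝 p))
    (hs : ∀ᶠ i in l, IsSubgradient h (xs i) (ps i)) : IsSubgradient h x p := fun y =>
  le_of_tendsto (((hc.tendsto x).comp hx).add (hp.inner (tendsto_const_nhds.sub hx)))
    (hs.mono fun _ hi => hi y)

/-- Subgradients of a continuous function are bounded on bounded sets: test them with a unit step in
their own direction. -/
theorem exists_norm_le_of_isSubgradient [FiniteDimensional ℝ X] {h : X → ℝ} (hc : Continuous h)
    (R : ℝ) : ∃ C, 0 ≤ C ∧ ∀ x p, ‖x‖ ≤ R → IsSubgradient h x p → ‖p‖ ≤ C := by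
  obtain ⟨C, hC⟩ := (isCompact_closedBall (0 : X) (R + 1)).exists_bound_of_continuousOn
    hc.continuousOn
  refine ⟨2 * |C|, by positivity, fun x p hx hp => ?_⟩
  rcases eq_or_ne p 0 with rfl | hp0
  · simp
  have hn : 0 < ‖p‖ := norm_pos_iff.2 hp0
  have h1 := hp (x + (‖p‖⁻¹) • p)
  rw [add_sub_cancel_left, inner_smul_right, real_inner_self_eq_norm_sq, pow_two,
    inv_mul_cancel_left₀ hn.ne'] at h1
  have h2 := hC x (by simp only [Metric.mem_closedBall, dist_zero_right]; linarith)
  have h3 := hC (x + (‖p‖⁻¹) • p) (by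
    simp only [Metric.mem_closedBall, dist_zero_right]
    refine (norm_add_le _ _).trans ?_
    rw [norm_smul, norm_inv, norm_norm, inv_mul_cancel₀ hn.ne']
    linarith)
  rw [Real.norm_eq_abs] at h2 h3
  have := (abs_le.1 (h2.trans (le_abs_self C))).1
  have := (abs_le.1 (h3.trans (le_abs_self C))).2
  linarith

/-- A minimizer over a convex set `C` of the sum of a linear and a finite convex function carries
multipliers: separate the strict epigraph of the sum from `C × (-∞, 0]`. -/
theorem exists_isSubgradient_of_isMinOn [FiniteDimensional ℝ X] {h : X → ℝ}
    (hh : ConvexOn ℝ univ h) {C : Set X} (hC : Convex ℝ C) {x a : X} (hx : x ∈ C)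
    (hmin : ∀ y ∈ C, h x ≤ h y + inner ℝ a (y - x)) :
    ∃ v, IsSubgradient h x v ∧ -(a + v) ∈ normalCone C x := by
  set f : X → ℝ := fun y => h y + inner ℝ a (y - x) with hf
  have hfconv : ConvexOn ℝ univ f := by
    refine hh.add ⟨convex_univ, fun u _ w _ s t _ _ hst => le_of_eq ?_⟩
    have e : s • u + t • w - x = s • (u - x) + t • (w - x) := by
      rw [smul_sub, smul_sub, sub_add_sub_comm, ← add_smul, hst, one_smul]
    simp only [e, inner_add_right, inner_smul_right, smul_eq_mul]
  have hfcont : Continuous f :=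
    hh.locallyLipschitz.continuous.add (continuous_const.inner (continuous_id.sub continuous_const))
  have hfx : f x = h x := by simp [hf]
  set A : Set (X × ℝ) := {q | q.1 ∈ univ ∧ f q.1 < q.2}
  have hA : Convex ℝ A := hfconv.convex_strict_epigraph
  have hAo : IsOpen A := by
    have : A = {q : X × ℝ | f q.1 < q.2} := by ext; simp [A]
    rw [this]
    exact isOpen_lt (hfcont.comp continuous_fst) continuous_snd
  have hB : Convex ℝ (C ×ˢ Iic (h x)) := hC.prod (convex_Iic _)
  have hdisj : Disjoint A (C ×ˢ Iic (h x)) := by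
    rw [Set.disjoint_left]
    rintro q ⟨_, h1⟩ ⟨h2, h3⟩
    have := hmin q.1 h2
    have h3' : q.2 ≤ h x := h3
    simp only [hf] at h1
    linarith
  obtain ⟨F, u, h1, h2⟩ := geometric_hahn_banach_open hA hAo hB hdisj
  have hF : ∀ y r, F (y, r) = F (y, 0) + r * F (0, 1) := by
    intro y r
    have : ((y, r) : X × ℝ) = (y, 0) + r • (0, 1) := by simp
    rw [this, map_add, map_smul, smul_eq_mul]
  set β := F (0, 1) with hβ
  have hb : β < 0 := by
    have h3 := h1 (x, h x + 1) ⟨mem_univ _, by simp [hfx]⟩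
    have h4 := h2 (x, h x) ⟨hx, le_refl (h x)⟩
    rw [hF] at h3 h4
    linarith
  set w : X := (InnerProductSpace.toDual ℝ X).symm (F.comp (ContinuousLinearMap.inl ℝ X ℝ))
  have hw : ∀ y, F (y, 0) = inner ℝ w y := by
    intro y
    rw [InnerProductSpace.toDual_symm_apply]
    rfl
  -- the separating functional takes the value `u` at `(x, h x)`
  have hu : u = inner ℝ w x + h x * β := by
    refine le_antisymm ?_ ?_
    · have h4 := h2 (x, h x) ⟨hx, le_refl (h x)⟩
      rwa [hF, hw] at h4
    · refine le_of_forall_pos_le_add fun ε hε => ?_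
      have h3 := h1 (x, h x + ε / (-β)) ⟨mem_univ _, by
        rw [hfx]
        have : 0 < ε / (-β) := div_pos hε (neg_pos.2 hb)
        simp only
        linarith⟩
      rw [hF, hw, add_mul, div_mul_eq_mul_div, div_neg, mul_div_cancel_right₀ _ hb.ne] at h3
      linarith
  have hsub : ∀ y, inner ℝ w y + f y * β ≤ u := by
    intro y
    refine le_of_forall_pos_le_add fun ε hε => ?_
    have h3 := h1 (y, f y + ε / (-β)) ⟨mem_univ _, by
      have : 0 < ε / (-β) := div_pos hε (neg_pos.2 hb)
      simp only
      linarith⟩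
    rw [hF, hw, add_mul, div_mul_eq_mul_div, div_neg, mul_div_cancel_right₀ _ hb.ne] at h3
    linarith
  have hnorm : ∀ y ∈ C, u ≤ inner ℝ w y + h x * β := by
    intro y hy
    have h4 := h2 (y, h x) ⟨hy, le_refl (h x)⟩
    rwa [hF, hw] at h4
  refine ⟨(-β)⁻¹ • w - a, fun y => ?_, hx, fun y hy => ?_⟩
  · have h3 := hsub y
    rw [hu] at h3
    rw [inner_sub_left, real_inner_smul_left, inner_sub_right w]
    have h5 : (-β)⁻¹ * (inner ℝ w y - inner ℝ w x) ≤ (-β)⁻¹ * ((f y - h x) * (-β)) :=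
      mul_le_mul_of_nonneg_left (by linarith) (inv_nonneg.2 (by linarith))
    rw [mul_comm (f y - h x), inv_mul_cancel_left₀ (by linarith)] at h5
    simp only [hf] at h5
    linarith
  · have h3 := hnorm y hy
    rw [hu] at h3
    rw [add_sub_cancel, inner_neg_left, real_inner_smul_left, inner_sub_right]
    have : 0 ≤ (-β)⁻¹ * (inner ℝ w y - inner ℝ w x) :=
      mul_nonneg (inv_nonneg.2 (by linarith)) (by linarith)
    linarith

/-! ### Conjugates -/

theorem IsSubgradient.conj_eq {h : X → ℝ} {x p : X} (hp : IsSubgradient h x p) :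
    conj h p = inner ℝ x p - h x := by
  have : IsGreatest (range fun y => inner ℝ y p - h y) (inner ℝ x p - h x) := by
    refine ⟨⟨x, rfl⟩, ?_⟩
    rintro _ ⟨y, rfl⟩
    have := hp y
    simp only
    rw [inner_sub_right, real_inner_comm, real_inner_comm x] at this
    linarith
  exact this.csSup_eq

/-- The Fenchel–Young inequality. Strong convexity makes the supremum defining `conj h q`
finite. -/
theorem StrongConvexOn.le_conj {h : X → ℝ} {σ : ℝ} (hσ : 0 < σ) (hh : StrongConvexOn univ σ h)
    {x₀ p : X} (hp : IsSubgradient h x₀ p) (x q : X) : inner ℝ x q - h x ≤ conj h q := by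
  have h1 : ∀ y, h x₀ + inner ℝ p (y - x₀) + σ / 4 * ‖y - x₀‖ ^ 2 ≤ h y := by
    intro y
    have h2 := hh.2 (mem_univ x₀) (mem_univ y) (show (0 : ℝ) ≤ 1 / 2 by norm_num)
      (show (0 : ℝ) ≤ 1 / 2 by norm_num) (by norm_num)
    have h3 := hp ((1 / 2 : ℝ) • x₀ + (1 / 2 : ℝ) • y)
    have e : (1 / 2 : ℝ) • x₀ + (1 / 2 : ℝ) • y - x₀ = (1 / 2 : ℝ) • (y - x₀) := by module
    rw [e, inner_smul_right] at h3
    simp only [smul_eq_mul] at h2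
    rw [norm_sub_rev] at h2
    linarith
  refine le_ciSup (f := fun y => inner ℝ y q - h y)
    ⟨inner ℝ x₀ q - h x₀ + ‖q - p‖ ^ 2 / σ, ?_⟩ x
  rintro _ ⟨y, rfl⟩
  simp only
  have h2 := h1 y
  have h3 : inner ℝ y q = inner ℝ x₀ q + inner ℝ (q - p) (y - x₀) + inner ℝ p (y - x₀) := by
    rw [real_inner_comm q y, real_inner_comm q x₀, inner_sub_left, inner_sub_right q]
    ring
  have h4 := real_inner_le_norm (q - p) (y - x₀)
  have h5 : ‖q - p‖ * ‖y - x₀‖ ≤ ‖q - p‖ ^ 2 / σ + σ / 4 * ‖y - x₀‖ ^ 2 := by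
    have : ‖q - p‖ ^ 2 / σ + σ / 4 * ‖y - x₀‖ ^ 2 - ‖q - p‖ * ‖y - x₀‖
      = (‖q - p‖ - σ / 2 * ‖y - x₀‖) ^ 2 / σ := by field_simp; ring
    have : 0 ≤ (‖q - p‖ - σ / 2 * ‖y - x₀‖) ^ 2 / σ := by positivity
    linarith
  linarith

end Subgradients

/-! ### Quadratic functions and positive operators -/

section Quadratic

variable {X : Type*} [NormedAddCommGroup X] [InnerProductSpace ℝ X]

theorem hasGradientAt_of_abs_le [CompleteSpace X] {f : X → ℝ} {x p : X} {K : ℝ}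
    (h : ∀ y, |f y - f x - inner ℝ p (y - x)| ≤ K * ‖y - x‖ ^ 2) : HasGradientAt f p x := by
  rw [hasGradientAt_iff_isLittleO]
  have h1 : (fun y => f y - f x - inner ℝ p (y - x)) =O[𝓝 x] fun y => ‖y - x‖ ^ 2 :=
    Asymptotics.IsBigO.of_bound K (Eventually.of_forall fun y => by
      rw [Real.norm_eq_abs, Real.norm_of_nonneg (by positivity)]
      exact h y)
  have h2 : (fun y => ‖y - x‖ ^ 2) =o[𝓝 x] fun y => y - x := by
    have h3 : (fun z : X => ‖z‖ ^ 2) =o[𝓝 0] fun z : X => z :=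
      Asymptotics.isLittleO_norm_pow_id one_lt_two
    have h4 : Tendsto (fun y => y - x) (𝓝 x) (𝓝 0) := by
      have h5 : Continuous fun y => y - x := by fun_prop
      simpa using h5.tendsto x
    exact h3.comp_tendsto h4
  exact h1.trans_isLittleO h2

/-- The only consequence of being quadratic that is used: a first-order expansion with a uniform
quadratic error and a continuous gradient. -/
theorem IsStronglyConvexQuadratic.exists_expansion [CompleteSpace X] {f : X → ℝ}
    (hf : IsStronglyConvexQuadratic f) : Continuous f ∧ Continuous (gradient f) ∧
      ∃ K, 0 ≤ K ∧ ∀ x y, |f y - f x - inner ℝ (gradient f x) (y - x)| ≤ K * ‖y - x‖ ^ 2 := by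
  obtain ⟨⟨A, b, c, h⟩, _⟩ := hf
  have hfe : f = fun x => 1 / 2 * inner ℝ x (A x) + inner ℝ b x + c := funext h
  set g : X → X := fun x => (1 / 2 : ℝ) • (A x + ContinuousLinearMap.adjoint A x) + b with hg
  have hexp : ∀ x y, |f y - f x - inner ℝ (g x) (y - x)| ≤ (1 / 2 * ‖A‖) * ‖y - x‖ ^ 2 := by
    intro x y
    have e : f y - f x - inner ℝ (g x) (y - x) = 1 / 2 * inner ℝ (y - x) (A (y - x)) := by
      rw [h, h, hg]
      simp only [inner_add_left, inner_smul_left, inner_sub_right, inner_sub_left, map_sub,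
        ContinuousLinearMap.adjoint_inner_left]
      simp only [real_inner_comm (A x)]
      simp
      ring
    rw [e, abs_mul, abs_of_nonneg (by norm_num : (0 : ℝ) ≤ 1 / 2)]
    have h1 := abs_real_inner_le_norm (y - x) (A (y - x))
    have h2 := A.le_opNorm (y - x)
    nlinarith [norm_nonneg (y - x)]
  have hgrad : gradient f = g := funext fun x => (hasGradientAt_of_abs_le (hexp x)).gradient
  refine ⟨?_, ?_, 1 / 2 * ‖A‖, by positivity, ?_⟩
  · rw [hfe]; fun_prop
  · rw [hgrad]; fun_prop
  · rw [hgrad]; exact hexp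

theorem norm_le_of_isPositive {Q : X →L[ℝ] X} (hQ : Q.IsPositive) {c : ℝ} (hc : 0 ≤ c)
    (h : (c • ContinuousLinearMap.id ℝ X - Q).IsPositive) : ‖Q‖ ≤ c := by
  have hq : ∀ x, 0 ≤ inner ℝ (Q x) x := hQ.inner_nonneg_left
  have hq' : ∀ x, inner ℝ (Q x) x ≤ c * ‖x‖ ^ 2 := by
    intro x
    have := h.inner_nonneg_left x
    simp only [sub_apply, smul_apply,
      ContinuousLinearMap.id_apply, inner_sub_left, real_inner_smul_left,
      real_inner_self_eq_norm_sq] at this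
    linarith
  -- polarization
  have hpol : ∀ x y, inner ℝ (Q x) y ≤ c / 2 * (‖x‖ ^ 2 + ‖y‖ ^ 2) := by
    intro x y
    have h1 := hq' (x + y)
    have h2 := hq (x - y)
    have hs : inner ℝ (Q y) x = inner ℝ (Q x) y := by
      rw [hQ.inner_left_eq_inner_right, real_inner_comm]
    simp only [map_add, map_sub, inner_add_left, inner_add_right, inner_sub_left,
      inner_sub_right, hs] at h1 h2
    have h3 := parallelogram_law_with_norm ℝ x y
    have h4 : c * ‖x + y‖ ^ 2 ≤ c * (2 * (‖x‖ ^ 2 + ‖y‖ ^ 2)) :=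
      mul_le_mul_of_nonneg_left (by nlinarith [sq_nonneg ‖x - y‖]) hc
    nlinarith
  refine Q.opNorm_le_bound hc fun x => ?_
  rcases eq_or_ne (Q x) 0 with h0 | h0
  · rw [h0, norm_zero]; positivity
  have hn : 0 < ‖Q x‖ := norm_pos_iff.2 h0
  have h1 := hpol x ((‖x‖ / ‖Q x‖) • Q x)
  rw [inner_smul_right, real_inner_self_eq_norm_sq, norm_smul, norm_div, norm_norm, norm_norm,
    div_mul_cancel₀ _ hn.ne', pow_two, ← mul_assoc, div_mul_cancel₀ _ hn.ne'] at h1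
  rcases eq_or_ne x 0 with hx | hx
  · simp [hx] at h0
  have hx' : 0 < ‖x‖ := norm_pos_iff.2 hx
  refine le_of_mul_le_mul_left ?_ hx'
  linarith

end Quadratic

/-! ### Upper-`C²` functions -/

section UpperC2

variable {n : ℕ}

/-- The quadratic upper estimate that limiting subgradients of an upper-`C²` function provide,
locally. -/
theorem UpperC2At.exists_le {g : Vec n → EReal} {x : Vec n} (hg : UpperC2At g x) :
    ∃ ρ, 0 ≤ ρ ∧ ∃ δ > 0, ∀ x' ∈ Metric.ball x δ, ∀ y ∈ Metric.ball x δ, ∀ v ∈ limSubdiff g x',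
      (g y).toReal ≤ (g x').toReal + inner ℝ v (y - x') + ρ / 2 * ‖y - x'‖ ^ 2 := by
  obtain ⟨ρ, hρ, δ, hδ, q, Δ, b, c, -, -, -, hmin⟩ := hg
  refine ⟨ρ, hρ, δ, hδ, ?_⟩
  set h : Vec n → ℝ := fun y => ρ / 2 * ‖y‖ ^ 2 - (g y).toReal with hh
  have hge : ∀ y ∈ Metric.ball x δ, g y = ((g y).toReal : EReal) := by
    intro y hy
    obtain ⟨s, -, hs⟩ := (hmin y hy).1
    rw [← hs, EReal.toReal_coe]
  have hub : ∀ y ∈ Metric.ball x δ, ∀ s ∈ Δ, inner ℝ (b s) y + c s ≤ h y := by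
    intro y hy s hs
    have := (hmin y hy).2 (mem_image_of_mem _ hs)
    rw [hge y hy, EReal.coe_le_coe_iff] at this
    simp only [hh]
    linarith
  have hat : ∀ y ∈ Metric.ball x δ, ∃ s ∈ Δ, h y = inner ℝ (b s) y + c s := by
    intro y hy
    obtain ⟨s, hs, he⟩ := (hmin y hy).1
    refine ⟨s, hs, ?_⟩
    simp only [hh]
    rw [← he, EReal.toReal_coe]
    ring
  have hconv : ConvexOn ℝ (Metric.ball x δ) h := by
    refine ⟨convex_ball _ _, fun u hu w hw s t hs ht hst => ?_⟩
    obtain ⟨r, hr, he⟩ := hat _ (convex_ball x δ hu hw hs ht hst)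
    have h1 := mul_le_mul_of_nonneg_left (hub u hu r hr) hs
    have h2 := mul_le_mul_of_nonneg_left (hub w hw r hr) ht
    have h3 : c r = s * c r + t * c r := by rw [← add_mul, hst, one_mul]
    rw [he, inner_add_right, inner_smul_right, inner_smul_right, smul_eq_mul, smul_eq_mul]
    linarith
  intro x' hx' y hy v hv
  have key := le_of_mem_limSubdiff_sub (f := fun y => ρ / 2 * ‖y‖ ^ 2) (K := ρ / 2)
    (a := fun y => ρ • y) Metric.isOpen_ball hconv
    (fun y hy => by rw [hge y hy]; simp only [hh, sub_sub_cancel])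
    (by fun_prop) (by fun_prop)
    (fun x y => by
      rw [real_inner_smul_left, norm_sub_sq_real, inner_sub_right, real_inner_self_eq_norm_sq,
        real_inner_comm]
      exact le_of_eq (by ring)) hx' hv hy
  simp only [hh, inner_sub_left, real_inner_smul_left, inner_sub_right,
    real_inner_self_eq_norm_sq] at key
  rw [norm_sub_sq_real, inner_sub_right, real_inner_comm x' y]
  linarith

/-- On a compact set the quadratic upper estimate is uniform, even for pairs of points between
which the set does not contain the segment, once the subgradients are bounded: distant
points are handled by enlarging the curvature. -/
theorem exists_forall_le_of_upperC2At {K : Set (Vec n)} (hK : IsCompact K) {g : Vec n → EReal}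
    (hg : ∀ x ∈ K, UpperC2At g x) (hc : ContinuousOn (fun x => (g x).toReal) K) (R : ℝ) :
    ∃ ρ, 0 ≤ ρ ∧ ∀ x ∈ K, ∀ y ∈ K, ∀ v ∈ limSubdiff g x, ‖v‖ ≤ R →
      (g y).toReal ≤ (g x).toReal + inner ℝ v (y - x) + ρ / 2 * ‖y - x‖ ^ 2 := by
  obtain ⟨C, hC⟩ := hK.exists_bound_of_continuousOn hc
  obtain ⟨B, hB⟩ := hK.isBounded.exists_norm_le
  have key := (hK.prod hK).induction_on (p := fun S => ∃ ρ, 0 ≤ ρ ∧ ∀ q ∈ S, q.1 ∈ K → q.2 ∈ K →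
      ∀ v ∈ limSubdiff g q.1, ‖v‖ ≤ R →
      (g q.2).toReal ≤ (g q.1).toReal + inner ℝ v (q.2 - q.1) + ρ / 2 * ‖q.2 - q.1‖ ^ 2)
    ⟨0, le_rfl, by simp⟩
    (fun s t hst ⟨ρ, h0, h⟩ => ⟨ρ, h0, fun q hq => h q (hst hq)⟩)
    (by
      rintro s t ⟨ρ, h0, h⟩ ⟨ρ', h0', h'⟩
      refine ⟨max ρ ρ', le_max_of_le_left h0, fun q hq h1 h2 v hv hvR => ?_⟩
      have hm1 : ρ / 2 * ‖q.2 - q.1‖ ^ 2 ≤ max ρ ρ' / 2 * ‖q.2 - q.1‖ ^ 2 := by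
        gcongr; exact le_max_left _ _
      have hm2 : ρ' / 2 * ‖q.2 - q.1‖ ^ 2 ≤ max ρ ρ' / 2 * ‖q.2 - q.1‖ ^ 2 := by
        gcongr; exact le_max_right _ _
      rcases hq with hq | hq
      · linarith [h q hq h1 h2 v hv hvR]
      · linarith [h' q hq h1 h2 v hv hvR])
    (by
      rintro ⟨x, y⟩ ⟨hx, hy⟩
      rcases eq_or_ne x y with rfl | hne
      · obtain ⟨ρ, hρ, δ, hδ, h⟩ := (hg x hx).exists_le
        refine ⟨Metric.ball x δ ×ˢ Metric.ball x δ, mem_nhdsWithin_of_mem_nhds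
          (prod_mem_nhds (Metric.ball_mem_nhds _ hδ) (Metric.ball_mem_nhds _ hδ)), ρ, hρ, ?_⟩
        rintro ⟨a, b⟩ ⟨ha, hb⟩ - - v hv -
        exact h a ha b hb v hv
      · set r := ‖y - x‖ / 2 with hr
        have hr0 : 0 < r := by
          have : 0 < ‖y - x‖ := norm_pos_iff.2 (sub_ne_zero.2 hne.symm)
          positivity
        refine ⟨{q | r < ‖q.2 - q.1‖}, mem_nhdsWithin_of_mem_nhds ?_,
          2 * (2 * |C| + |R| * (2 * |B|)) / r ^ 2, by positivity, ?_⟩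
        · refine IsOpen.mem_nhds (isOpen_lt continuous_const (by fun_prop)) ?_
          simp only [mem_ofPred_eq]
          linarith
        · rintro ⟨a, b⟩ (hab : r < ‖b - a‖) (ha : a ∈ K) (hb : b ∈ K) v - hvR
          simp only
          have h1 := abs_le.1 ((hC a ha).trans (le_abs_self C))
          have h2 := abs_le.1 ((hC b hb).trans (le_abs_self C))
          have h3 := abs_real_inner_le_norm v (b - a)
          have h4 : ‖b - a‖ ≤ 2 * |B| := by
            have := norm_sub_le b a
            have := (hB a ha).trans (le_abs_self B)
            have := (hB b hb).trans (le_abs_self B)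
            linarith
          have h5 : ‖v‖ * ‖b - a‖ ≤ |R| * (2 * |B|) :=
            mul_le_mul (hvR.trans (le_abs_self R)) h4 (norm_nonneg _) (abs_nonneg _)
          have h6 := (abs_le.1 (h3.trans h5)).1
          have h7 : 2 * |C| + |R| * (2 * |B|)
              ≤ 2 * (2 * |C| + |R| * (2 * |B|)) / r ^ 2 / 2 * ‖b - a‖ ^ 2 := by
            have h8 : r ^ 2 ≤ ‖b - a‖ ^ 2 := pow_le_pow_left₀ hr0.le hab.le 2
            have h9 : 0 ≤ 2 * |C| + |R| * (2 * |B|) := by positivity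
            calc 2 * |C| + |R| * (2 * |B|)
                = 2 * (2 * |C| + |R| * (2 * |B|)) / r ^ 2 / 2 * r ^ 2 := by field_simp
              _ ≤ _ := by gcongr
          linarith [h1.1, h1.2, h2.1, h2.2])
  obtain ⟨ρ, hρ, h⟩ := key
  exact ⟨ρ, hρ, fun x hx y hy v hv hvR => h (x, y) ⟨hx, hy⟩ hx hy v hv hvR⟩

end UpperC2

/-! ### Desingularizing functions and summability -/

/-- A concave function on `[0, η)` grows between two points at least as fast as its derivative at
a third point to their right predicts. -/
theorem IsDesingularizing.deriv_mul_le {η : EReal} {ψ : ℝ → ℝ} (hψ : IsDesingularizing η ψ)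
    {s r b : ℝ} (hs : 0 ≤ s) (hsr : s ≤ r) (hrb : r ≤ b) (hb : 0 < b) (hbη : (b : EReal) < η) :
    deriv ψ b * (r - s) ≤ ψ r - ψ s := by
  obtain ⟨-, hconc, -, -, hdiff, -⟩ := hψ
  have hmem : ∀ t, 0 ≤ t → t ≤ b → t ∈ desingInterval η := fun t h0 h1 =>
    ⟨h0, lt_of_le_of_lt (EReal.coe_le_coe_iff.2 h1) hbη⟩
  have hopen : IsOpen {t : ℝ | 0 < t ∧ (t : EReal) < η} :=
    (isOpen_lt continuous_const continuous_id).inter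
      (isOpen_lt continuous_coe_real_ereal continuous_const)
  have hd : DifferentiableAt ℝ ψ b :=
    (hdiff.differentiableOn one_ne_zero).differentiableAt (hopen.mem_nhds ⟨hb, hbη⟩)
  rcases hsr.eq_or_lt with rfl | hlt
  · simp
  have hslope : deriv ψ b ≤ (ψ r - ψ s) / (r - s) := by
    have hend : ∀ t, 0 ≤ t → t < b → deriv ψ b ≤ (ψ b - ψ t) / (b - t) := by
      intro t h0 h1
      have := hconc.deriv_le_slope (hmem t h0 h1.le) (hmem b hb.le le_rfl) h1 hd
      rwa [slope_def_field] at this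
    rcases hrb.eq_or_lt with rfl | hlt'
    · exact hend s hs hlt
    · exact (hend r (hs.trans hsr) hlt').trans
        (hconc.slope_anti_adjacent (hmem s hs (hsr.trans hrb)) (hmem b hb.le le_rfl) hlt hlt')
  rwa [le_div_iff₀ (sub_pos.2 hlt)] at hslope

/-- Summability from the recursion `d (k+1) ^ 2 ≤ C d k (b k - b (k+1))` with `b ≥ 0`
decreasing: by the arithmetic-geometric mean inequality, `2 d (k+1) ≤ d k + C (b k - b (k+1))`,
and the sum over `k` telescopes. -/
theorem summable_of_sq_le {d b : ℕ → ℝ} {C : ℝ} (hC : 0 ≤ C) (hd : ∀ k, 0 ≤ d k) {N : ℕ}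
    (hb : ∀ k ≥ N, 0 ≤ b k) (hanti : ∀ k ≥ N, b (k + 1) ≤ b k)
    (h : ∀ k ≥ N, d (k + 1) ^ 2 ≤ C * d k * (b k - b (k + 1))) : Summable d := by
  have h1 : ∀ k ≥ N, 2 * d (k + 1) ≤ d k + C * (b k - b (k + 1)) := by
    intro k hk
    have h3 : 0 ≤ C * (b k - b (k + 1)) := mul_nonneg hC (sub_nonneg.2 (hanti k hk))
    have h5 : (2 * d (k + 1)) ^ 2 ≤ (d k + C * (b k - b (k + 1))) ^ 2 := by
      nlinarith [h k hk, sq_nonneg (d k - C * (b k - b (k + 1)))]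
    exact (abs_le_of_sq_le_sq' h5 (by have := hd k; linarith)).2
  have h2 : ∀ i, ∑ k ∈ Finset.range i, d (k + (N + 1)) + d (i + N) + C * b (i + N)
      ≤ d N + C * b N := by
    intro i
    induction i with
    | zero => simp
    | succ i ih =>
      rw [Finset.sum_range_succ]
      have := h1 (i + N) (by omega)
      have e : i + (N + 1) = i + N + 1 := by omega
      have e' : i + 1 + N = i + N + 1 := by omega
      rw [e, e']
      linarith
  rw [← summable_nat_add_iff (N + 1)]
  refine summable_of_sum_range_le (c := d N + C * b N) (fun k => hd _) fun i => ?_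
  have := h2 i
  have := hd (i + N)
  have := mul_nonneg hC (hb (i + N) (by omega))
  linarith

variable {n m : ℕ}

/-! ### The subproblem -/

theorem inner_vec_eq_sum (a b : Vec m) : inner ℝ a b = ∑ i, a i * b i := by
  rw [PiLp.inner_apply]
  exact Finset.sum_congr rfl fun i _ => by simp [mul_comm]

theorem mem_normalCone_nonpos_iff {ζ w : Vec m} : ζ ∈ normalCone (nonpos m) w ↔
    w ∈ nonpos m ∧ (∀ i, 0 ≤ ζ i) ∧ ∀ i, ζ i * w i = 0 := by
  constructor
  · rintro ⟨hw, h⟩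
    have hnn : ∀ i, 0 ≤ ζ i := by
      intro i
      have := h (w - EuclideanSpace.single i 1) (fun j => by
        have h1 := hw j
        rcases eq_or_ne j i with rfl | hne
        · simp; linarith
        · simp [hne]; exact h1)
      rw [sub_sub_cancel_left, inner_neg_right, EuclideanSpace.inner_single_right] at this
      simpa using this
    refine ⟨hw, hnn, ?_⟩
    have h0 := h 0 (fun i => le_of_eq rfl)
    rw [zero_sub, inner_neg_right, inner_vec_eq_sum] at h0
    have hterm : ∀ i ∈ Finset.univ, ζ i * w i ≤ 0 := fun i _ =>
      mul_nonpos_of_nonneg_of_nonpos (hnn i) (hw i)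
    have hsum : ∑ i, ζ i * w i = 0 := le_antisymm (Finset.sum_nonpos hterm) (by linarith)
    exact fun i => (Finset.sum_eq_zero_iff_of_nonpos hterm).1 hsum i (Finset.mem_univ i)
  · rintro ⟨hw, hnn, h0⟩
    refine ⟨hw, fun z hz => ?_⟩
    rw [inner_vec_eq_sum]
    refine Finset.sum_nonpos fun i _ => ?_
    have := mul_nonpos_of_nonneg_of_nonpos (hnn i) (hz i)
    have h1 := h0 i
    simp only [PiLp.sub_apply, mul_sub]
    linarith

namespace Problem

variable (P : Problem n m)

theorem G_apply (x s : Vec n) (V : Mat n m) (L : Vec m) (i : Fin m) :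
    P.G x s V L i = P.g s i + inner ℝ (V i) (x - s) + 1 / 2 * ‖x - s‖ ^ 2 * L i := rfl

theorem G_self (s : Vec n) (V : Mat n m) (L : Vec m) : P.G s s V L = P.g s := by
  ext i
  simp [G_apply]

theorem G_expansion (x y s : Vec n) (V : Mat n m) (L : Vec m) (i : Fin m) :
    P.G y s V L i = P.G x s V L i + inner ℝ (V i + L i • (x - s)) (y - x)
      + 1 / 2 * ‖y - x‖ ^ 2 * L i := by
  rw [G_apply, G_apply]
  have e : y - s = (x - s) + (y - x) := by abel
  rw [e, norm_add_sq_real, inner_add_left, inner_add_right, real_inner_smul_left]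
  ring

theorem gradMul_G (x s : Vec n) (V : Mat n m) (L lam : Vec m) :
    gradMul (fun y => P.G y s V L) x lam = ∑ i, lam i • (V i + L i • (x - s)) := by
  refine Finset.sum_congr rfl fun i _ => ?_
  rw [(hasGradientAt_of_abs_le (f := fun y => P.G y s V L i) (p := V i + L i • (x - s))
    (K := 1 / 2 * |L i|) fun y => ?_).gradient]
  rw [P.G_expansion x y]
  have e : ∀ a b c : ℝ, a + b + c - a - b = c := fun a b c => by ring
  rw [e, abs_mul, abs_of_nonneg (by positivity : 0 ≤ 1 / 2 * ‖y - x‖ ^ 2)]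
  exact le_of_eq (by ring)

/-- Convexity of the constraint functions of the subproblem, weighted with multipliers. -/
theorem inner_gradMul_G_le (x y s : Vec n) (V : Mat n m) {L lam : Vec m} (hL : ∀ i, 0 ≤ L i)
    (hlam : ∀ i, 0 ≤ lam i) : inner ℝ (gradMul (fun y => P.G y s V L) x lam) (y - x)
      ≤ ∑ i, lam i * (P.G y s V L i - P.G x s V L i) := by
  rw [gradMul_G, sum_inner]
  refine Finset.sum_le_sum fun i _ => ?_
  rw [real_inner_smul_left, P.G_expansion x y]
  refine mul_le_mul_of_nonneg_left ?_ (hlam i)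
  have : 0 ≤ 1 / 2 * ‖y - x‖ ^ 2 * L i := mul_nonneg (by positivity) (hL i)
  linarith

theorem convex_subFeas (s : Vec n) (V : Mat n m) {L : Vec m} (hL : ∀ i, 0 ≤ L i) :
    Convex ℝ (P.subFeas s V L) := by
  intro x hx y hy a b ha hb hab i
  set z := a • x + b • y
  have h1 := P.G_expansion z x s V L i
  have h2 := P.G_expansion z y s V L i
  have h3 := hx i
  have h4 := hy i
  have e : a • (x - z) + b • (y - z) = 0 := by
    have : a • (x - z) + b • (y - z) = z - (a + b) • z := by simp only [z]; module
    rw [this, hab, one_smul, sub_self]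
  have h5 : a * inner ℝ (V i + L i • (z - s)) (x - z) + b * inner ℝ (V i + L i • (z - s)) (y - z)
      = 0 := by
    rw [← inner_smul_right, ← inner_smul_right, ← inner_add_right, e, inner_zero_right]
  have h6 : 0 ≤ 1 / 2 * ‖x - z‖ ^ 2 * L i := mul_nonneg (by positivity) (hL i)
  have h7 : 0 ≤ 1 / 2 * ‖y - z‖ ^ 2 * L i := mul_nonneg (by positivity) (hL i)
  have h8 := mul_nonpos_of_nonneg_of_nonpos ha h3
  have h9 := mul_nonpos_of_nonneg_of_nonpos hb h4
  rw [h1] at h8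
  rw [h2] at h9
  have h10 := mul_nonneg ha h6
  have h11 := mul_nonneg hb h7
  have h12 : (a + b) * P.G z s V L i ≤ 0 := by nlinarith
  rwa [hab, one_mul] at h12

theorem theta_self (s ξ : Vec n) (Q : Vec n →L[ℝ] Vec n) :
    P.theta s ξ Q s = (P.g0 s).toReal := by
  simp [theta]

theorem theta_expansion (s ξ : Vec n) {Q : Vec n →L[ℝ] Vec n} (hQ : Q.IsPositive) (x y : Vec n) :
    P.theta s ξ Q y = P.theta s ξ Q x + inner ℝ (ξ + Q (x - s)) (y - x)
      + 1 / 2 * inner ℝ (y - x) (Q (y - x)) := by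
  rw [theta, theta]
  have e : y - s = (x - s) + (y - x) := by abel
  rw [e]
  set a := x - s
  set b := y - x
  have h : inner ℝ b (Q a) = inner ℝ a (Q b) := by
    rw [real_inner_comm, hQ.inner_left_eq_inner_right]
  simp only [map_add, inner_add_left, inner_add_right, h, hQ.inner_left_eq_inner_right]
  ring

theorem gradient_theta (s ξ : Vec n) {Q : Vec n →L[ℝ] Vec n} (hQ : Q.IsPositive) (x : Vec n) :
    gradient (P.theta s ξ Q) x = ξ + Q (x - s) := by
  refine (hasGradientAt_of_abs_le (K := 1 / 2 * ‖Q‖) fun y => ?_).gradient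
  rw [P.theta_expansion s ξ hQ x y]
  have e : ∀ a b c : ℝ, a + b + c - a - b = c := fun a b c => by ring
  rw [e, abs_mul, abs_of_nonneg (by norm_num : (0 : ℝ) ≤ 1 / 2)]
  have h1 := abs_real_inner_le_norm (y - x) (Q (y - x))
  have h2 := Q.le_opNorm (y - x)
  nlinarith [norm_nonneg (y - x)]

theorem mul_sq_le_inner {Q : Vec n →L[ℝ] Vec n} {μ : ℝ}
    (hQμ : (Q - μ • ContinuousLinearMap.id ℝ (Vec n)).IsPositive) (d : Vec n) :
    μ * ‖d‖ ^ 2 ≤ inner ℝ d (Q d) := by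
  have := hQμ.inner_nonneg_right d
  simp only [sub_apply, smul_apply, ContinuousLinearMap.id_apply, inner_sub_right,
    real_inner_smul_right, real_inner_self_eq_norm_sq] at this
  linarith

/-- Strong convexity of the objective of the subproblem. -/
theorem subObj_ge (s ξ : Vec n) {Q : Vec n →L[ℝ] Vec n} (hQ : Q.IsPositive) {μ : ℝ}
    (hQμ : (Q - μ • ContinuousLinearMap.id ℝ (Vec n)).IsPositive) {x v : Vec n}
    (hv : IsSubgradient P.phi x v) (y : Vec n) :
    P.subObj s ξ Q x + inner ℝ (ξ + Q (x - s) + v) (y - x) + μ / 2 * ‖y - x‖ ^ 2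
      ≤ P.subObj s ξ Q y := by
  rw [subObj, subObj, P.theta_expansion s ξ hQ x y, inner_add_left (ξ + Q (x - s))]
  have h1 := hv y
  have h2 := mul_sq_le_inner hQμ (y - x)
  linarith

/-- Points at which the objective of the subproblem does not exceed its value at the iterate are
uniformly close to the iterate. -/
theorem norm_sub_le_of_subObj_le {s ξ : Vec n} {Q : Vec n →L[ℝ] Vec n} (hQ : Q.IsPositive)
    {μ : ℝ} (hμ : 0 < μ) (hQμ : (Q - μ • ContinuousLinearMap.id ℝ (Vec n)).IsPositive) {v y : Vec n}
    (hv : IsSubgradient P.phi s v) (hy : P.subObj s ξ Q y ≤ P.subObj s ξ Q s) :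
    ‖y - s‖ ≤ 2 * ‖ξ + v‖ / μ := by
  have h1 := P.subObj_ge s ξ hQ hQμ hv y
  rw [sub_self, map_zero, add_zero] at h1
  have h2 := (abs_le.1 (abs_real_inner_le_norm (ξ + v) (y - s))).1
  rw [le_div_iff₀ hμ]
  rcases (norm_nonneg (y - s)).eq_or_lt with h0 | h0
  · rw [← h0, zero_mul]; positivity
  · refine le_of_mul_le_mul_right ?_ h0
    nlinarith

/-- Existence of a subgradient of `φ` at the solution of the subproblem for which the optimality
condition holds. -/
theorem IsSubSol.exists_isSubgradient {P : Problem n m} (hphi : ConvexOn ℝ univ P.phi)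
    {s ξ x : Vec n} {V : Mat n m} {L : Vec m} {Q : Vec n →L[ℝ] Vec n} (hL : ∀ i, 0 ≤ L i)
    (hQ : Q.IsPositive) (hx : P.IsSubSol s ξ V L Q x) :
    ∃ v, IsSubgradient P.phi x v ∧
      -(ξ + Q (x - s) + v) ∈ normalCone {p | P.G p s V L ∈ nonpos m} x := by
  have hconv := P.convex_subFeas s V hL
  refine exists_isSubgradient_of_isMinOn hphi hconv hx.1 fun y hy => ?_
  -- compare the values at `x` and at `x + t (y - x)`, and let `t` tend to `0`
  have hlim : Tendsto (fun t : ℝ => P.phi y + inner ℝ (ξ + Q (x - s)) (y - x)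
      + 1 / 2 * inner ℝ (y - x) (Q (y - x)) * t) (𝓝[>] 0)
      (𝓝 (P.phi y + inner ℝ (ξ + Q (x - s)) (y - x))) := by
    have : Continuous fun t : ℝ => P.phi y + inner ℝ (ξ + Q (x - s)) (y - x)
      + 1 / 2 * inner ℝ (y - x) (Q (y - x)) * t := by fun_prop
    have := this.tendsto 0
    simp only [mul_zero, add_zero] at this
    exact this.mono_left nhdsWithin_le_nhds
  refine ge_of_tendsto hlim ?_
  filter_upwards [Ioo_mem_nhdsGT (one_pos : (0 : ℝ) < 1)] with t ht
  have h1 : P.subObj s ξ Q x ≤ P.subObj s ξ Q ((1 - t) • x + t • y) :=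
    hx.2 (hconv hx.1 hy (sub_nonneg.2 ht.2.le) ht.1.le (by ring))
  have h2 := hphi.2 (mem_univ x) (mem_univ y) (sub_nonneg.2 ht.2.le) ht.1.le (by ring)
  rw [subObj, subObj, P.theta_expansion s ξ hQ x ((1 - t) • x + t • y)] at h1
  have e : (1 - t) • x + t • y - x = t • (y - x) := by module
  rw [e, map_smul, real_inner_smul_left, inner_smul_right, inner_smul_right] at h1
  simp only [smul_eq_mul] at h2
  have h5 : t * P.phi x ≤ t * (P.phi y + inner ℝ (ξ + Q (x - s)) (y - x)
      + 1 / 2 * inner ℝ (y - x) (Q (y - x)) * t) := by nlinarith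
  exact le_of_mul_le_mul_left h5 ht.1

section Inexact

variable {s ξ x y v v' : Vec n} {V : Mat n m} {L lam lam' : Vec m} {Q : Vec n →L[ℝ] Vec n}
  {μ βC βS : ℝ}

/-- An inexact solution `y` of the subproblem is almost optimal. -/
theorem subObj_add_le_of_inexact (hL : ∀ i, 0 ≤ L i) (hQ : Q.IsPositive)
    (hQμ : (Q - μ • ContinuousLinearMap.id ℝ (Vec n)).IsPositive)
    (hx : x ∈ P.subFeas s V L) (hv : IsSubgradient P.phi y v) (hlam : ∀ i, 0 ≤ lam i)
    (hC : P.resC s V L y lam ≤ βC / 2 * ‖y - s‖ ^ 2)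
    (hS : P.resS s ξ V L Q y v lam ≤ βS * ‖y - s‖) :
    P.subObj s ξ Q y + μ / 2 * ‖x - y‖ ^ 2
      ≤ P.subObj s ξ Q x + βS * ‖y - s‖ * ‖x - y‖ + βC / 2 * ‖y - s‖ ^ 2 := by
  have h1 := P.subObj_ge s ξ hQ hQμ hv x
  rw [resS, P.gradient_theta s ξ hQ] at hS
  have h2 := P.inner_gradMul_G_le y x s V hL hlam
  set A := ξ + Q (y - s) + v
  set B := gradMul (fun y => P.G y s V L) y lam
  have h3 : inner ℝ A (x - y) = inner ℝ (A + B) (x - y) - inner ℝ B (x - y) := by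
    rw [inner_add_left A]; ring
  have h4 := (abs_le.1 (abs_real_inner_le_norm (A + B) (x - y))).1
  have h5 : ‖A + B‖ * ‖x - y‖ ≤ βS * ‖y - s‖ * ‖x - y‖ :=
    mul_le_mul_of_nonneg_right hS (norm_nonneg _)
  have h6 : ∑ i, lam i * (P.G x s V L i - P.G y s V L i) ≤ - inner ℝ lam (P.G y s V L) := by
    rw [inner_vec_eq_sum, ← Finset.sum_neg_distrib]
    refine Finset.sum_le_sum fun i _ => ?_
    have := mul_nonpos_of_nonneg_of_nonpos (hlam i) (hx i)
    rw [mul_sub]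
    linarith
  have h7 : - inner ℝ lam (P.G y s V L) ≤ βC / 2 * ‖y - s‖ ^ 2 := by
    refine le_trans ?_ hC
    rw [resC]
    exact le_add_of_le_of_nonneg (le_max_left _ _) (norm_nonneg _)
  linarith

theorem G_le_of_resC_le {t : ℝ} (hC : P.resC s V L y lam ≤ t) (i : Fin m) :
    P.G y s V L i ≤ t := by
  refine le_trans ?_ hC
  rw [resC]
  have h1 := norm_le_pi_norm (fun i => max (P.G y s V L i) 0 : Fin m → ℝ) i
  have h2 : P.G y s V L i ≤ ‖max (P.G y s V L i) 0‖ := (le_max_left _ _).trans (le_abs_self _)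
  have h3 : 0 ≤ max (-inner ℝ lam (P.G y s V L)) 0 := le_max_right _ _
  linarith

/-- The objective at an almost feasible point is not much below the optimal value, by
multipliers at the solution. -/
theorem subObj_add_le_of_multiplier (hL : ∀ i, 0 ≤ L i) (hQ : Q.IsPositive)
    (hQμ : (Q - μ • ContinuousLinearMap.id ℝ (Vec n)).IsPositive)
    (hv' : IsSubgradient P.phi x v') (hlam' : lam' ∈ normalCone (nonpos m) (P.G x s V L))
    (hstat : gradMul (fun y => P.G y s V L) x lam' = -(ξ + Q (x - s) + v'))
    {t : ℝ} (ht : ∀ i, P.G y s V L i ≤ t) :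
    P.subObj s ξ Q x + μ / 2 * ‖y - x‖ ^ 2 ≤ P.subObj s ξ Q y + (∑ i, lam' i) * t := by
  obtain ⟨-, hnn, h0⟩ := mem_normalCone_nonpos_iff.1 hlam'
  have h1 := P.subObj_ge s ξ hQ hQμ hv' y
  have h2 := P.inner_gradMul_G_le x y s V hL hnn
  rw [hstat, inner_neg_left] at h2
  have h3 : ∑ i, lam' i * (P.G y s V L i - P.G x s V L i) ≤ (∑ i, lam' i) * t := by
    rw [Finset.sum_mul]
    refine Finset.sum_le_sum fun i _ => ?_
    rw [mul_sub, h0, sub_zero]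
    exact mul_le_mul_of_nonneg_left (ht i) (hnn i)
  linarith

end Inexact

theorem F_eq {x : Vec n} (hx : x ∈ P.feas) (ht : P.g0 x ≠ ⊤) (hb : P.g0 x ≠ ⊥) :
    P.F x = (((P.g0 x).toReal + P.phi x : ℝ) : EReal) := by
  rw [F, if_pos (show P.g x ∈ nonpos m from hx), add_zero, EReal.coe_add,
    EReal.coe_toReal ht hb]

end Problem

/-! ### Boundedness of the generated quantities -/

/-- The real-valued objective `g₀ + φ`, which agrees with `F` on the feasible set. -/
noncomputable def Problem.obj (P : Problem n m) (x : Vec n) : ℝ := (P.g0 x).toReal + P.phi x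

theorem Problem.Standing.F_eq {P : Problem n m} {O : Set (Vec n)} (hP : P.Standing O) {x : Vec n}
    (hx : x ∈ P.feas) : P.F x = (P.obj x : EReal) :=
  P.F_eq hx (hP.g0_ne_top x (hP.feas_subset hx)) (hP.g0_ne_bot x)

theorem Problem.Standing.isClosed_feas {P : Problem n m} {O : Set (Vec n)} (hP : P.Standing O) :
    IsClosed P.feas := by
  have : P.feas = ⋂ i, {x | P.g x i ≤ 0} := by
    ext x
    simp [Problem.feas, nonpos]
  rw [this]
  exact isClosed_iInter fun i => isClosed_le (hP.g_lip i).continuous continuous_const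

theorem Problem.Standing.continuous_phi {P : Problem n m} {O : Set (Vec n)} (hP : P.Standing O) :
    Continuous P.phi := hP.phi_convex.locallyLipschitz.continuous

theorem StrongConvexOn.convexOn_univ {X : Type*} [NormedAddCommGroup X] [InnerProductSpace ℝ X]
    {h : X → ℝ} {σ : ℝ} (hσ : 0 < σ)
    (hh : StrongConvexOn univ σ h) : ConvexOn ℝ univ h :=
  UniformConvexOn.convexOn hh fun r => by positivity

/-- In the interior of the set where `g = f - h`, limiting subgradients of `g` correspond to
subgradients of `h`. -/
theorem isSubgradient_neg_add_gradient {g : Vec n → EReal} {f h : Vec n → ℝ} {D : Set (Vec n)}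
    (hD : Convex ℝ D) (hf : IsStronglyConvexQuadratic f)
    (hh : ∃ σ > (0 : ℝ), StrongConvexOn univ σ h) (hg : ∀ y ∈ D, g y = ((f y - h y : ℝ) : EReal))
    {x v : Vec n} (hx : x ∈ interior D) (hv : v ∈ limSubdiff g x) :
    IsSubgradient h x (-v + gradient f x) := by
  obtain ⟨σ, hσ, hh⟩ := hh
  have hconv := StrongConvexOn.convexOn_univ hσ hh
  obtain ⟨hfc, hgc, K, -, hexp⟩ := hf.exists_expansion
  refine isSubgradient_of_eventually hconv ?_
  filter_upwards [isOpen_interior.mem_nhds hx] with y hy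
  rw [neg_add_eq_sub]
  refine le_of_mem_limSubdiff_sub (K := K) isOpen_interior
    (hconv.subset (subset_univ _) hD.interior) (fun y hy => hg y (interior_subset hy)) hgc hfc
    (fun x y => ?_) hx hv hy
  have := (abs_le.1 (hexp x y)).2
  linarith

namespace IsRun

variable {P : Problem n m} {O D : Set (Vec n)} {p : Params} {T : Trace n m} {S : Decomp n m}

theorem mem_feas (hT : IsRun P p T) (k : ℕ) : T.x k ∈ P.feas := by
  cases k with
  | zero => exact hT.x_zero
  | succ k => rw [hT.x_succ]; exact (hT.accept k).1

theorem update (hT : IsRun P p T) {k j : ℕ} (hj : j < T.jend k) :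
    (P.g (T.y k j) ∉ nonpos m ∧ T.L k (j + 1) = p.tau • T.L k j ∧ T.mu k (j + 1) = T.mu k j) ∨
    (P.g (T.y k j) ∈ nonpos m ∧ T.L k (j + 1) = T.L k j ∧
      T.mu k (j + 1) = p.tau * T.mu k j) := by
  by_cases h : P.g (T.y k j) ∈ nonpos m
  · exact Or.inr ⟨h, hT.update_mu k j hj h⟩
  · exact Or.inl ⟨h, hT.update_L k j hj h⟩

theorem lower_bounds (hT : IsRun P p T) (k : ℕ) : ∀ j ≤ T.jend k,
    p.muMin ≤ T.mu k j ∧ ∀ i, p.LMin ≤ T.L k j i := by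
  intro j
  induction j with
  | zero => exact fun _ => ⟨(hT.mu_zero k).1, fun i => (hT.L_zero k i).1⟩
  | succ j ih =>
    intro hj
    obtain ⟨h1, h2⟩ := ih (by omega)
    have hτ := p.one_lt_tau
    have := p.muMin_pos
    have := p.LMin_pos
    rcases hT.update (k := k) (j := j) (by omega) with ⟨-, hL, hμ⟩ | ⟨-, hL, hμ⟩
    · rw [hL, hμ]
      refine ⟨h1, fun i => ?_⟩
      have := h2 i
      simp only [PiLp.smul_apply, smul_eq_mul]
      nlinarith
    · rw [hL, hμ]
      exact ⟨by nlinarith, h2⟩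

theorem mu_pos (hT : IsRun P p T) {k j : ℕ} (hj : j ≤ T.jend k) : 0 < T.mu k j :=
  p.muMin_pos.trans_le (hT.lower_bounds k j hj).1

theorem L_nonneg (hT : IsRun P p T) {k j : ℕ} (hj : j ≤ T.jend k) (i : Fin m) : 0 ≤ T.L k j i :=
  p.LMin_pos.le.trans ((hT.lower_bounds k j hj).2 i)

theorem isPositive_Q (hT : IsRun P p T) {k j : ℕ} (hj : j ≤ T.jend k) : (T.Q k j).IsPositive := by
  have h1 := (hT.Q_lower k j hj).add
    ((ContinuousLinearMap.isPositive_id (𝕜 := ℝ) (E := Vec n)).smul_of_nonneg (hT.mu_pos hj).le)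
  rwa [sub_add_cancel] at h1

theorem isSubgradient_h0 (hT : IsRun P p T) (hD : Convex ℝ D) (hS : S.IsFor P D)
    (hxD : ∀ k, T.x k ∈ interior D) (k : ℕ) :
    IsSubgradient S.h0 (T.x k) (-T.xi k + gradient S.f0 (T.x k)) :=
  isSubgradient_neg_add_gradient hD hS.f0_quad hS.h0_conv hS.eq0 (hxD k) (hT.xi_mem k)

theorem isSubgradient_h (hT : IsRun P p T) (hD : Convex ℝ D) (hS : S.IsFor P D)
    (hxD : ∀ k, T.x k ∈ interior D) (k : ℕ) (i : Fin m) :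
    IsSubgradient (S.h i) (T.x k) (-T.V k i + gradient (S.f i) (T.x k)) :=
  isSubgradient_neg_add_gradient hD (hS.f_quad i) (hS.h_conv i)
    (fun y hy => congrArg _ (hS.eq i y hy)) (hxD k) (hT.V_mem k i)

/-- The iterates and the chosen subgradients are bounded; for the latter, use that subgradients of
the convex parts of the decomposition are bounded on bounded sets. -/
theorem exists_norm_le (hT : IsRun P p T) (hbdd : Bornology.IsBounded (range T.x))
    (hD : Convex ℝ D) (hS : S.IsFor P D) (hxD : ∀ k, T.x k ∈ interior D) :
    ∃ C, 0 ≤ C ∧ ∀ k, ‖T.x k‖ ≤ C ∧ ‖T.xi k‖ ≤ C ∧ ∀ i, ‖T.V k i‖ ≤ C := by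
  obtain ⟨R, hR⟩ := hbdd.exists_norm_le
  have hR' : ∀ k, ‖T.x k‖ ≤ R := fun k => hR _ (mem_range_self k)
  have key : ∀ f h : Vec n → ℝ, IsStronglyConvexQuadratic f →
      (∃ σ > (0 : ℝ), StrongConvexOn univ σ h) → ∃ C, ∀ k v,
        IsSubgradient h (T.x k) (-v + gradient f (T.x k)) → ‖v‖ ≤ C := by
    rintro f h hf ⟨σ, hσ, hh⟩
    obtain ⟨-, hgc, -⟩ := hf.exists_expansion
    obtain ⟨C1, hC1⟩ := (isCompact_closedBall (0 : Vec n) R).exists_bound_of_continuousOn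
      hgc.continuousOn
    obtain ⟨C2, -, hC2⟩ := exists_norm_le_of_isSubgradient
      (StrongConvexOn.convexOn_univ hσ hh).locallyLipschitz.continuous R
    refine ⟨C1 + C2, fun k v hv => ?_⟩
    have h1 := hC2 _ _ (hR' k) hv
    have h2 := hC1 (T.x k) (by simpa using hR' k)
    have e : v = gradient f (T.x k) - (-v + gradient f (T.x k)) := by abel
    rw [e]
    exact (norm_sub_le _ _).trans (add_le_add h2 h1)
  obtain ⟨C0, hC0⟩ := key _ _ hS.f0_quad hS.h0_conv
  choose Ci hCi using fun i => key _ _ (hS.f_quad i) (hS.h_conv i)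
  refine ⟨|R| + |C0| + ∑ i, |Ci i|, by positivity, fun k => ⟨?_, ?_, fun i => ?_⟩⟩
  · have := (hR' k).trans (le_abs_self R)
    have : 0 ≤ ∑ i, |Ci i| := by positivity
    linarith [abs_nonneg C0]
  · have := (hC0 k _ (hT.isSubgradient_h0 hD hS hxD k)).trans (le_abs_self C0)
    have : 0 ≤ ∑ i, |Ci i| := by positivity
    linarith [abs_nonneg R]
  · have := (hCi i k _ (hT.isSubgradient_h hD hS hxD k i)).trans (le_abs_self (Ci i))
    have := Finset.single_le_sum (f := fun i => |Ci i|) (fun i _ => abs_nonneg _)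
      (Finset.mem_univ i)
    linarith [abs_nonneg R, abs_nonneg C0]

/-- All trial points, and the exact solutions of the subproblems, stay at a bounded distance from
the iterates, since the subproblems are uniformly strongly convex. -/
theorem exists_norm_sub_le (hT : IsRun P p T) (hP : P.Standing O) {C : ℝ}
    (hC : ∀ k, ‖T.x k‖ ≤ C ∧ ‖T.xi k‖ ≤ C ∧ ∀ i, ‖T.V k i‖ ≤ C) :
    ∃ R, ∀ k, ∀ j ≤ T.jend k, ∀ z,
      P.subObj (T.x k) (T.xi k) (T.Q k j) z ≤ P.subObj (T.x k) (T.xi k) (T.Q k j) (T.x k) →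
      ‖z - T.x k‖ ≤ R := by
  obtain ⟨B, hB0, hB⟩ := exists_norm_le_of_isSubgradient hP.continuous_phi C
  refine ⟨2 * (C + B) / p.muMin, fun k j hj z hz => ?_⟩
  obtain ⟨v, hv, -⟩ := exists_isSubgradient_of_isMinOn hP.phi_convex (convex_singleton (T.x k))
    (a := 0) (mem_singleton _) (by rintro y rfl; simp)
  refine (P.norm_sub_le_of_subObj_le (hT.isPositive_Q hj) p.muMin_pos ?_ hv hz).trans ?_
  · have h1 := (hT.Q_lower k j hj).add
      ((ContinuousLinearMap.isPositive_id (𝕜 := ℝ) (E := Vec n)).smul_of_nonneg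
        (sub_nonneg.2 (hT.lower_bounds k j hj).1))
    rwa [sub_smul, sub_add_sub_cancel] at h1
  · have := p.muMin_pos
    gcongr
    exact (norm_add_le _ _).trans (add_le_add (hC k).2.1 (hB _ _ (hC k).1 hv))

/-- The quadratic upper models of the problem functions at the iterates are valid on bounded sets
with a uniform curvature. -/
theorem exists_upper_models (hT : IsRun P p T) (hP : P.Standing O) {C : ℝ}
    (hC : ∀ k, ‖T.x k‖ ≤ C ∧ ‖T.xi k‖ ≤ C ∧ ∀ i, ‖T.V k i‖ ≤ C) (R : ℝ) :
    ∃ ρ, 0 ≤ ρ ∧ ∀ k y, ‖y - T.x k‖ ≤ R →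
      (∀ i, P.g y i ≤ P.g (T.x k) i + inner ℝ (T.V k i) (y - T.x k)
        + ρ / 2 * ‖y - T.x k‖ ^ 2) ∧
      (y ∈ P.feas → (P.g0 y).toReal ≤ (P.g0 (T.x k)).toReal + inner ℝ (T.xi k) (y - T.x k)
        + ρ / 2 * ‖y - T.x k‖ ^ 2) := by
  set K := Metric.closedBall (0 : Vec n) (C + |R|) with hK
  have hxK : ∀ k, T.x k ∈ K := fun k => by
    simp only [hK, Metric.mem_closedBall, dist_zero_right]
    linarith [(hC k).1, abs_nonneg R]
  have hyK : ∀ k y, ‖y - T.x k‖ ≤ R → y ∈ K := fun k y hy => by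
    simp only [hK, Metric.mem_closedBall, dist_zero_right]
    have := norm_add_le (T.x k) (y - T.x k)
    rw [add_sub_cancel] at this
    linarith [(hC k).1, le_abs_self R]
  have hKc : IsCompact K := isCompact_closedBall _ _
  choose ρ hρ0 hρ using fun i => exists_forall_le_of_upperC2At hKc (fun x _ => hP.g_upperC2 i x)
    (by simpa using (hP.g_lip i).continuous.continuousOn) C
  obtain ⟨ρ₀, hρ₀0, hρ₀⟩ := exists_forall_le_of_upperC2At (hKc.inter_left hP.isClosed_feas)
    (fun x hx => hP.g0_upperC2 x (hP.feas_subset hx.1))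
    (hP.g0_lip.continuousOn.mono fun x hx => hP.feas_subset hx.1) C
  have hle : ∀ i, ρ i ≤ ρ₀ + ∑ i, ρ i := fun i => by
    have := Finset.single_le_sum (f := ρ) (fun i _ => hρ0 i) (Finset.mem_univ i)
    linarith
  have hle0 : ρ₀ ≤ ρ₀ + ∑ i, ρ i := by
    have := Finset.sum_nonneg (s := Finset.univ) (f := ρ) (fun i _ => hρ0 i)
    linarith
  refine ⟨ρ₀ + ∑ i, ρ i, hρ₀0.trans hle0, fun k y hy => ⟨fun i => ?_, fun hyf => ?_⟩⟩
  · have h1 := hρ i _ (hxK k) _ (hyK k y hy) _ (hT.V_mem k i) ((hC k).2.2 i)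
    simp only [EReal.toReal_coe] at h1
    refine h1.trans ?_
    gcongr
    exact hle i
  · have h1 := hρ₀ _ ⟨hT.mem_feas k, hxK k⟩ _ ⟨hyf, hyK k y hy⟩ _ (hT.xi_mem k) (hC k).2.1
    refine h1.trans ?_
    gcongr

/-- The regularization parameters stay bounded: a trial point is feasible once the curvatures
`L` exceed those of the constraints, and it is accepted once, in addition, `μ` exceeds that of the
objective. -/
theorem exists_mu_L_le (hT : IsRun P p T) (hP : P.Standing O) {C : ℝ}
    (hC : ∀ k, ‖T.x k‖ ≤ C ∧ ‖T.xi k‖ ≤ C ∧ ∀ i, ‖T.V k i‖ ≤ C) :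
    ∃ B, 0 ≤ B ∧ ∀ k, ∀ j ≤ T.jend k, T.mu k j ≤ B ∧ ∀ i, T.L k j i ≤ B := by
  obtain ⟨R, hR⟩ := hT.exists_norm_sub_le hP hC
  obtain ⟨ρ, hρ0, hρ⟩ := hT.exists_upper_models hP hC R
  have hτ := p.one_lt_tau
  have hτ0 : 0 ≤ p.tau := by linarith
  have hLm := p.LMin_pos
  have hLM : 0 < p.LMax := hLm.trans_le p.LMin_le
  have hβ := p.betaC_pos
  have hα := p.alpha_pos
  set B1 := max p.muMax (p.tau * (ρ + p.alpha))
  set B2 := max p.LMax (p.tau * (p.LMax * (ρ + p.betaC) / p.LMin))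
  have key : ∀ k, ∀ j ≤ T.jend k, T.mu k j ≤ B1 ∧ (∀ i, T.L k j i ≤ B2) ∧
      ∀ i i', T.L k j i * p.LMin ≤ p.LMax * T.L k j i' := by
    intro k j
    induction j with
    | zero =>
      refine fun _ => ⟨(hT.mu_zero k).2.trans (le_max_left _ _),
        fun i => (hT.L_zero k i).2.trans (le_max_left _ _), fun i i' => ?_⟩
      exact mul_le_mul (hT.L_zero k i).2 (hT.L_zero k i').1 hLm.le hLM.le
    | succ j ih =>
      intro hj
      obtain ⟨h1, h2, h3⟩ := ih (by omega)
      have hj' : j ≤ T.jend k := by omega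
      set y := T.y k j with hy
      set d := ‖y - T.x k‖ with hd
      obtain ⟨hm1, hm2⟩ := hρ k y (hR k j hj' _ (hT.inexact_obj k j hj'))
      rcases hT.update (k := k) (j := j) (by omega) with ⟨hg, hL, hμ⟩ | ⟨hg, hL, hμ⟩
      · rw [hL, hμ]
        obtain ⟨i, hi⟩ : ∃ i, 0 < P.g y i := by
          by_contra hcon
          push Not at hcon
          exact hg hcon
        have h4 := P.G_le_of_resC_le (hT.inexact_C k j hj') i
        rw [P.G_apply] at h4
        have h5 := hm1 i
        have h6 : 0 < (p.betaC + ρ - T.L k j i) * (d ^ 2 / 2) := by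
          simp only [← hy, ← hd] at h4
          linarith
        have h7 : T.L k j i < ρ + p.betaC := by
          have := pos_of_mul_pos_left h6 (by positivity)
          linarith
        have h8 : ∀ i', T.L k j i' ≤ p.LMax * (ρ + p.betaC) / p.LMin := by
          intro i'
          rw [le_div_iff₀ hLm]
          exact (h3 i' i).trans (mul_le_mul_of_nonneg_left h7.le hLM.le)
        refine ⟨h1, fun i' => ?_, fun i' i'' => ?_⟩
        · simp only [PiLp.smul_apply, smul_eq_mul]
          exact (mul_le_mul_of_nonneg_left (h8 i') hτ0).trans (le_max_right _ _)
        · simp only [PiLp.smul_apply, smul_eq_mul]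
          have := mul_le_mul_of_nonneg_left (h3 i' i'') hτ0
          linarith
      · rw [hL, hμ]
        refine ⟨?_, h2, h3⟩
        have hna := hT.not_accept k j (by omega)
        have h4 : P.obj (T.x k) - p.alpha / 2 * d ^ 2 < P.obj y := by
          by_contra hcon
          refine hna ⟨hg, ?_⟩
          rw [hP.F_eq (x := T.y k j) hg, hP.F_eq (hT.mem_feas k), ← EReal.coe_sub,
            EReal.coe_le_coe_iff]
          exact not_lt.1 hcon
        have h5 := hm2 hg
        have h6 := hT.inexact_obj k j hj'
        rw [Problem.subObj, Problem.subObj, P.theta_self, Problem.theta] at h6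
        have h7 := Problem.mul_sq_le_inner (hT.Q_lower k j hj') (y - T.x k)
        simp only [Problem.obj] at h4
        have h8 : 0 < (ρ + p.alpha - T.mu k j) * (d ^ 2 / 2) := by
          simp only [← hy, ← hd] at h6 h7
          linarith
        have h9 : T.mu k j < ρ + p.alpha := by
          have := pos_of_mul_pos_left h8 (by positivity)
          linarith
        exact (mul_le_mul_of_nonneg_left h9.le hτ0).trans (le_max_right _ _)
  refine ⟨max B1 B2, le_max_of_le_right (le_max_of_le_left hLM.le), fun k j hj => ?_⟩
  obtain ⟨h1, h2, -⟩ := key k j hj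
  exact ⟨h1.trans (le_max_left _ _), fun i => (h2 i).trans (le_max_right _ _)⟩

theorem obj_succ_le (hT : IsRun P p T) (hP : P.Standing O) (k : ℕ) :
    P.obj (T.x (k + 1)) ≤ P.obj (T.x k) - p.alpha / 2 * ‖T.x (k + 1) - T.x k‖ ^ 2 := by
  have h := (hT.accept k).2
  rw [← hT.x_succ, hP.F_eq (hT.mem_feas (k + 1)), hP.F_eq (hT.mem_feas k), ← EReal.coe_sub,
    EReal.coe_le_coe_iff] at h
  exact h

/-- The objective values decrease to a limit. -/
theorem exists_tendsto_obj (hT : IsRun P p T) (hP : P.Standing O) :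
    ∃ F, Tendsto (fun k => P.obj (T.x k)) atTop (𝓝 F) ∧ ∀ k, F ≤ P.obj (T.x k) := by
  obtain ⟨B, hB⟩ := hP.bddBelow
  have hanti : Antitone fun k => P.obj (T.x k) := antitone_nat_of_succ_le fun k => by
    have h1 := hT.obj_succ_le hP k
    have := p.alpha_pos
    have : 0 ≤ p.alpha / 2 * ‖T.x (k + 1) - T.x k‖ ^ 2 := by positivity
    linarith
  have hbdd : BddBelow (range fun k => P.obj (T.x k)) := by
    refine ⟨B, ?_⟩
    rintro _ ⟨k, rfl⟩
    have := hB _ (hT.mem_feas k)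
    rw [hP.F_eq (hT.mem_feas k), EReal.coe_le_coe_iff] at this
    exact this
  exact ⟨_, tendsto_atTop_ciInf hanti hbdd, fun k => ciInf_le hbdd k⟩

theorem tendsto_norm_step (hT : IsRun P p T) (hP : P.Standing O) :
    Tendsto (fun k => ‖T.x (k + 1) - T.x k‖) atTop (𝓝 0) := by
  obtain ⟨F, hF, -⟩ := hT.exists_tendsto_obj hP
  have hα := p.alpha_pos
  have h1 : Tendsto (fun k => 2 / p.alpha * (P.obj (T.x k) - P.obj (T.x (k + 1)))) atTop
      (𝓝 (2 / p.alpha * (F - F))) :=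
    (hF.sub (hF.comp (tendsto_add_atTop_nat 1))).const_mul _
  rw [sub_self, mul_zero] at h1
  have h2 : Tendsto (fun k => ‖T.x (k + 1) - T.x k‖ ^ 2) atTop (𝓝 0) := by
    refine squeeze_zero (fun k => by positivity) (fun k => ?_) h1
    have h3 := hT.obj_succ_le hP k
    rw [div_mul_eq_mul_div, le_div_iff₀ hα]
    linarith
  have h3 := h2.sqrt
  simpa using h3

end IsRun

/-! ### Multipliers and error estimates for the inexact solutions -/

theorem norm_piLp_le_sum {E : Type*} [SeminormedAddCommGroup E]
    (V : PiLp 2 (fun _ : Fin m => E)) : ‖V‖ ≤ ∑ i, ‖V i‖ := by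
  have h0 : 0 ≤ ∑ i, ‖V i‖ := Finset.sum_nonneg fun _ _ => norm_nonneg _
  refine (abs_le_of_sq_le_sq' ?_ h0).2
  rw [PiLp.norm_sq_eq_of_L2, pow_two, Finset.sum_mul]
  refine Finset.sum_le_sum fun i _ => ?_
  rw [pow_two]
  exact mul_le_mul_of_nonneg_left
    (Finset.single_le_sum (f := fun i => ‖V i‖) (fun _ _ => norm_nonneg _) (Finset.mem_univ i))
    (norm_nonneg _)

theorem le_mul_of_mul_sq_le {μ a b c d : ℝ} (hμ : 0 < μ) (ha : 0 ≤ a) (hb : 0 ≤ b) (hc : 0 ≤ c)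
    (hd : 0 ≤ d) (h : μ * a ^ 2 ≤ b * d * a + c * d ^ 2) : a ≤ (1 + (b + c) / μ) * d := by
  have h0 : 0 ≤ (b + c) / μ * d := by positivity
  rw [add_mul, one_mul]
  rcases le_total a d with hle | hle
  · linarith
  rcases ha.eq_or_lt with h1 | h1
  · linarith
  have h2 : c * (d * d) ≤ c * (d * a) :=
    mul_le_mul_of_nonneg_left (mul_le_mul_of_nonneg_left hle hd) hc
  have h3 : a * (μ * a) ≤ a * ((b + c) * d) := by linarith
  have h4 := le_of_mul_le_mul_left h3 h1
  have h5 : a ≤ (b + c) / μ * d := by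
    rw [div_mul_eq_mul_div, le_div_iff₀ hμ]
    linarith
  linarith

/-- The value at `(x̄^k, x^k, V^k, L^k, ξ^k)` of the potential function without its quadratic term,
`φ(x̄^k) + g₀(x^k) + ⟪ξ^k, x̄^k - x^k⟫`. -/
noncomputable def Trace.modelValue (P : Problem n m) (T : Trace n m) (xbar : ℕ → Vec n)
    (k : ℕ) : ℝ :=
  P.phi (xbar k) + (P.g0 (T.x k)).toReal + inner ℝ (T.xi k) (xbar k - T.x k)

/-- The optimality condition of the `k`-th accepted subproblem at its solution, with a subgradient
`v` of `φ` and a multiplier `lam`. -/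
def Trace.IsKKT (P : Problem n m) (T : Trace n m) (xbar : ℕ → Vec n) (k : ℕ)
    (v : Vec n) (lam : Vec m) : Prop :=
  IsSubgradient P.phi (xbar k) v ∧
  lam ∈ normalCone (nonpos m) (P.G (xbar k) (T.x k) (T.V k) (T.Lk k)) ∧
  T.xi k + T.Qk k (xbar k - T.x k) + v
    + ∑ i, lam i • (T.V k i + T.Lk k i • (xbar k - T.x k)) = 0

namespace IsRun

variable {P : Problem n m} {O D : Set (Vec n)} {p : Params} {T : Trace n m} {S : Decomp n m}
  {xbar : ℕ → Vec n}

theorem subObj_xbar_le (hT : IsRun P p T)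
    (hxbar : ∀ k, P.IsSubSol (T.x k) (T.xi k) (T.V k) (T.Lk k) (T.Qk k) (xbar k)) (k : ℕ) :
    P.subObj (T.x k) (T.xi k) (T.Qk k) (xbar k)
      ≤ P.subObj (T.x k) (T.xi k) (T.Qk k) (T.x k) := by
  refine (hxbar k).2 ?_
  rw [Problem.subFeas, mem_ofPred_eq, P.G_self]
  exact hT.mem_feas k

theorem norm_Qk_le (hT : IsRun P p T) {B : ℝ} (hB : ∀ k, ∀ j ≤ T.jend k, T.mu k j ≤ B) (k : ℕ) :
    ‖T.Qk k‖ ≤ B + p.M := by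
  have hμ := hT.mu_pos (le_refl (T.jend k))
  have hM := p.M_pos
  exact (norm_le_of_isPositive (hT.isPositive_Q le_rfl) (by linarith)
    (hT.Q_upper k _ le_rfl)).trans (by linarith [hB k _ le_rfl])

/-- Under the partial bounded multiplier property, multipliers of the accepted subproblems can be
chosen bounded, by compactness. -/
theorem exists_bounded_multipliers (hT : IsRun P p T) (hP : P.Standing O)
    (hxbar : ∀ k, P.IsSubSol (T.x k) (T.xi k) (T.V k) (T.Lk k) (T.Qk k) (xbar k))
    (hbmp : ClusterBMP P T xbar) {K : Set (Par n m × Vec n)} (hK : IsCompact K)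
    (hmem : ∀ k, (T.u k, xbar k) ∈ K) {R : ℝ}
    (hR : ∀ k v, IsSubgradient P.phi (xbar k) v →
      ‖T.xi k + T.Qk k (xbar k - T.x k) + v‖ ≤ R) :
    ∃ C, ∀ᶠ k in atTop, ∃ v lam, T.IsKKT P xbar k v lam ∧ ‖lam‖ ≤ C := by
  have hu : ∀ k, T.u k ∈ parSet n m := fun k =>
    ⟨fun i => hT.L_nonneg le_rfl i, hT.isPositive_Q le_rfl⟩
  refine exists_eventually_of_mapClusterPt hK hmem
    (R := fun C k => ∃ v lam, T.IsKKT P xbar k v lam ∧ ‖lam‖ ≤ C)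
    (fun C C' => ⟨max C C', ?_⟩) ?_
  · rintro k (⟨v, lam, h, hle⟩ | ⟨v, lam, h, hle⟩)
    · exact ⟨v, lam, h, hle.trans (le_max_left _ _)⟩
    · exact ⟨v, lam, h, hle.trans (le_max_right _ _)⟩
  · rintro ⟨u, x⟩ hux
    obtain ⟨-, κ, hκ, N, hN, N', hN', h⟩ := hbmp u x hux
    refine ⟨κ * R, N ×ˢ N', prod_mem_nhds hN hN', Eventually.of_forall fun k hk => ?_⟩
    obtain ⟨v, hv, hn⟩ := (hxbar k).exists_isSubgradient hP.phi_convex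
      (fun i => hT.L_nonneg le_rfl i) (hT.isPositive_Q le_rfl)
    obtain ⟨lam, hlam, hg, hle⟩ := h _ hk.1 (hu k) _ hk.2 (hxbar k).1 _ hn
    refine ⟨v, lam, ⟨hv, hlam, ?_⟩, hle.trans ?_⟩
    · have h1 := P.gradMul_G (xbar k) (T.x k) (T.V k) (T.Lk k) lam
      have h2 : gradMul (P.H (T.u k)) (xbar k) lam
        = gradMul (fun y => P.G y (T.x k) (T.V k) (T.Lk k)) (xbar k) lam := rfl
      rw [← h1, ← h2, hg]
      exact add_neg_cancel _
    · rw [norm_neg]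
      exact mul_le_mul_of_nonneg_left (hR k v hv) hκ.le

/-- The estimates that drive the convergence analysis. The distance from `x^k` to the exact
solution `x̄^k` is of the order of the step, and the model value lies between consecutive
objective values up to a multiple of the squared step. -/
theorem exists_estimates (hT : IsRun P p T) (hP : P.Standing O)
    (hxbar : ∀ k, P.IsSubSol (T.x k) (T.xi k) (T.V k) (T.Lk k) (T.Qk k) (xbar k))
    (hbdd : Bornology.IsBounded (range T.x)) (hbmp : ClusterBMP P T xbar)
    (hD : Convex ℝ D) (hS : S.IsFor P D) (hxD : ∀ k, T.x k ∈ interior D) :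
    ∃ C, 0 ≤ C ∧
      (∀ k, ‖T.x k‖ ≤ C ∧ ‖xbar k‖ ≤ C ∧ ‖T.V k‖ ≤ C ∧ ‖T.xi k‖ ≤ C ∧ ‖T.Lk k‖ ≤ C ∧
        ‖T.Qk k‖ ≤ C) ∧
      (∀ k, T.modelValue P xbar k ≤ P.obj (T.x k)) ∧
      ∀ᶠ k in atTop, ‖xbar k - T.x k‖ ≤ C * ‖T.x (k + 1) - T.x k‖ ∧
        P.obj (T.x (k + 1)) ≤ T.modelValue P xbar k + C * ‖T.x (k + 1) - T.x k‖ ^ 2 ∧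
        ∃ v lam, T.IsKKT P xbar k v lam ∧ ‖lam‖ ≤ C ∧ ‖v‖ ≤ C := by
  obtain ⟨C, hC0, hC⟩ := hT.exists_norm_le hbdd hD hS hxD
  obtain ⟨B, hB0, hB⟩ := hT.exists_mu_L_le hP hC
  obtain ⟨R, hR⟩ := hT.exists_norm_sub_le hP hC
  obtain ⟨ρ, hρ0, hρ⟩ := hT.exists_upper_models hP hC R
  have hM := p.M_pos
  have hβC := p.betaC_pos
  have hβS := p.betaS_pos
  have hμ := p.muMin_pos
  have hxR : ∀ k, ‖xbar k - T.x k‖ ≤ R := fun k => hR k _ le_rfl _ (hT.subObj_xbar_le hxbar k)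
  have hR0 : 0 ≤ R := (norm_nonneg _).trans (hxR 0)
  have hxb : ∀ k, ‖xbar k‖ ≤ R + C := fun k => by
    have := norm_add_le (xbar k - T.x k) (T.x k)
    rw [sub_add_cancel] at this
    linarith [hxR k, (hC k).1]
  have hV : ∀ k, ‖T.V k‖ ≤ m * C := fun k => by
    refine (norm_piLp_le_sum _).trans ((Finset.sum_le_sum fun i _ => (hC k).2.2 i).trans ?_)
    simp
  have hL : ∀ k, ‖T.Lk k‖ ≤ m * B := fun k => by
    refine (norm_piLp_le_sum _).trans ((Finset.sum_le_sum (g := fun _ => B) fun i _ => ?_).trans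
      (by simp))
    have h0 : 0 ≤ T.Lk k i := hT.L_nonneg le_rfl i
    rw [Real.norm_of_nonneg h0]
    exact (hB k _ le_rfl).2 i
  have hQ : ∀ k, ‖T.Qk k‖ ≤ B + p.M := hT.norm_Qk_le fun k j hj => (hB k j hj).1
  obtain ⟨A, hA0, hA⟩ := exists_norm_le_of_isSubgradient hP.continuous_phi (R + C)
  have hv : ∀ k v, IsSubgradient P.phi (xbar k) v → ‖v‖ ≤ A := fun k v h => hA _ _ (hxb k) h
  obtain ⟨Λ, hΛ⟩ := hT.exists_bounded_multipliers hP hxbar hbmp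
    (K := (Metric.closedBall 0 C ×ˢ Metric.closedBall 0 (m * B) ×ˢ Metric.closedBall 0 (m * C) ×ˢ
      Metric.closedBall 0 C ×ˢ Metric.closedBall 0 (B + p.M)) ×ˢ Metric.closedBall 0 (R + C))
    (((isCompact_closedBall _ _).prod ((isCompact_closedBall _ _).prod
      ((isCompact_closedBall _ _).prod ((isCompact_closedBall _ _).prod
        (isCompact_closedBall _ _))))).prod (isCompact_closedBall _ _))
    (fun k => by
      simp only [mem_prod, Trace.u, Metric.mem_closedBall, dist_zero_right]
      exact ⟨⟨(hC k).1, hL k, hV k, (hC k).2.1, hQ k⟩, hxb k⟩)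
    (R := C + (B + p.M) * R + A)
    (fun k v h => by
      refine (norm_add_le _ _).trans (add_le_add ((norm_add_le _ _).trans
        (add_le_add (hC k).2.1 (((T.Qk k).le_opNorm _).trans ?_))) (hv k v h))
      exact mul_le_mul (hQ k) (hxR k) (norm_nonneg _) (by linarith))
  -- `Ce` bounds the ratio of the error of the inexact solution and the step
  obtain ⟨Ce, hCe⟩ : ∃ Ce, Ce = 1 + (p.betaS + (p.betaC / 2 + m * |Λ| * (p.betaC / 2))) / p.muMin :=
    ⟨_, rfl⟩
  have hCe0 : 0 ≤ Ce := by rw [hCe]; positivity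
  obtain ⟨C3, hC3⟩ : ∃ C3, C3 = p.betaS * Ce + p.betaC / 2 + ρ / 2 + (B + p.M) * (Ce + 1) ^ 2 :=
    ⟨_, rfl⟩
  have hC30 : 0 ≤ C3 := by rw [hC3]; positivity
  refine ⟨C + (R + C) + m * C + m * B + (B + p.M) + A + |Λ| + (Ce + 1) + C3, by positivity,
    fun k => ?_, fun k => ?_, ?_⟩
  · have h1 : 0 ≤ m * C := by positivity
    have h2 : 0 ≤ m * B := by positivity
    have := abs_nonneg Λ
    have := (hC k).1
    have := (hC k).2.1
    have := hxb k
    have := hV k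
    have := hL k
    have := hQ k
    refine ⟨?_, ?_, ?_, ?_, ?_, ?_⟩ <;> linarith
  · have h1 := hT.subObj_xbar_le hxbar k
    rw [Problem.subObj, Problem.subObj, P.theta_self, Problem.theta] at h1
    have h2 := (hT.isPositive_Q (le_refl (T.jend k))).inner_nonneg_right (xbar k - T.x k)
    simp only [Trace.modelValue, Problem.obj]
    simp only [Trace.Qk] at h1
    linarith
  · filter_upwards [hΛ] with k ⟨v, lam, hkkt, hlam⟩
    set d := ‖T.x (k + 1) - T.x k‖ with hd
    set a := ‖T.x (k + 1) - xbar k‖ with ha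
    have hd0 : 0 ≤ d := norm_nonneg _
    have ha0 : 0 ≤ a := norm_nonneg _
    have hLnn : ∀ i, 0 ≤ T.Lk k i := fun i => hT.L_nonneg le_rfl i
    have hQp : (T.Qk k).IsPositive := hT.isPositive_Q le_rfl
    have hQμ := hT.Q_lower k _ le_rfl
    have hμk := (hT.lower_bounds k _ le_rfl).1
    set μ := T.mu k (T.jend k)
    have hresC := hT.inexact_C k _ le_rfl
    have hresS := hT.inexact_S k _ le_rfl
    have hvy := isSubgradient_of_mem_limSubdiffReal hP.phi_convex (hT.v_mem k _ le_rfl)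
    have h1 := P.subObj_add_le_of_inexact hLnn hQp hQμ (hxbar k).1 hvy (hT.lam_nonneg k _ le_rfl)
      hresC hresS
    have h2 := P.subObj_add_le_of_multiplier (y := T.x (k + 1)) hLnn hQp hQμ hkkt.1 hkkt.2.1
      (by rw [P.gradMul_G]; exact eq_neg_of_add_eq_zero_right hkkt.2.2)
      (fun i => by rw [hT.x_succ]; exact P.G_le_of_resC_le hresC i)
    rw [← hT.x_succ] at h1 h2
    rw [norm_sub_rev (xbar k)] at h1
    rw [← hd, ← ha] at h1 h2
    have hsum : ∑ i, lam i ≤ m * |Λ| := by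
      refine (Finset.sum_le_sum (g := fun _ => |Λ|) fun i _ => ?_).trans (by simp)
      exact (le_abs_self _).trans ((PiLp.norm_apply_le lam i).trans
        (hlam.trans (le_abs_self Λ)))
    have h3 : (∑ i, lam i) * (p.betaC / 2 * d ^ 2) ≤ (m * |Λ|) * (p.betaC / 2 * d ^ 2) :=
      mul_le_mul_of_nonneg_right hsum (by positivity)
    have h4 : p.muMin * a ^ 2 ≤ μ * a ^ 2 := mul_le_mul_of_nonneg_right hμk (by positivity)
    have hae : a ≤ Ce * d := by
      rw [hCe]
      exact le_mul_of_mul_sq_le hμ ha0 hβS.le (by positivity) hd0 (by linarith)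
    have hee : ‖xbar k - T.x k‖ ≤ (Ce + 1) * d := by
      have := norm_sub_le_norm_sub_add_norm_sub (xbar k) (T.x (k + 1)) (T.x k)
      rw [norm_sub_rev (xbar k) (T.x (k + 1))] at this
      linarith
    have hn1 : 0 ≤ m * C := by positivity
    have hn2 : 0 ≤ m * B := by positivity
    have hn3 := abs_nonneg Λ
    refine ⟨hee.trans (mul_le_mul_of_nonneg_right (by linarith) hd0), ?_, v, lam, hkkt, ?_, ?_⟩
    · have h5 := (hρ k (T.x (k + 1)) (by
        rw [hT.x_succ]
        exact hR k _ le_rfl _ (hT.inexact_obj k _ le_rfl))).2 (hT.mem_feas (k + 1))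
      have h6 : P.obj (T.x (k + 1)) ≤ T.modelValue P xbar k + C3 * d ^ 2 := by
        have h7 := hQp.inner_nonneg_right (T.x (k + 1) - T.x k)
        have h8 := real_inner_le_norm (xbar k - T.x k) (T.Qk k (xbar k - T.x k))
        have h9 := (T.Qk k).le_opNorm (xbar k - T.x k)
        have h10 : ‖xbar k - T.x k‖ * ‖T.Qk k (xbar k - T.x k)‖
            ≤ ((Ce + 1) * d) * ((B + p.M) * ((Ce + 1) * d)) :=
          mul_le_mul hee (h9.trans (mul_le_mul (hQ k) hee (norm_nonneg _) (by positivity)))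
            (norm_nonneg _) (by positivity)
        have h11 : p.betaS * d * a ≤ p.betaS * d * (Ce * d) :=
          mul_le_mul_of_nonneg_left hae (by positivity)
        have h12 : 0 ≤ μ / 2 * a ^ 2 := by
          have : 0 < μ := hμ.trans_le hμk
          positivity
        rw [Problem.subObj, Problem.subObj, Problem.theta, Problem.theta] at h1
        simp only [Trace.modelValue, Problem.obj]
        have h13 : 0 ≤ ((Ce + 1) * d) * ((B + p.M) * ((Ce + 1) * d)) := by positivity
        rw [hC3]
        linarith
      refine h6.trans (add_le_add_right (mul_le_mul_of_nonneg_right ?_ (by positivity)) _)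
      linarith
    · linarith [le_abs_self Λ]
    · linarith [hv k v hkkt.1]

end IsRun

/-! ### Subgradients of the potential function -/

section TPart

variable {X : Type*} [NormedAddCommGroup X] [InnerProductSpace ℝ X]

theorem conj_term_eq [CompleteSpace X] {f h : X → ℝ} {s v : X}
    (hv : IsSubgradient h s (-v + gradient f s)) (x : X) :
    inner ℝ v x + f s - inner ℝ (gradient f s) s + conj h (-v + gradient f s)
      = inner ℝ v (x - s) + (f s - h s) := by
  rw [hv.conj_eq, inner_add_right, inner_neg_right, inner_sub_right, real_inner_comm s v,
    real_inner_comm s (gradient f s)]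
  ring

/-- By the Fenchel–Young inequality at `s`, the functions of which the potential is composed are
minorized by smooth functions that are exact to first order in the second variable. -/
theorem exists_le_conj_term [CompleteSpace X] {f h : X → ℝ} (hf : IsStronglyConvexQuadratic f)
    (hh : ∃ σ > (0 : ℝ), StrongConvexOn univ σ h) {s v : X}
    (hv : IsSubgradient h s (-v + gradient f s)) : ∃ K, 0 ≤ K ∧ ∀ x' s' v',
      inner ℝ v' (x' - s) + (f s - h s) - K * ‖s' - s‖ ^ 2 ≤
        inner ℝ v' x' + f s' - inner ℝ (gradient f s') s' + conj h (-v' + gradient f s') := by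
  obtain ⟨-, -, K, hK, hexp⟩ := hf.exists_expansion
  obtain ⟨σ, hσ, hh⟩ := hh
  refine ⟨K, hK, fun x' s' v' => ?_⟩
  have h1 := StrongConvexOn.le_conj hσ hh hv s (-v' + gradient f s')
  have h2 := (abs_le.1 (hexp s' s)).2
  rw [norm_sub_rev s s', inner_sub_right] at h2
  rw [inner_add_right, inner_neg_right, real_inner_comm v' s,
    real_inner_comm (gradient f s') s] at h1
  rw [inner_sub_right]
  linarith

theorem inner_sub_inner_ge {x x' s v v' : X} {r : ℝ} (hx : ‖x' - x‖ ≤ r) (hv : ‖v' - v‖ ≤ r) :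
    inner ℝ v (x' - x) + inner ℝ (x - s) (v' - v) - r ^ 2
      ≤ inner ℝ v' (x' - s) - inner ℝ v (x - s) := by
  have h1 : inner ℝ v' (x' - s) - inner ℝ v (x - s) = inner ℝ v (x' - x)
      + inner ℝ (x - s) (v' - v) + inner ℝ (v' - v) (x' - x) := by
    rw [real_inner_comm (v' - v) (x - s)]
    simp only [inner_sub_left, inner_sub_right]
    ring
  have h2 := (abs_le.1 (abs_real_inner_le_norm (v' - v) (x' - x))).1
  have h3 : ‖v' - v‖ * ‖x' - x‖ ≤ r * r :=
    mul_le_mul hv hx (norm_nonneg _) ((norm_nonneg _).trans hv)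
  rw [h1]
  linarith

theorem half_sq_mul_sub_ge {x x' s s' : X} {l l' r : ℝ} (hl' : 0 ≤ l') (hx : ‖x' - x‖ ≤ r)
    (hs : ‖s' - s‖ ≤ r) (hl : |l' - l| ≤ r) :
    l * inner ℝ (x - s) (x' - x) + l * inner ℝ (s - x) (s' - s)
        + 1 / 2 * ‖x - s‖ ^ 2 * (l' - l) - 2 * ‖x - s‖ * r ^ 2
      ≤ 1 / 2 * ‖x' - s'‖ ^ 2 * l' - 1 / 2 * ‖x - s‖ ^ 2 * l := by
  have e : x' - s' = (x - s) + ((x' - x) - (s' - s)) := by abel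
  set a := x - s with ha
  have e2 : s - x = -a := by rw [ha]; abel
  rw [e, e2, norm_add_sq_real, inner_neg_left, inner_sub_right a (x' - x)]
  set q := ‖x' - x - (s' - s)‖
  set t := inner ℝ a (x' - x) - inner ℝ a (s' - s) with ht
  have h1 : |t| ≤ ‖a‖ * (2 * r) := by
    rw [ht, ← inner_sub_right]
    refine (abs_real_inner_le_norm _ _).trans (mul_le_mul_of_nonneg_left ?_ (norm_nonneg _))
    exact (norm_sub_le _ _).trans (by linarith)
  have h2 : |t * (l' - l)| ≤ ‖a‖ * (2 * r) * r := by
    rw [abs_mul]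
    exact mul_le_mul h1 hl (abs_nonneg _) ((abs_nonneg _).trans h1)
  have h3 := (abs_le.1 h2).1
  have h4 : 0 ≤ q ^ 2 * l' := by positivity
  nlinarith

theorem mem_regSubdiff_of_forall_le {h : X → EReal} {w g : X} {K a : ℝ} (hK : 0 ≤ K)
    (hval : h w = (a : EReal))
    (hmin : ∀ w', h w + ((inner ℝ g (w' - w) - K * ‖w' - w‖ ^ 2 : ℝ) : EReal) ≤ h w') :
    g ∈ regSubdiff h w := by
  refine ⟨?_, ?_, fun ε hε => ?_⟩
  · rw [hval]; exact EReal.coe_ne_top _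
  · rw [hval]; exact EReal.coe_ne_bot _
  · filter_upwards [Metric.ball_mem_nhds w (show 0 < ε / (K + 1) by positivity)] with w' hw'
    rw [Metric.mem_ball, dist_eq_norm, lt_div_iff₀ (by positivity)] at hw'
    refine le_trans ?_ (hmin w')
    rw [hval, ← EReal.coe_add, ← EReal.coe_add, EReal.coe_le_coe_iff]
    have := norm_nonneg (w' - w)
    nlinarith

end TPart

theorem Decomp.T_apply (S : Decomp n m) (x s : Vec n) (V : Mat n m) (L : Vec m) (i : Fin m) :
    S.T x s V L i = inner ℝ (V i) x + S.f i s - inner ℝ (gradient (S.f i) s) s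
      + conj (S.h i) (-V i + gradient (S.f i) s) + 1 / 2 * ‖x - s‖ ^ 2 * L i := rfl

/-- The subgradient of the potential function that the multiplier `lam` and the subgradient `v` of
`φ` provide at the point `(x, s, V, L, ξ, d)`. -/
noncomputable def potentialSubgradient (c : ℝ) (x s : Vec n) (V : Mat n m) (L : Vec m)
    (ξ d v : Vec n) (lam : Vec m) : WSpace n m :=
  WithLp.toLp 2 (mkZ (ξ + v + ∑ i, lam i • (V i + L i • (x - s))) (∑ i, lam i • L i • (s - x))
    (WithLp.toLp 2 fun i => lam i • (x - s))
    (WithLp.toLp 2 fun i => lam i * (1 / 2 * ‖x - s‖ ^ 2)) (x - s), (2 * c) • d)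

/-- The point `(x, s, V, L, ξ, d)` of the domain of the potential function. -/
noncomputable def wPoint (x s : Vec n) (V : Mat n m) (L : Vec m) (ξ d : Vec n) : WSpace n m :=
  WithLp.toLp 2 (mkZ x s V L ξ, d)

theorem inner_potentialSubgradient (c : ℝ) (x s : Vec n) (V : Mat n m) (L : Vec m)
    (ξ d v : Vec n) (lam : Vec m) (x' s' : Vec n) (V' : Mat n m) (L' : Vec m) (ξ' d' : Vec n) :
    inner ℝ (potentialSubgradient c x s V L ξ d v lam)
      (wPoint x' s' V' L' ξ' d' - wPoint x s V L ξ d)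
    = inner ℝ ξ (x' - x) + inner ℝ (x - s) (ξ' - ξ) + inner ℝ v (x' - x)
        + 2 * c * inner ℝ d (d' - d)
        + ∑ i, lam i * ((inner ℝ (V i) (x' - x) + inner ℝ (x - s) (V' i - V i))
          + (L i * inner ℝ (x - s) (x' - x) + L i * inner ℝ (s - x) (s' - s)
            + 1 / 2 * ‖x - s‖ ^ 2 * (L' i - L i))) := by
  have hin : inner ℝ (potentialSubgradient c x s V L ξ d v lam)
      (wPoint x' s' V' L' ξ' d' - wPoint x s V L ξ d)
      = inner ℝ (ξ + v + ∑ i, lam i • (V i + L i • (x - s))) (x' - x)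
        + (inner ℝ (∑ i, lam i • L i • (s - x)) (s' - s)
        + (∑ i, inner ℝ (lam i • (x - s)) (V' i - V i)
        + (∑ i, inner ℝ (lam i * (1 / 2 * ‖x - s‖ ^ 2)) (L' i - L i)
        + inner ℝ (x - s) (ξ' - ξ)))) + inner ℝ ((2 * c) • d) (d' - d) := by
    simp only [WithLp.prod_inner_apply]
    rfl
  have e : ∀ a b : ℝ, inner ℝ a b = a * b := fun a b => by rw [real_inner_comm]; rfl
  rw [hin, inner_add_left (ξ + v), inner_add_left ξ, sum_inner, sum_inner]
  simp only [inner_add_left, real_inner_smul_left, mul_add, Finset.sum_add_distrib, e, mul_assoc]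
  ring

theorem norm_components_sub_le (x s : Vec n) (V : Mat n m) (L : Vec m) (ξ d x' s' : Vec n)
    (V' : Mat n m) (L' : Vec m) (ξ' d' : Vec n) {r : ℝ}
    (hr : ‖wPoint x' s' V' L' ξ' d'
      - wPoint x s V L ξ d‖ ≤ r) :
    ‖x' - x‖ ≤ r ∧ ‖s' - s‖ ≤ r ∧ ‖V' - V‖ ≤ r ∧ ‖L' - L‖ ≤ r ∧ ‖ξ' - ξ‖ ≤ r ∧
      ‖d' - d‖ ≤ r := by
  set δ : WSpace n m := wPoint x' s' V' L' ξ' d' - wPoint x s V L ξ d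
  have hrz : ‖δ.fst‖ ≤ r := (WithLp.norm_fst_le _ δ).trans hr
  have hr1 : ‖δ.fst.snd‖ ≤ r := (WithLp.norm_snd_le _ δ.fst).trans hrz
  have hr2 : ‖δ.fst.snd.snd‖ ≤ r := (WithLp.norm_snd_le _ δ.fst.snd).trans hr1
  have hr3 : ‖δ.fst.snd.snd.snd‖ ≤ r := (WithLp.norm_snd_le _ δ.fst.snd.snd).trans hr2
  exact ⟨(WithLp.norm_fst_le _ δ.fst).trans hrz, (WithLp.norm_fst_le _ δ.fst.snd).trans hr1,
    (WithLp.norm_fst_le _ δ.fst.snd.snd).trans hr2,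
    (WithLp.norm_fst_le _ δ.fst.snd.snd.snd).trans hr3,
    (WithLp.norm_snd_le _ δ.fst.snd.snd.snd).trans hr3, (WithLp.norm_snd_le _ δ).trans hr⟩

/-- A minorant of the potential function on its domain: the indicator function is minorized by
the Lagrangian term, and the result by its linearization up to a quadratic error. -/
theorem exists_potential_minorant {P : Problem n m} {S : Decomp n m} {D : Set (Vec n)}
    (hS : S.IsFor P D) {c : ℝ} (hc : 0 ≤ c) {x s ξ v : Vec n} {V : Mat n m} {L lam : Vec m}
    (h0 : IsSubgradient S.h0 s (-ξ + gradient S.f0 s))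
    (hi : ∀ i, IsSubgradient (S.h i) s (-V i + gradient (S.f i) s))
    (hv : IsSubgradient P.phi x v) (hlam : lam ∈ normalCone (nonpos m) (S.T x s V L)) :
    ∃ K, 0 ≤ K ∧ ∀ (d x' s' : Vec n) (V' : Mat n m) (L' : Vec m) (ξ' d' : Vec n) (r : ℝ),
      ‖x' - x‖ ≤ r → ‖s' - s‖ ≤ r → ‖V' - V‖ ≤ r → ‖L' - L‖ ≤ r → ‖ξ' - ξ‖ ≤ r →
      (∀ i, 0 ≤ L' i) → S.T x' s' V' L' ∈ nonpos m →
      P.phi x + S.T0 x s ξ + c * ‖d‖ ^ 2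
        + (inner ℝ ξ (x' - x) + inner ℝ (x - s) (ξ' - ξ) + inner ℝ v (x' - x)
          + 2 * c * inner ℝ d (d' - d)
          + ∑ i, lam i * ((inner ℝ (V i) (x' - x) + inner ℝ (x - s) (V' i - V i))
            + (L i * inner ℝ (x - s) (x' - x) + L i * inner ℝ (s - x) (s' - s)
              + 1 / 2 * ‖x - s‖ ^ 2 * (L' i - L i))) - K * r ^ 2)
        ≤ P.phi x' + S.T0 x' s' ξ' + c * ‖d'‖ ^ 2 := by
  obtain ⟨-, hnn, hcomp⟩ := mem_normalCone_nonpos_iff.1 hlam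
  obtain ⟨K0, hK0, hlow0⟩ := exists_le_conj_term hS.f0_quad hS.h0_conv h0
  choose Ki hKi hlowi using fun i => exists_le_conj_term (hS.f_quad i) (hS.h_conv i) (hi i)
  have hsum : 0 ≤ ∑ i, lam i * (Ki i + 1 + 2 * ‖x - s‖) := Finset.sum_nonneg fun i _ =>
    mul_nonneg (hnn i) (by have := hKi i; positivity)
  refine ⟨K0 + 1 + ∑ i, lam i * (Ki i + 1 + 2 * ‖x - s‖), by positivity, ?_⟩
  intro d x' s' V' L' ξ' d' r hrx hrs hrV' hrL' hrξ hL' hT'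
  have hrV : ∀ i, ‖V' i - V i‖ ≤ r := fun i => (PiLp.norm_apply_le (V' - V) i).trans hrV'
  have hrL : ∀ i, |L' i - L i| ≤ r := fun i => (PiLp.norm_apply_le (L' - L) i).trans hrL'
  have e0 : S.T0 x s ξ = inner ℝ ξ (x - s) + (S.f0 s - S.h0 s) := conj_term_eq h0 x
  have l0 := hlow0 x' s' ξ'
  have l0' : inner ℝ ξ' (x' - s) + (S.f0 s - S.h0 s) - K0 * ‖s' - s‖ ^ 2 ≤ S.T0 x' s' ξ' := l0
  have l1 := inner_sub_inner_ge (s := s) hrx hrξ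
  have hsr : ‖s' - s‖ ^ 2 ≤ r ^ 2 := pow_le_pow_left₀ (norm_nonneg _) hrs 2
  have l2 : K0 * ‖s' - s‖ ^ 2 ≤ K0 * r ^ 2 := mul_le_mul_of_nonneg_left hsr hK0
  have l3 : ∑ i, lam i * ((inner ℝ (V i) (x' - x) + inner ℝ (x - s) (V' i - V i))
        + (L i * inner ℝ (x - s) (x' - x) + L i * inner ℝ (s - x) (s' - s)
          + 1 / 2 * ‖x - s‖ ^ 2 * (L' i - L i)))
      - (∑ i, lam i * (Ki i + 1 + 2 * ‖x - s‖)) * r ^ 2 ≤ 0 := by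
    rw [Finset.sum_mul, ← Finset.sum_sub_distrib]
    refine Finset.sum_nonpos fun i _ => ?_
    have m1 := inner_sub_inner_ge (s := s) hrx (hrV i)
    have m2 := half_sq_mul_sub_ge (hL' i) hrx hrs (hrL i)
    have m3 := hlowi i x' s' (V' i)
    have m4 := hT' i
    have m5 := hcomp i
    rw [Decomp.T_apply] at m4 m5
    rw [conj_term_eq (hi i)] at m5
    have m6 : Ki i * ‖s' - s‖ ^ 2 ≤ Ki i * r ^ 2 := mul_le_mul_of_nonneg_left hsr (hKi i)
    have m7 : lam i * (((inner ℝ (V i) (x' - x) + inner ℝ (x - s) (V' i - V i))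
        + (L i * inner ℝ (x - s) (x' - x) + L i * inner ℝ (s - x) (s' - s)
          + 1 / 2 * ‖x - s‖ ^ 2 * (L' i - L i))) - (Ki i + 1 + 2 * ‖x - s‖) * r ^ 2
        + (inner ℝ (V i) (x - s) + (S.f i s - S.h i s) + 1 / 2 * ‖x - s‖ ^ 2 * L i)) ≤ 0 :=
      mul_nonpos_of_nonneg_of_nonpos (hnn i) (by linarith)
    rw [mul_add, m5] at m7
    linarith
  have l4 := hv x'
  have l5 : c * ‖d‖ ^ 2 + 2 * c * inner ℝ d (d' - d) ≤ c * ‖d'‖ ^ 2 := by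
    have e : d' = d + (d' - d) := by abel
    have e2 : ‖d'‖ ^ 2 = ‖d‖ ^ 2 + 2 * inner ℝ d (d' - d) + ‖d' - d‖ ^ 2 := by
      conv_lhs => rw [e]
      exact norm_add_sq_real _ _
    rw [e2]
    have : 0 ≤ c * ‖d' - d‖ ^ 2 := by positivity
    linarith
  rw [e0]
  linarith

theorem potential_eq (P : Problem n m) {S : Decomp n m} (c : ℝ) {x s : Vec n} {V : Mat n m}
    {L : Vec m} (ξ d : Vec n) (hL : ∀ i, 0 ≤ L i) (hT : S.T x s V L ∈ nonpos m) :
    potential P S c (wPoint x s V L ξ d)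
      = ((P.phi x + S.T0 x s ξ + c * ‖d‖ ^ 2 : ℝ) : EReal) := by
  rw [EReal.coe_add]
  exact congrArg (· + _) (if_pos ⟨hL, hT⟩)

/-- At a point where the subgradient relations between `s` and `ξ`, `V` hold, multipliers of the
constraint system yield regular subgradients of the potential function. -/
theorem mem_regSubdiff_potential {P : Problem n m} {S : Decomp n m} {D : Set (Vec n)}
    (hS : S.IsFor P D) {c : ℝ} (hc : 0 ≤ c) {x s ξ d v : Vec n} {V : Mat n m} {L lam : Vec m}
    (h0 : IsSubgradient S.h0 s (-ξ + gradient S.f0 s))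
    (hi : ∀ i, IsSubgradient (S.h i) s (-V i + gradient (S.f i) s)) (hL : ∀ i, 0 ≤ L i)
    (hv : IsSubgradient P.phi x v) (hlam : lam ∈ normalCone (nonpos m) (S.T x s V L)) :
    potentialSubgradient c x s V L ξ d v lam
      ∈ regSubdiff (potential P S c) (wPoint x s V L ξ d) := by
  obtain ⟨K, hK, hmin⟩ := exists_potential_minorant hS hc h0 hi hv hlam
  have hval := potential_eq P c ξ d hL hlam.1
  have hmain : ∀ w' : WSpace n m, potential P S c (wPoint x s V L ξ d)
      + ((inner ℝ (potentialSubgradient c x s V L ξ d v lam)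
          (w' - wPoint x s V L ξ d)
        - K * ‖w' - wPoint x s V L ξ d‖ ^ 2 : ℝ) : EReal)
      ≤ potential P S c w' := by
    intro w'
    obtain ⟨x', s', V', L', ξ', d', rfl⟩ : ∃ x' s' V' L' ξ' d',
        w' = wPoint x' s' V' L' ξ' d' := ⟨_, _, _, _, _, _, rfl⟩
    by_cases hdom : (∀ i, 0 ≤ L' i) ∧ S.T x' s' V' L' ∈ nonpos m
    swap
    · have : bigPhi P S (mkZ x' s' V' L' ξ') = ⊤ := if_neg hdom
      have htop : potential P S c (wPoint x' s' V' L' ξ' d') = ⊤ := by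
        rw [potential]
        change bigPhi P S (mkZ x' s' V' L' ξ') + _ = ⊤
        rw [this, EReal.top_add_coe]
      exact le_of_le_of_eq le_top htop.symm
    rw [potential_eq P c ξ' d' hdom.1 hdom.2, hval, ← EReal.coe_add, EReal.coe_le_coe_iff]
    obtain ⟨h1, h2, h3, h4, h5, -⟩ := norm_components_sub_le x s V L ξ d x' s' V' L' ξ' d' le_rfl
    have h6 := hmin d x' s' V' L' ξ' d' _ h1 h2 h3 h4 h5 hdom.1 hdom.2
    rw [← inner_potentialSubgradient c x s V L ξ d v lam x' s' V' L' ξ' d'] at h6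
    exact h6
  exact mem_regSubdiff_of_forall_le hK hval hmain

theorem norm_toLp_prod_le {E F : Type*} [SeminormedAddCommGroup E] [SeminormedAddCommGroup F]
    (a : E) (b : F) : ‖WithLp.toLp 2 (a, b)‖ ≤ ‖a‖ + ‖b‖ := by
  rw [WithLp.prod_norm_eq_of_L2]
  refine Real.sqrt_le_iff.2 ⟨by positivity, ?_⟩
  change ‖a‖ ^ 2 + ‖b‖ ^ 2 ≤ _
  nlinarith [norm_nonneg a, norm_nonneg b, mul_nonneg (norm_nonneg a) (norm_nonneg b)]

theorem norm_potentialSubgradient_le {c : ℝ} (hc : 0 ≤ c) {x s ξ d v : Vec n} {V : Mat n m}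
    {L lam : Vec m} {B : ℝ} (hL : ‖L‖ ≤ B) (hlam : ‖lam‖ ≤ B) :
    ‖potentialSubgradient c x s V L ξ d v lam‖
      ≤ ‖ξ + v + ∑ i, lam i • (V i + L i • (x - s))‖
        + (m * B * B + m * B + m * B * ‖x - s‖ + 1) * ‖x - s‖ + 2 * c * ‖d‖ := by
  have hB : 0 ≤ B := (norm_nonneg _).trans hL
  have hli : ∀ i, ‖lam i‖ ≤ B := fun i => (PiLp.norm_apply_le lam i).trans hlam
  have hLi : ∀ i, ‖L i‖ ≤ B := fun i => (PiLp.norm_apply_le L i).trans hL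
  have h1 : ‖∑ i, lam i • L i • (s - x)‖ ≤ m * B * B * ‖x - s‖ := by
    refine (norm_sum_le _ _).trans ((Finset.sum_le_sum (g := fun _ => B * (B * ‖x - s‖))
      fun i _ => ?_).trans (le_of_eq (by simp; ring)))
    rw [norm_smul, norm_smul, norm_sub_rev]
    gcongr
    · exact hli i
    · exact hLi i
  have h2 : ‖(WithLp.toLp 2 fun i => lam i • (x - s) : Mat n m)‖ ≤ m * B * ‖x - s‖ := by
    refine (norm_piLp_le_sum _).trans ((Finset.sum_le_sum (g := fun _ => B * ‖x - s‖)
      fun i _ => ?_).trans (le_of_eq (by simp; ring)))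
    change ‖lam i • (x - s)‖ ≤ _
    rw [norm_smul]
    gcongr
    exact hli i
  have h3 : ‖(WithLp.toLp 2 fun i => lam i * (1 / 2 * ‖x - s‖ ^ 2) : Vec m)‖
      ≤ m * B * ‖x - s‖ * ‖x - s‖ := by
    refine (norm_piLp_le_sum _).trans ((Finset.sum_le_sum (g := fun _ => B * ‖x - s‖ ^ 2)
      fun i _ => ?_).trans (le_of_eq (by simp; ring)))
    change ‖lam i * (1 / 2 * ‖x - s‖ ^ 2)‖ ≤ _
    rw [norm_mul, Real.norm_of_nonneg (by positivity : 0 ≤ 1 / 2 * ‖x - s‖ ^ 2)]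
    refine mul_le_mul (hli i) ?_ (by positivity) hB
    linarith [sq_nonneg ‖x - s‖]
  have h4 : ‖(2 * c) • d‖ = 2 * c * ‖d‖ := by
    rw [norm_smul, Real.norm_of_nonneg (by positivity)]
  refine (norm_toLp_prod_le _ _).trans ?_
  rw [h4]
  have h5 := norm_toLp_prod_le (ξ + v + ∑ i, lam i • (V i + L i • (x - s)))
    (WithLp.toLp 2 (∑ i, lam i • L i • (s - x), WithLp.toLp 2
      ((WithLp.toLp 2 fun i => lam i • (x - s) : Mat n m), WithLp.toLp 2
        ((WithLp.toLp 2 fun i => lam i * (1 / 2 * ‖x - s‖ ^ 2) : Vec m), x - s))))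
  have h6 := norm_toLp_prod_le (∑ i, lam i • L i • (s - x)) (WithLp.toLp 2
      ((WithLp.toLp 2 fun i => lam i • (x - s) : Mat n m), WithLp.toLp 2
        ((WithLp.toLp 2 fun i => lam i * (1 / 2 * ‖x - s‖ ^ 2) : Vec m), x - s)))
  have h7 := norm_toLp_prod_le (WithLp.toLp 2 fun i => lam i • (x - s) : Mat n m) (WithLp.toLp 2
        ((WithLp.toLp 2 fun i => lam i * (1 / 2 * ‖x - s‖ ^ 2) : Vec m), x - s))
  have h8 := norm_toLp_prod_le
    (WithLp.toLp 2 fun i => lam i * (1 / 2 * ‖x - s‖ ^ 2) : Vec m) (x - s)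
  refine add_le_add (h5.trans ?_) le_rfl
  linarith

/-! ### Stationarity of cluster points -/

theorem exists_tendsto_of_norm_le {E : Type*} [NormedAddCommGroup E] [ProperSpace E]
    {U : Ultrafilter ℕ} {f : ℕ → E} {C : ℝ} (h : ∀ᶠ k in (U : Filter ℕ), ‖f k‖ ≤ C) :
    ∃ y, Tendsto f U (𝓝 y) := by
  obtain ⟨y, -, hy⟩ := (isCompact_closedBall (0 : E) C).ultrafilter_le_nhds' (U.map f)
    (by
      change ∀ᶠ k in (U : Filter ℕ), f k ∈ Metric.closedBall 0 C
      simpa using h)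
  exact ⟨y, hy⟩

namespace IsRun

variable {P : Problem n m} {O D : Set (Vec n)} {p : Params} {T : Trace n m} {S : Decomp n m}
  {xbar : ℕ → Vec n}

/-- Along an ultrafilter that realizes a cluster point, all the bounded quantities in the optimality
conditions of the subproblems converge, and the conditions pass to the limit. -/
theorem omega_subset_stationary (hT : IsRun P p T) (hP : P.Standing O) {C : ℝ}
    (hbd : ∀ k, ‖T.x k‖ ≤ C ∧ ‖xbar k‖ ≤ C ∧ ‖T.V k‖ ≤ C ∧ ‖T.xi k‖ ≤ C ∧ ‖T.Lk k‖ ≤ C ∧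
      ‖T.Qk k‖ ≤ C)
    (hest : ∀ᶠ k in atTop, ‖xbar k - T.x k‖ ≤ C * ‖T.x (k + 1) - T.x k‖ ∧
        ∃ v lam, T.IsKKT P xbar k v lam ∧ ‖lam‖ ≤ C ∧ ‖v‖ ≤ C) :
    T.omega ⊆ P.stationary := by
  intro xs hxs
  obtain ⟨U, hU, hx⟩ := mapClusterPt_iff_ultrafilter.1 hxs
  have hfeas : xs ∈ P.feas :=
    hP.isClosed_feas.mem_of_tendsto hx (Eventually.of_forall hT.mem_feas)
  have hdiff : Tendsto (fun k => xbar k - T.x k) U (𝓝 0) := by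
    refine tendsto_zero_iff_norm_tendsto_zero.2 (Tendsto.mono_left ?_ hU)
    have h := (hT.tendsto_norm_step hP).const_mul C
    rw [mul_zero] at h
    exact squeeze_zero' (Eventually.of_forall fun _ => norm_nonneg _)
      (hest.mono fun k hk => hk.1) h
  have hxb : Tendsto xbar U (𝓝 xs) := by
    have h := hdiff.add hx
    rw [zero_add] at h
    exact h.congr fun k => sub_add_cancel _ _
  have hev : ∀ᶠ k in atTop, ∃ q : Vec n × Vec m,
      T.IsKKT P xbar k q.1 q.2 ∧ ‖q.2‖ ≤ C ∧ ‖q.1‖ ≤ C :=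
    hest.mono fun k ⟨_, v, lam, h⟩ => ⟨(v, lam), h⟩
  obtain ⟨q, hq'⟩ := hev.choice
  have hq : ∀ᶠ k in (U : Filter ℕ), T.IsKKT P xbar k (q k).1 (q k).2 ∧ ‖(q k).2‖ ≤ C ∧
    ‖(q k).1‖ ≤ C := hU hq'
  obtain ⟨v, hv⟩ := exists_tendsto_of_norm_le (hq.mono fun k hk => hk.2.2)
  obtain ⟨lam, hlam⟩ := exists_tendsto_of_norm_le (hq.mono fun k hk => hk.2.1)
  obtain ⟨ξ, hξ⟩ := exists_tendsto_of_norm_le (U := U)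
    (Eventually.of_forall fun k => (hbd k).2.2.2.1)
  obtain ⟨V, hV⟩ := exists_tendsto_of_norm_le (U := U) (Eventually.of_forall fun k => (hbd k).2.2.1)
  obtain ⟨L, hL⟩ := exists_tendsto_of_norm_le (U := U)
    (Eventually.of_forall fun k => (hbd k).2.2.2.2.1)
  obtain ⟨Q, hQ⟩ := exists_tendsto_of_norm_le (U := U)
    (Eventually.of_forall fun k => (hbd k).2.2.2.2.2)
  have happ : ∀ {E : Type} [NormedAddCommGroup E] {f : ℕ → PiLp 2 fun _ : Fin m => E}
      {y : PiLp 2 fun _ : Fin m => E}, Tendsto f U (𝓝 y) → ∀ i,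
      Tendsto (fun k => f k i) U (𝓝 (y i)) := by
    intro E _ f y h i
    have hc : Continuous fun z : PiLp 2 (fun _ : Fin m => E) => z i :=
      PiLp.continuous_apply 2 _ i
    exact (hc.tendsto y).comp h
  have hlami := happ hlam
  have hVi := happ hV
  have hLi := happ hL
  have hG : ∀ i, Tendsto (fun k => P.G (xbar k) (T.x k) (T.V k) (T.Lk k) i) U (𝓝 (P.g xs i)) := by
    intro i
    have h := (((hP.g_lip i).continuous.tendsto xs).comp hx).add ((hVi i).inner hdiff) |>.add
      (((hdiff.norm.pow 2).const_mul (1 / 2)).mul (hLi i))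
    simp only [inner_zero_right, norm_zero, add_zero, ne_eq, OfNat.ofNat_ne_zero,
      not_false_eq_true, zero_pow, mul_zero, zero_mul] at h
    exact h
  refine ⟨hfeas, ξ, ?_, v, ?_, lam, ?_, V, fun i => ?_, ?_⟩
  · have hO := hP.feas_subset hfeas
    refine mem_limSubdiff_of_tendsto hx ?_ hξ hT.xi_mem (hP.g0_ne_top _ hO) (hP.g0_ne_bot _)
    have h1 : Tendsto (fun k => (P.g0 (T.x k)).toReal) U (𝓝 (P.g0 xs).toReal) :=
      ((hP.g0_lip.continuousOn.continuousAt (hP.isOpen.mem_nhds hO)).tendsto).comp hx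
    have h2 := (continuous_coe_real_ereal.tendsto _).comp h1
    rw [EReal.coe_toReal (hP.g0_ne_top _ hO) (hP.g0_ne_bot _)] at h2
    refine h2.congr fun k => ?_
    exact EReal.coe_toReal (hP.g0_ne_top _ (hP.feas_subset (hT.mem_feas k))) (hP.g0_ne_bot _)
  · exact (IsSubgradient.of_tendsto hP.continuous_phi hxb hv
      (hq.mono fun k hk => hk.1.1)).mem_limSubdiffReal
  · refine mem_normalCone_nonpos_iff.2 ⟨hfeas, fun i => ?_, fun i => ?_⟩
    · exact ge_of_tendsto (hlami i)
        (hq.mono fun k hk => (mem_normalCone_nonpos_iff.1 hk.1.2.1).2.1 i)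
    · refine tendsto_nhds_unique_of_eventuallyEq ((hlami i).mul (hG i))
        (tendsto_const_nhds (x := (0 : ℝ))) ?_
      exact hq.mono fun k hk => (mem_normalCone_nonpos_iff.1 hk.1.2.1).2.2 i
  · refine mem_limSubdiff_of_tendsto hx ?_ (hVi i) (fun k => hT.V_mem k i)
      (EReal.coe_ne_top _) (EReal.coe_ne_bot _)
    exact (continuous_coe_real_ereal.tendsto _).comp
      (((hP.g_lip i).continuous.tendsto xs).comp hx)
  · have hQd : Tendsto (fun k => T.Qk k (xbar k - T.x k)) U (𝓝 (Q 0)) :=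
      (isBoundedBilinearMap_apply.continuous.tendsto (Q, (0 : Vec n))).comp (hQ.prodMk_nhds hdiff)
    have h1 : Tendsto (fun k => T.xi k + T.Qk k (xbar k - T.x k) + (q k).1
        + ∑ i, (q k).2 i • (T.V k i + T.Lk k i • (xbar k - T.x k))) U
        (𝓝 (ξ + Q 0 + v + ∑ i, lam i • (V i + L i • (0 : Vec n)))) :=
      ((hξ.add hQd).add hv).add (tendsto_finsetSum _ fun i _ =>
        (hlami i).smul ((hVi i).add ((hLi i).smul hdiff)))
    simp only [map_zero, add_zero, smul_zero] at h1
    exact tendsto_nhds_unique_of_eventuallyEq h1 tendsto_const_nhds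
      (hq.mono fun k hk => hk.1.2.2)

/-! ### The potential function along the run -/

/-- At the run, Fenchel's equality turns `T₀` into the linearization of `g₀` at `x^k`. -/
theorem T0_eq (hT : IsRun P p T) (hD : Convex ℝ D) (hS : S.IsFor P D)
    (hxD : ∀ k, T.x k ∈ interior D) (k : ℕ) :
    P.phi (xbar k) + S.T0 (xbar k) (T.x k) (T.xi k) = T.modelValue P xbar k := by
  have h1 : S.T0 (xbar k) (T.x k) (T.xi k) = _ :=
    conj_term_eq (hT.isSubgradient_h0 hD hS hxD k) (xbar k)
  rw [h1, Trace.modelValue, hS.eq0 _ (interior_subset (hxD k)), EReal.toReal_coe]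
  ring

/-- At the run, Fenchel's equality turns `T` into the constraint map of the subproblem. -/
theorem T_eq (hT : IsRun P p T) (hD : Convex ℝ D) (hS : S.IsFor P D)
    (hxD : ∀ k, T.x k ∈ interior D) (k : ℕ) :
    S.T (xbar k) (T.x k) (T.V k) (T.Lk k) = P.G (xbar k) (T.x k) (T.V k) (T.Lk k) := by
  ext i
  rw [Decomp.T_apply, conj_term_eq (hT.isSubgradient_h hD hS hxD k i), P.G_apply,
    hS.eq i _ (interior_subset (hxD k))]
  ring

theorem potential_run_eq (hT : IsRun P p T) (hD : Convex ℝ D) (hS : S.IsFor P D)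
    (hxD : ∀ k, T.x k ∈ interior D)
    (hxbar : ∀ k, P.IsSubSol (T.x k) (T.xi k) (T.V k) (T.Lk k) (T.Qk k) (xbar k))
    (c : ℝ) (k : ℕ) (d : Vec n) :
    potential P S c (wPoint (xbar k) (T.x k) (T.V k) (T.Lk k) (T.xi k) d)
      = ((T.modelValue P xbar k + c * ‖d‖ ^ 2 : ℝ) : EReal) := by
  have h := (hxbar k).1
  have hL : ∀ i, 0 ≤ T.Lk k i := fun i => hT.L_nonneg le_rfl i
  rw [potential_eq P c _ _ hL
    (by rw [hT.T_eq hD hS hxD k]; exact h), hT.T0_eq hD hS hxD k]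

/-- The potential function is constant on the set of cluster points of the run. -/
theorem potential_eq_of_mapClusterPt (hT : IsRun P p T) (hP : P.Standing O) (hD : Convex ℝ D)
    (hS : S.IsFor P D) (hxD : ∀ k, T.x k ∈ interior D)
    (hxbar : ∀ k, P.IsSubSol (T.x k) (T.xi k) (T.V k) (T.Lk k) (T.Qk k) (xbar k))
    {F : ℝ} (hF : Tendsto (T.modelValue P xbar) atTop (𝓝 F)) (c : ℝ) {w : WSpace n m}
    (hw : MapClusterPt w atTop (T.w xbar)) : potential P S c w = (F : EReal) := by
  obtain ⟨U, hU, hlim⟩ := mapClusterPt_iff_ultrafilter.1 hw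
  obtain ⟨x, s, V, L, ξ, d, rfl⟩ : ∃ x s V L ξ d, w = wPoint x s V L ξ d :=
    ⟨_, _, _, _, _, _, rfl⟩
  have hn : Tendsto (fun k => ‖T.w xbar k - wPoint x s V L ξ d‖) U (𝓝 0) :=
    tendsto_iff_norm_sub_tendsto_zero.1 hlim
  have hcomp := fun k => norm_components_sub_le x s V L ξ d (xbar k) (T.x k) (T.V k) (T.Lk k)
    (T.xi k) (T.x (k + 1) - T.x k) (r := ‖T.w xbar k - wPoint x s V L ξ d‖) le_rfl
  have hx : Tendsto xbar U (𝓝 x) := tendsto_iff_norm_sub_tendsto_zero.2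
    (squeeze_zero (fun _ => norm_nonneg _) (fun k => (hcomp k).1) hn)
  have hs : Tendsto T.x U (𝓝 s) := tendsto_iff_norm_sub_tendsto_zero.2
    (squeeze_zero (fun _ => norm_nonneg _) (fun k => (hcomp k).2.1) hn)
  have hV : ∀ i, Tendsto (fun k => T.V k i) U (𝓝 (V i)) := fun i =>
    tendsto_iff_norm_sub_tendsto_zero.2 (squeeze_zero (fun _ => norm_nonneg _)
      (fun k => (PiLp.norm_apply_le (T.V k - V) i).trans (hcomp k).2.2.1) hn)
  have hL : ∀ i, Tendsto (fun k => T.Lk k i) U (𝓝 (L i)) := fun i =>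
    tendsto_iff_norm_sub_tendsto_zero.2 (squeeze_zero (fun _ => norm_nonneg _)
      (fun k => (PiLp.norm_apply_le (T.Lk k - L) i).trans (hcomp k).2.2.2.1) hn)
  have hξ : Tendsto T.xi U (𝓝 ξ) := tendsto_iff_norm_sub_tendsto_zero.2
    (squeeze_zero (fun _ => norm_nonneg _) (fun k => (hcomp k).2.2.2.2.1) hn)
  have hd : d = 0 := by
    refine tendsto_nhds_unique (tendsto_iff_norm_sub_tendsto_zero.2
      (squeeze_zero (fun _ => norm_nonneg _) (fun k => (hcomp k).2.2.2.2.2) hn)) ?_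
    exact tendsto_zero_iff_norm_tendsto_zero.2 ((hT.tendsto_norm_step hP).mono_left hU)
  -- the subgradient relations pass to the limit, and with them the Fenchel equalities
  have key : ∀ (f h : Vec n → ℝ), IsStronglyConvexQuadratic f →
      (∃ σ > (0 : ℝ), StrongConvexOn univ σ h) → ∀ (vs : ℕ → Vec n) (v : Vec n),
      Tendsto vs U (𝓝 v) → (∀ k, IsSubgradient h (T.x k) (-vs k + gradient f (T.x k))) →
      Tendsto (fun k => inner ℝ (vs k) (xbar k) + f (T.x k) - inner ℝ (gradient f (T.x k)) (T.x k)
        + conj h (-vs k + gradient f (T.x k))) U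
      (𝓝 (inner ℝ v x + f s - inner ℝ (gradient f s) s + conj h (-v + gradient f s))) := by
    rintro f h hf ⟨σ, hσ, hh⟩ vs v hvs hsub
    obtain ⟨hfc, hgc, -⟩ := hf.exists_expansion
    have hhc := (StrongConvexOn.convexOn_univ hσ hh).locallyLipschitz.continuous
    have hlim : IsSubgradient h s (-v + gradient f s) := IsSubgradient.of_tendsto hhc hs
      (hvs.neg.add ((hgc.tendsto s).comp hs)) (Eventually.of_forall hsub)
    rw [conj_term_eq hlim]
    refine Tendsto.congr (fun k => (conj_term_eq (hsub k) (xbar k)).symm) ?_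
    exact (hvs.inner (hx.sub hs)).add (((hfc.tendsto s).comp hs).sub ((hhc.tendsto s).comp hs))
  have hT0 : Tendsto (fun k => S.T0 (xbar k) (T.x k) (T.xi k)) U (𝓝 (S.T0 x s ξ)) :=
    key _ _ hS.f0_quad hS.h0_conv _ _ hξ (hT.isSubgradient_h0 hD hS hxD)
  have hTi : ∀ i, Tendsto (fun k => S.T (xbar k) (T.x k) (T.V k) (T.Lk k) i) U
      (𝓝 (S.T x s V L i)) := fun i =>
    (key _ _ (hS.f_quad i) (hS.h_conv i) _ _ (hV i) fun k => hT.isSubgradient_h hD hS hxD k i).add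
      ((((hx.sub hs).norm.pow 2).const_mul _).mul (hL i))
  have hfeas : S.T x s V L ∈ nonpos m := fun i => le_of_tendsto (hTi i)
    (Eventually.of_forall fun k => by rw [hT.T_eq hD hS hxD k]; exact (hxbar k).1 i)
  have hLnn : ∀ i, 0 ≤ L i := fun i => ge_of_tendsto (hL i)
    (Eventually.of_forall fun k => hT.L_nonneg le_rfl i)
  have hval : P.phi x + S.T0 x s ξ = F := by
    refine tendsto_nhds_unique (((hP.continuous_phi.tendsto x).comp hx).add hT0)
      ((hF.mono_left hU).congr fun k => ?_)
    exact (hT.T0_eq hD hS hxD k).symm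
  rw [potential_eq P c _ _ hLnn hfeas, hval, hd, norm_zero]
  simp

end IsRun

/-! ### The Kurdyka–Łojasiewicz inequality and summability of the steps -/

namespace IsRun

variable {P : Problem n m} {O D : Set (Vec n)} {p : Params} {T : Trace n m} {S : Decomp n m}
  {xbar : ℕ → Vec n}

/-- The subgradients of the potential function along the run are of the order of the step. The last
component of the point is the step scaled by `t`. -/
theorem exists_infEDist_le (hT : IsRun P p T) (hD : Convex ℝ D) (hS : S.IsFor P D)
    (hxD : ∀ k, T.x k ∈ interior D) {C c : ℝ} (hc : 0 ≤ c) (hC : 0 ≤ C)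
    (hbd : ∀ k, ‖T.x k‖ ≤ C ∧ ‖xbar k‖ ≤ C ∧ ‖T.V k‖ ≤ C ∧ ‖T.xi k‖ ≤ C ∧ ‖T.Lk k‖ ≤ C ∧
      ‖T.Qk k‖ ≤ C)
    (hest : ∀ᶠ k in atTop, ‖xbar k - T.x k‖ ≤ C * ‖T.x (k + 1) - T.x k‖ ∧
        ∃ v lam, T.IsKKT P xbar k v lam ∧ ‖lam‖ ≤ C ∧ ‖v‖ ≤ C) (t : ℝ) :
    ∃ A, 0 ≤ A ∧ ∀ᶠ k in atTop, Metric.infEDist 0 (limSubdiff (potential P S c)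
        (wPoint (xbar k) (T.x k) (T.V k) (T.Lk k) (T.xi k) (t • (T.x (k + 1) - T.x k))))
      ≤ ENNReal.ofReal (A * ‖T.x (k + 1) - T.x k‖) := by
  refine ⟨(C + (m * C * C + m * C + m * C * (2 * C) + 1)) * C + 2 * c * |t|, by positivity, ?_⟩
  filter_upwards [hest] with k ⟨hek, v, lam, hkkt, hlam, _⟩
  obtain ⟨hx, hxb, -, -, hL, hQ⟩ := hbd k
  have hLnn : ∀ i, 0 ≤ T.Lk k i := fun i => hT.L_nonneg le_rfl i
  have hmem := regSubdiff_subset_limSubdiff _ _ (mem_regSubdiff_potential hS hc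
    (d := t • (T.x (k + 1) - T.x k)) (hT.isSubgradient_h0 hD hS hxD k)
    (hT.isSubgradient_h hD hS hxD k) hLnn hkkt.1
    (by rw [hT.T_eq hD hS hxD k]; exact hkkt.2.1))
  refine (Metric.infEDist_le_edist_of_mem hmem).trans ?_
  rw [edist_dist, dist_zero_left]
  refine ENNReal.ofReal_le_ofReal ((norm_potentialSubgradient_le hc hL hlam).trans ?_)
  have e : T.xi k + v + ∑ i, lam i • (T.V k i + T.Lk k i • (xbar k - T.x k))
      = -(T.Qk k (xbar k - T.x k)) := by
    rw [eq_neg_iff_add_eq_zero, ← hkkt.2.2]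
    abel
  rw [e, norm_neg, norm_smul, Real.norm_eq_abs]
  have h1 : ‖T.Qk k (xbar k - T.x k)‖ ≤ C * ‖xbar k - T.x k‖ :=
    ((T.Qk k).le_opNorm _).trans (mul_le_mul_of_nonneg_right hQ (norm_nonneg _))
  have h2 : ‖xbar k - T.x k‖ ≤ 2 * C := (norm_sub_le _ _).trans (by linarith)
  have h3 : (m * C * C + m * C + m * C * ‖xbar k - T.x k‖ + 1) * ‖xbar k - T.x k‖
      ≤ (m * C * C + m * C + m * C * (2 * C) + 1) * ‖xbar k - T.x k‖ := by gcongr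
  have h4 : (C + (m * C * C + m * C + m * C * (2 * C) + 1)) * ‖xbar k - T.x k‖
      ≤ (C + (m * C * C + m * C + m * C * (2 * C) + 1)) * (C * ‖T.x (k + 1) - T.x k‖) := by
    gcongr
  linarith

end IsRun

/-- The range `η` and a desingularizing function, of which only the monotonicity and the
nonnegativity are recorded. These functions are stable under sums, so that finitely
many of them can be replaced with a single one. -/
def DesingPair : Type :=
  {q : ℝ × (ℝ → ℝ) // 0 < q.1 ∧ (∀ t ∈ Ico 0 q.1, 0 ≤ q.2 t) ∧ MonotoneOn q.2 (Ico 0 q.1)}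

instance : Nonempty DesingPair := ⟨⟨(1, 0), one_pos, fun _ _ => le_rfl, monotoneOn_const⟩⟩

/-- The Kurdyka–Łojasiewicz inequality at a point where the function exceeds the reference
value by `b`, in integrated form: below `b`, increments of the desingularizing function dominate
increments of the argument divided by the norm `a` of a subgradient. -/
def DesingPair.Holds (q : DesingPair) (a b : ℝ) : Prop :=
  b < q.1.1 → ∀ s r, 0 ≤ s → s ≤ r → r ≤ b → 0 < b → r - s ≤ (q.1.2 r - q.1.2 s) * a

theorem DesingPair.exists_or_imp (q q' : DesingPair) : ∃ q'' : DesingPair, ∀ a b : ℝ, 0 ≤ a →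
    (q.Holds a b ∨ q'.Holds a b → q''.Holds a b) := by
  obtain ⟨⟨η, ψ⟩, hη, hψ, hm⟩ := q
  obtain ⟨⟨η', ψ'⟩, hη', hψ', hm'⟩ := q'
  have hs : Ico 0 (min η η') ⊆ Ico 0 η := Ico_subset_Ico_right (min_le_left _ _)
  have hs' : Ico 0 (min η η') ⊆ Ico 0 η' := Ico_subset_Ico_right (min_le_right _ _)
  refine ⟨⟨(min η η', ψ + ψ'), lt_min hη hη', fun t ht =>
    add_nonneg (hψ t (hs ht)) (hψ' t (hs' ht)), (hm.mono hs).add (hm'.mono hs')⟩, ?_⟩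
  intro a b ha h hb s r h0 hsr hrb hb0
  have hb1 : b < η := lt_of_lt_of_le hb (min_le_left _ _)
  have hb2 : b < η' := lt_of_lt_of_le hb (min_le_right _ _)
  have m1 : 0 ≤ ψ r - ψ s := sub_nonneg.2 (hm ⟨h0, by linarith⟩ ⟨by linarith, by linarith⟩ hsr)
  have m2 : 0 ≤ ψ' r - ψ' s :=
    sub_nonneg.2 (hm' ⟨h0, by linarith⟩ ⟨by linarith, by linarith⟩ hsr)
  change r - s ≤ ((ψ r + ψ' r) - (ψ s + ψ' s)) * a
  rcases h with h | h
  · have := h hb1 s r h0 hsr hrb hb0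
    have : (ψ r - ψ s) * a ≤ ((ψ r + ψ' r) - (ψ s + ψ' s)) * a :=
      mul_le_mul_of_nonneg_right (by linarith) ha
    simp only at *
    linarith
  · have := h hb2 s r h0 hsr hrb hb0
    have : (ψ' r - ψ' s) * a ≤ ((ψ r + ψ' r) - (ψ s + ψ' s)) * a :=
      mul_le_mul_of_nonneg_right (by linarith) ha
    simp only at *
    linarith

/-- Extraction of the integrated inequality from the Kurdyka–Łojasiewicz property. -/
theorem HasKL.exists_desingPair {X : Type*} [NormedAddCommGroup X] [InnerProductSpace ℝ X]
    {h : X → EReal} {w : X} (hKL : HasKL h w) {F : ℝ} (hF : h w = (F : EReal)) :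
    ∃ q : DesingPair, ∃ δ > 0, ∀ y ∈ Metric.closedBall w δ, ∀ a b : ℝ, 0 ≤ a →
      h y = ((F + b : ℝ) : EReal) → Metric.infEDist 0 (limSubdiff h y) ≤ ENNReal.ofReal a →
      q.Holds a b := by
  obtain ⟨-, δ, hδ, η, hη, ψ, hψ, hineq⟩ := hKL
  obtain ⟨η', hη'0, hη'⟩ := EReal.lt_iff_exists_real_btwn.1 hη
  have hη'pos : 0 < η' := EReal.coe_pos.1 hη'0
  have hlt : ∀ t : ℝ, t < η' → (t : EReal) < η := fun t ht =>
    (EReal.coe_lt_coe_iff.2 ht).trans hη'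
  have hmono : MonotoneOn ψ (Ico 0 η') := by
    intro s hs r hr hsr
    rcases hr.1.eq_or_lt with h0 | h0
    · rw [le_antisymm hsr (h0 ▸ hs.1)]
    have h1 := hψ.deriv_mul_le hs.1 hsr le_rfl h0 (hlt r hr.2)
    have h2 := (hψ.2.2.2.2.2 r h0 (hlt r hr.2)).le
    have := mul_nonneg h2 (sub_nonneg.2 hsr)
    linarith
  refine ⟨⟨(η', ψ), hη'pos, fun t ht => hψ.2.2.1 t ⟨ht.1, hlt t ht.2⟩, hmono⟩, δ, hδ, ?_⟩
  intro y hy a b ha hyb hdist hb s r h0 hsr hrb hb0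
  have hbη' : b < η' := hb
  have h1 := hineq y hy (by rw [hF, hyb, EReal.coe_lt_coe_iff]; linarith) (by
    rw [hF, hyb, EReal.coe_add]
    exact EReal.add_lt_add_left_coe (hlt b hbη') F)
  have e : (h y - h w).toReal = b := by
    rw [hF, hyb, ← EReal.coe_sub, EReal.toReal_coe]
    ring
  rw [e] at h1
  have hder := hψ.2.2.2.2.2 b hb0 (hlt b hbη')
  have h2 : 1 ≤ deriv ψ b * a := by
    have h3 := h1.trans (mul_le_mul_right hdist _)
    rw [← ENNReal.ofReal_mul hder.le] at h3
    exact ENNReal.one_le_ofReal.1 h3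
  have h3 := hψ.deriv_mul_le h0 hsr hrb hb0 (hlt b hbη')
  have h4 : deriv ψ b * (r - s) * a ≤ (ψ r - ψ s) * a := mul_le_mul_of_nonneg_right h3 ha
  have h5 : (r - s) * 1 ≤ (r - s) * (deriv ψ b * a) :=
    mul_le_mul_of_nonneg_left h2 (sub_nonneg.2 hsr)
  change r - s ≤ (ψ r - ψ s) * a
  linarith

namespace IsRun

variable {P : Problem n m} {O D : Set (Vec n)} {p : Params} {T : Trace n m} {S : Decomp n m}
  {xbar : ℕ → Vec n}

theorem norm_w_le {C : ℝ}
    (hbd : ∀ k, ‖T.x k‖ ≤ C ∧ ‖xbar k‖ ≤ C ∧ ‖T.V k‖ ≤ C ∧ ‖T.xi k‖ ≤ C ∧ ‖T.Lk k‖ ≤ C ∧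
      ‖T.Qk k‖ ≤ C) (k : ℕ) : ‖T.w xbar k‖ ≤ 7 * C := by
  obtain ⟨hx, hxb, hV, hξ, hL, -⟩ := hbd k
  have h1 := norm_toLp_prod_le (mkZ (xbar k) (T.x k) (T.V k) (T.Lk k) (T.xi k))
    (T.x (k + 1) - T.x k)
  have h2 := norm_toLp_prod_le (xbar k) (WithLp.toLp 2 (T.x k, WithLp.toLp 2
    (T.V k, WithLp.toLp 2 (T.Lk k, T.xi k))))
  have h3 := norm_toLp_prod_le (T.x k) (WithLp.toLp 2 (T.V k, WithLp.toLp 2 (T.Lk k, T.xi k)))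
  have h4 := norm_toLp_prod_le (T.V k) (WithLp.toLp 2 (T.Lk k, T.xi k))
  have h5 := norm_toLp_prod_le (T.Lk k) (T.xi k)
  have h6 := norm_sub_le (T.x (k + 1)) (T.x k)
  have h7 := (hbd (k + 1)).1
  change ‖WithLp.toLp 2 (mkZ (xbar k) (T.x k) (T.V k) (T.Lk k) (T.xi k),
    T.x (k + 1) - T.x k)‖ ≤ _
  refine h1.trans ?_
  have h8 : ‖mkZ (xbar k) (T.x k) (T.V k) (T.Lk k) (T.xi k)‖ ≤ 5 * C := h2.trans (by linarith)
  linarith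

/-- Summability of the steps. The descent of the objective is measured with the desingularizing
function, while the Kurdyka–Łojasiewicz inequality holds at the potential values `b k`, which
dominate the next objective value. -/
theorem summable_step (hT : IsRun P p T) (hP : P.Standing O) (hD : Convex ℝ D)
    (hS : S.IsFor P D) (hxD : ∀ k, T.x k ∈ interior D)
    (hxbar : ∀ k, P.IsSubSol (T.x k) (T.xi k) (T.V k) (T.Lk k) (T.Qk k) (xbar k))
    {c C : ℝ} (hc : 0 < c) (hC : 0 ≤ C)
    (hKL : ∀ w, MapClusterPt w atTop (T.w xbar) → HasKL (potential P S c) w)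
    (hbd : ∀ k, ‖T.x k‖ ≤ C ∧ ‖xbar k‖ ≤ C ∧ ‖T.V k‖ ≤ C ∧ ‖T.xi k‖ ≤ C ∧ ‖T.Lk k‖ ≤ C ∧
      ‖T.Qk k‖ ≤ C)
    (hub : ∀ k, T.modelValue P xbar k ≤ P.obj (T.x k))
    (hlb : ∀ᶠ k in atTop, P.obj (T.x (k + 1))
      ≤ T.modelValue P xbar k + C * ‖T.x (k + 1) - T.x k‖ ^ 2)
    (hest : ∀ᶠ k in atTop, ‖xbar k - T.x k‖ ≤ C * ‖T.x (k + 1) - T.x k‖ ∧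
        ∃ v lam, T.IsKKT P xbar k v lam ∧ ‖lam‖ ≤ C ∧ ‖v‖ ≤ C) :
    Summable fun k => ‖T.x (k + 1) - T.x k‖ := by
  obtain ⟨F, hF, hFle⟩ := hT.exists_tendsto_obj hP
  have hstep := hT.tendsto_norm_step hP
  have hstep2 : Tendsto (fun k => C * ‖T.x (k + 1) - T.x k‖ ^ 2) atTop (𝓝 0) := by
    have := (hstep.pow 2).const_mul C
    simpa using this
  have hmodel : Tendsto (T.modelValue P xbar) atTop (𝓝 F) := by
    have h1 : Tendsto (fun k => P.obj (T.x (k + 1)) - C * ‖T.x (k + 1) - T.x k‖ ^ 2) atTop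
        (𝓝 F) := by
      have := (hF.comp (tendsto_add_atTop_nat 1)).sub hstep2
      rwa [sub_zero] at this
    exact tendsto_of_tendsto_of_tendsto_of_le_of_le' h1 hF
      (hlb.mono fun k hk => by linarith) (Eventually.of_forall hub)
  -- scaling the last component by `t` replaces the coefficient `c` with `C`
  set t := Real.sqrt (C / c) with ht
  have htc : c * t ^ 2 = C := by
    rw [ht, Real.sq_sqrt (by positivity)]
    field_simp
  set d : ℕ → ℝ := fun k => ‖T.x (k + 1) - T.x k‖ with hd
  set b : ℕ → ℝ := fun k => T.modelValue P xbar k + C * d k ^ 2 - F with hb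
  set wt : ℕ → WSpace n m := fun k =>
    wPoint (xbar k) (T.x k) (T.V k) (T.Lk k) (T.xi k) (t • (T.x (k + 1) - T.x k)) with hwt
  have hval : ∀ k, potential P S c (wt k) = ((F + b k : ℝ) : EReal) := by
    intro k
    rw [hwt]
    simp only
    rw [hT.potential_run_eq hD hS hxD hxbar c k, norm_smul, mul_pow, Real.norm_eq_abs, sq_abs,
      ← mul_assoc, htc]
    congr 1
    simp only [hb, hd]
    ring
  have hdist : Tendsto (fun k => dist (wt k) (T.w xbar k)) atTop (𝓝 0) := by
    have h1 : Tendsto (fun k => |t - 1| * d k) atTop (𝓝 0) := by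
      have := hstep.const_mul |t - 1|
      rwa [mul_zero] at this
    refine squeeze_zero (fun _ => dist_nonneg) (fun k => ?_) h1
    have e : wt k - T.w xbar k
        = WithLp.toLp 2 ((0 : ZSpace n m), (t - 1) • (T.x (k + 1) - T.x k)) := by
      have h2 : wt k - T.w xbar k = WithLp.toLp 2
        (mkZ (xbar k) (T.x k) (T.V k) (T.Lk k) (T.xi k)
          - mkZ (xbar k) (T.x k) (T.V k) (T.Lk k) (T.xi k),
          t • (T.x (k + 1) - T.x k) - (T.x (k + 1) - T.x k)) := rfl
      rw [h2, sub_self, sub_smul, one_smul]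
    rw [dist_eq_norm, e]
    refine (norm_toLp_prod_le _ _).trans ?_
    rw [norm_zero, zero_add, norm_smul, Real.norm_eq_abs]
  obtain ⟨A, hA0, hA⟩ := hT.exists_infEDist_le hD hS hxD hc.le hC hbd hest t
  obtain ⟨q, hq⟩ := exists_eventually_of_mapClusterPt
    (isCompact_closedBall (0 : WSpace n m) (7 * C)) (a := T.w xbar)
    (fun k => by simpa using norm_w_le hbd k)
    (R := fun (q : DesingPair) k => q.Holds (A * d k) (b k))
    (fun q q' => by
      obtain ⟨q'', h⟩ := q.exists_or_imp q'
      exact ⟨q'', fun k => h _ _ (by positivity)⟩)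
    (fun w hw => by
      obtain ⟨q, δ, hδ, h⟩ := (hKL w hw).exists_desingPair
        (hT.potential_eq_of_mapClusterPt hP hD hS hxD hxbar hmodel c hw)
      refine ⟨q, Metric.ball w (δ / 2), Metric.ball_mem_nhds w (by positivity), ?_⟩
      filter_upwards [hA, hdist.eventually_lt_const (show 0 < δ / 2 by positivity)] with k h1 h2 h3
      refine h (wt k) ?_ _ _ (by positivity) (hval k) h1
      rw [Metric.mem_ball] at h3
      rw [Metric.mem_closedBall]
      linarith [dist_triangle (wt k) (T.w xbar k) w])
  obtain ⟨⟨η, ψ⟩, hη, hψ0, hψm⟩ := q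
  have hb0 : Tendsto b atTop (𝓝 0) := by
    have := (hmodel.add hstep2).sub_const F
    simpa using this
  have ha0 : Tendsto (fun k => P.obj (T.x (k + 1)) - F) atTop (𝓝 0) := by
    have := (hF.comp (tendsto_add_atTop_nat 1)).sub_const F
    simpa using this
  obtain ⟨N, hN⟩ := eventually_atTop.1 (hq.and (hlb.and ((hb0.eventually_lt_const hη).and
    (ha0.eventually_lt_const hη))))
  have hα := p.alpha_pos
  have hdec : ∀ k, p.alpha / 2 * d k ^ 2 ≤ P.obj (T.x k) - P.obj (T.x (k + 1)) := fun k => by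
    have := hT.obj_succ_le hP k
    simp only [hd]
    linarith
  have hanti : ∀ k, P.obj (T.x (k + 1)) ≤ P.obj (T.x k) := fun k => by
    have h1 := hdec k
    have : 0 ≤ p.alpha / 2 * d k ^ 2 := by positivity
    linarith
  refine summable_of_sq_le (b := fun k => ψ (P.obj (T.x (k + 1)) - F)) (C := 2 * A / p.alpha)
    (N := N) (by positivity) (fun _ => norm_nonneg _) (fun k hk => ?_) (fun k hk => ?_)
    (fun k hk => ?_)
  · exact hψ0 _ ⟨sub_nonneg.2 (hFle _), (hN k hk).2.2.2⟩
  · exact hψm ⟨sub_nonneg.2 (hFle _), (hN (k + 1) (by omega)).2.2.2⟩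
      ⟨sub_nonneg.2 (hFle _), (hN k hk).2.2.2⟩ (sub_le_sub_right (hanti _) _)
  · obtain ⟨h1, h2, h3, -⟩ := hN k hk
    have h4 := hdec (k + 1)
    rcases (sub_nonneg.2 (hFle (k + 1))).eq_or_lt with h0 | h0
    · -- the limit value has been reached, so that the next step vanishes
      have h5 := hFle (k + 1 + 1)
      have h6 := hanti (k + 1)
      have h7 : P.obj (T.x (k + 1 + 1)) = P.obj (T.x (k + 1)) := by linarith
      have h8 : d (k + 1) ^ 2 = 0 := by
        rw [h7, sub_self] at h4
        have : 0 ≤ d (k + 1) ^ 2 := by positivity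
        nlinarith
      simp only [h7, sub_self, mul_zero]
      exact h8.le
    · have h5 : P.obj (T.x (k + 1)) - F ≤ b k := by
        simp only [hb, hd]
        linarith
      have h6 : (P.obj (T.x (k + 1)) - F) - (P.obj (T.x (k + 1 + 1)) - F)
          ≤ (ψ (P.obj (T.x (k + 1)) - F) - ψ (P.obj (T.x (k + 1 + 1)) - F)) * (A * d k) :=
        h1 h3 _ _ (sub_nonneg.2 (hFle _)) (sub_le_sub_right (hanti _) _) h5 (h0.trans_le h5)
      change d (k + 1) ^ 2 ≤ 2 * A / p.alpha * d k * _
      rw [div_mul_eq_mul_div, div_mul_eq_mul_div, le_div_iff₀ hα]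
      linarith

end IsRun

end MBA

/-- Full convergence of the inexact moving balls approximation method. -/
theorem theorem4p2 {n m : ℕ} (P : MBA.Problem n m) (O : Set (MBA.Vec n)) (hP : P.Standing O)
    (p : MBA.Params) (T : MBA.Trace n m) (hT : MBA.IsRun P p T)
    -- `xbar k` is the optimal solution of the `k`-th accepted subproblem
    (xbar : ℕ → MBA.Vec n)
    (hxbar : ∀ k, P.IsSubSol (T.x k) (T.xi k) (T.V k) (T.Lk k) (T.Qk k) (xbar k))
    (hsub : MBA.SubproblemSubregular P T)
    (hbdd : Bornology.IsBounded (Set.range T.x))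
    (hbmp : MBA.ClusterBMP P T xbar)
    -- the compact convex set and the decomposition from which the potential function is built
    (D : Set (MBA.Vec n)) (hDc : IsCompact D) (hDconv : Convex ℝ D) (hDO : D ⊆ O)
    (hxD : ∀ k, T.x k ∈ interior D)
    (S : MBA.Decomp n m) (hS : S.IsFor P D)
    (c : ℝ) (hc : 0 < c)
    (hKL : ∀ w, MapClusterPt w Filter.atTop (T.w xbar) → MBA.HasKL (MBA.potential P S c) w) :
    Summable (fun k => ‖T.x (k + 1) - T.x k‖) ∧
    (∃ xs ∈ T.omega, Filter.Tendsto T.x Filter.atTop (nhds xs)) ∧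
    T.omega ⊆ P.stationary := by
  obtain ⟨C, hC, hbd, hub, hest⟩ := hT.exists_estimates hP hxbar hbdd hbmp hDconv hS hxD
  have hest' := hest.mono fun k hk => And.intro hk.1 hk.2.2
  have hsum := hT.summable_step hP hDconv hS hxD hxbar hc hC hKL hbd hub
    (hest.mono fun k hk => hk.2.1) hest'
  refine ⟨hsum, ?_, hT.omega_subset_stationary hP hbd hest'⟩
  have hcauchy : CauchySeq T.x := cauchySeq_of_summable_dist (by
    refine hsum.congr fun k => ?_
    rw [dist_comm, dist_eq_norm])
  obtain ⟨xs, hxs⟩ := cauchySeq_tendsto_of_complete hcauchy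
  exact ⟨xs, hxs.mapClusterPt, hxs⟩
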